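/- **Theorem 1.2 (nonexistence of scattering).** Let $\alpha^1=\begin{pmatrix}0&1\\1&0\end{pmatrix}$, $\alpha^2=\begin{pmatrix}0&-i\\i&0\end{pmatrix}$, $\beta=\begin{pmatrix}1&0\\0&-1\end{pmatrix}$, $D=-i\nabla$ on $\mathbb R^2$, let $c\in\mathbb R\setminus\{0\}$, and let $\langle\cdot,\cdot\rangle$ be the inner product of $\mathbb C^2$. For $\gamma>0$ and $\psi,\phi:\mathbb R\times\mathbb R^2\to\mathbb C^2$ put $$\mathcal V(\psi,\phi)(t)=\int_{\mathbb R^2}\big(|\cdot|^{-\gamma}*\langle\psi,\phi\rangle\big)(t,x)\,\langle\psi,\phi\rangle(t,x)\,dx .$$ A *smooth global solution* is a function $\psi\in C^\infty(\mathbb R\times\mathbb R^2;\mathbb C^2)$ with $\psi(t)\in L^2(\mathbb R^2)$ for every $t$ that satisfies $$(-i\partial_t+\alpha\cdot D+\beta)\psi=\big(c|\cdot|^{-\gamma}*\langle\psi,\beta\psi\rangle\big)\beta\psi\quad\text{on }\mathbb R\times\mathbb R^2 .$$ A *smooth linear solution* is a function $\psi^\ell\in C^\infty(\mathbb R\times\mathbb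 R^2;\mathbb C^2)$ that satisfies $(-i\partial_t+\alpha\cdot D+\beta)\psi^\ell=0$ and for which $\psi^\ell(0)$ and all its partial derivatives are in $L^1(\mathbb R^2)$. The function $\psi$ *scatters forward to $\psi^\ell$ in* $\mathcal H$ if $\|\psi(t)-\psi^\ell(t)\|_{\mathcal H}\to0$ as $t\to+\infty$. Finally $\|f\|_{H^{s,\delta}}=\|(1-\Delta)^{s/2}f\|_{L^2}+\|(1+|x|)^\delta f\|_{L^2}$. (i) Let $0<\gamma<1$, and let $\psi$ be a smooth global solution that scatters forward in $L^2$ to a smooth linear solution $\psi^\ell$. Suppose that there are $0<\theta<1$ and $t_*>0$ such that $$|\mathcal V(\psi^\ell,\beta\psi^\ell)(t)|\ \ge\ \theta\,\mathcal V(\psi^\ell,\psi^\ell)(t)\qquad\text{for all }t>t_* .\tag{1}$$ Then $\psi=0$ and $\psi^\ell=0$ on $\mathbb R\times\mathbb R^2$. (ii) Let $\gamma=1$, and let $\psi$ be a smooth global solution that scatters forward in $H^{s,\delta}$, for some $s,\delta>0$ (arbitrarily small), to a smooth linear solution $\psi^\ell$. Suppose that (1) holds with $\gamma=1$ for some $0<\theta<1$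 and $t_*>0$. Then $\psi=0$ and $\psi^\ell=0$ on $\mathbb R\times\mathbb R^2$. -/

import Mathlib

open MeasureTheory Filter Topology
open scoped ENNReal ContDiff FourierTransform Convolution

noncomputable section

namespace HartreeDirac

/-- The Euclidean plane `ℝ²`. -/
abbrev Plane : Type := EuclideanSpace ℝ (Fin 2)

/-- The spin space `ℂ²`. -/
abbrev Spinor : Type := EuclideanSpace ℂ (Fin 2)

/-- The Dirac matrices `α¹, α²` (indexed by `0, 1`). -/
def alpha : Fin 2 → Matrix (Fin 2) (Fin 2) ℂ :=
  ![!![0, 1; 1, 0], !![0, -Complex.I; Complex.I, 0]]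

/-- The Dirac matrix `β`. -/
def beta : Matrix (Fin 2) (Fin 2) ℂ := !![1, 0; 0, -1]

/-- The action of a `2 × 2` matrix on a spinor. -/
def act (M : Matrix (Fin 2) (Fin 2) ℂ) (v : Spinor) : Spinor := Matrix.toEuclideanLin M v

/-- The pointwise inner product `⟨u, v⟩ = u₁ conj(v₁) + u₂ conj(v₂)` on `ℂ²`. -/
def dot (u v : Spinor) : ℂ := ∑ j, u j * (starRingEnd ℂ) (v j)

/-- The partial derivative `∂ⱼ f` of a spinor field on the plane. -/
def partialDeriv (j : Fin 2) (f : Plane → Spinor) (x : Plane) : Spinor :=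
  fderiv ℝ f x (EuclideanSpace.single j (1 : ℝ))

/-- The Dirac operator of mass one, `(α · D + β) f` with `D = -i∇`. -/
def diracOp (f : Plane → Spinor) (x : Plane) : Spinor :=
  (∑ j, act (alpha j) (-Complex.I • partialDeriv j f x)) + act beta (f x)

/-- The left side `(-i∂ₜ + α · D + β) ψ` at the point `(t, x)`. -/
def diracEvol (ψ : ℝ → Plane → Spinor) (t : ℝ) (x : Plane) : Spinor :=
  -Complex.I • deriv (fun τ => ψ τ x) t + diracOp (ψ t) x

/-- The Coulomb type potential `c |x|^{-γ}`. -/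
def potential (c γ : ℝ) (x : Plane) : ℂ := ((c * ‖x‖ ^ (-γ) : ℝ) : ℂ)

/-- Convolution of complex valued functions on the plane. -/
def conv (V f : Plane → ℂ) : Plane → ℂ :=
  V ⋆[ContinuousLinearMap.mul ℂ ℂ, volume] f

/-- The nonlinearity `(V * ⟨f, βf⟩) β f` with `V = c |x|^{-γ}`. -/
def hartree (c γ : ℝ) (f : Plane → Spinor) (x : Plane) : Spinor :=
  conv (potential c γ) (fun y => dot (f y) (act beta (f y))) x • act beta (f x)

/-- The functional `𝒱(f, g) = ∫ (|·|^{-γ} * ⟨f, g⟩) ⟨f, g⟩ dx`. -/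
def interaction (γ : ℝ) (f g : Plane → Spinor) : ℂ :=
  ∫ x, conv (potential 1 γ) (fun y => dot (f y) (g y)) x * dot (f x) (g x)

/-- `ψ` is a smooth global (classical) solution of
`(-i∂ₜ + α · D + β) ψ = (c|x|^{-γ} * ⟨ψ, βψ⟩) βψ` on `ℝ × ℝ²`, with values in `L²`. -/
structure IsSmoothGlobalSolution (c γ : ℝ) (ψ : ℝ → Plane → Spinor) : Prop where
  smooth : ContDiff ℝ ∞ (fun p : ℝ × Plane => ψ p.1 p.2)
  memL2 : ∀ t, MemLp (ψ t) 2 volume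
  equation : ∀ t x, diracEvol ψ t x = hartree c γ (ψ t) x

/-- `φ` is a smooth (classical) solution of `(-i∂ₜ + α · D + β) φ = 0` on `ℝ × ℝ²`, whose initial
datum has integrable derivatives of every order (order zero included). -/
structure IsSmoothLinearSolution (φ : ℝ → Plane → Spinor) : Prop where
  smooth : ContDiff ℝ ∞ (fun p : ℝ × Plane => φ p.1 p.2)
  integrable_data : ∀ n : ℕ, Integrable (iteratedFDeriv ℝ n (φ 0)) volume
  equation : ∀ t x, diracEvol φ t x = 0

open Classical in
/-- The norm `‖f‖_{H^s} = ‖⟨D⟩^s f‖_{L²}` for `f ∈ L²` (infinite if `f ∉ L²`). Mathlib's Fourier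
transform is unitary on `L²`, and its variable `ξ` corresponds to the frequency `2πξ`. -/
def sobolevNorm (s : ℝ) (f : Plane → Spinor) : ℝ≥0∞ :=
  if h : MemLp f 2 volume then
    eLpNorm (fun ξ : Plane =>
      ((1 + (2 * Real.pi * ‖ξ‖) ^ 2) ^ (s / 2) : ℝ) • (𝓕 (h.toLp f) : Lp Spinor 2 volume) ξ)
      2 volume
  else ⊤

/-- The norm `‖f‖_{H^{s,δ}} = ‖f‖_{H^s} + ‖(1 + |x|)^δ f‖_{L²}`. -/
def weightedSobolevNorm (s δ : ℝ) (f : Plane → Spinor) : ℝ≥0∞ :=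
  sobolevNorm s f + eLpNorm (fun x : Plane => ((1 + ‖x‖) ^ δ : ℝ) • f x) 2 volume

/-- `ψ` scatters forward to `φ` in `L²`. -/
def ScattersL2 (ψ φ : ℝ → Plane → Spinor) : Prop :=
  Tendsto (fun t => eLpNorm (fun x => ψ t x - φ t x) 2 volume) atTop (𝓝 0)

/-- `ψ` scatters forward to `φ` in `H^{s,δ}`. -/
def ScattersWeighted (s δ : ℝ) (ψ φ : ℝ → Plane → Spinor) : Prop :=
  Tendsto (fun t => weightedSobolevNorm s δ (fun x => ψ t x - φ t x)) atTop (𝓝 0)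

/-- For some `0 < θ < 1` and `t_* > 0`, `|𝒱(φ, βφ)(t)| ≥ θ 𝒱(φ, φ)(t)` for all `t > t_*`
(`𝒱(φ, φ)` is a nonnegative real number). -/
def InteractionLowerBound (γ : ℝ) (φ : ℝ → Plane → Spinor) : Prop :=
  ∃ θ : ℝ, 0 < θ ∧ θ < 1 ∧ ∃ tstar : ℝ, 0 < tstar ∧ ∀ t, tstar < t →
    θ * (interaction γ (φ t) (φ t)).re ≤
      ‖interaction γ (φ t) (fun x => act beta (φ t x))‖

end HartreeDirac

end

/-!
The proof compares two estimates for the overlap `∫ ⟨ψ(t), φ(t)⟩ dx` of the solution with its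
scattering state. It is bounded, by conservation of charge. Its time derivative is `i` times the
overlap of the nonlinearity with `φ`, and since `ψ - φ → 0` this is `c` times the interaction
functional of `φ` with `βφ`, up to an error of smaller order. The kernel `|x|^{-γ}` is positive
definite (`riesz_energy_nonneg`), so the functional is a nonnegative real number and the hypothesis
bounds it below by the one of `φ` with itself. As `φ` travels with speed at most one, a fixed part
`μ` of its charge stays in a ball of radius `R + t` (`exists_mass_ball`), where the kernel is at
least `(2 (R + t))^{-γ}`; hence the derivative has a sign and a size of at least a multiple of
`t^{-γ}`. For `γ ≤ 1` this is not integrable, a contradiction unless `φ` has no charge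
(`mass_eq_zero_of_scatters`), and then `ψ`, whose charge is conserved and tends to zero, vanishes
too.

For the error to be of smaller order, the potentials of `|φ|²` and of `|ψ - φ| |φ|` have to be
`O(t^{-γ})` uniformly in space (`lintegral_overlap_sub_le`). The first follows from the dispersive
decay `|φ| = O(1/t)` (`IsSmoothLinearSolution.exists_decay`), because the potential of a density
that is `O(t⁻²)` with finite mass is estimated by splitting at distance `t`. The components of `φ`
solve the Klein-Gordon equation; multiplied by `e^{iz}` they solve the wave equation in one more
dimension, Kirchhoff's formula applies (`integral_meanDensity`), and an integration by parts against
the phase gains the factor by which the formula fails to decay (`kleinGordon_decay`).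

The potential of `|ψ - φ| |φ|` is treated by the Cauchy-Schwarz inequality when `γ < 1`, since the
kernel `|x|^{-2γ}` is still locally integrable. For `γ = 1` it is not, and the weighted Sobolev norm
enters: `|ψ - φ|` has a bounded Coulomb potential (`exists_riesz_one_le`), where the weight controls
the far field, and the near field is summed over dyadic annuli, on each of which the low frequencies
are bounded and the high frequencies are small in `L²`.

No decay in space is assumed for the solutions, so all balance laws are localized by smooth cutoffs,
and the cutoffs are removed by Fatou's lemma or dominated convergence.
-/

noncomputable section

namespace HartreeDirac

/-! ### Kirchhoff's formula for the Klein-Gordon equation -/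

section SphericalMeans

variable {E : Type*} [NormedAddCommGroup E] [NormedSpace ℝ E]

/-- The derivative of `F` in the direction `v`. -/
def dirDeriv (v : E) (F : E → ℂ) (p : E) : ℂ := fderiv ℝ F p v

lemma contDiff_dirDeriv {F : E → ℂ} (hF : ContDiff ℝ ∞ F) (v : E) :
    ContDiff ℝ ∞ (dirDeriv v F) :=
  (hF.fderiv_right (m := ∞) (by simp)).clm_apply contDiff_const

lemma dirDeriv_comm {F : E → ℂ} (hF : ContDiff ℝ ∞ F) (v w : E) (p : E) :
    dirDeriv v (dirDeriv w F) p = dirDeriv w (dirDeriv v F) p := by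
  have hd : DifferentiableAt ℝ (fderiv ℝ F) p :=
    (hF.fderiv_right (m := ∞) (by simp)).differentiable (by simp) p
  have key : ∀ a b : E, dirDeriv a (dirDeriv b F) p = fderiv ℝ (fderiv ℝ F) p a b := by
    intro a b
    have := (hd.hasFDerivAt.clm_apply (hasFDerivAt_const b p)).fderiv
    unfold dirDeriv
    rw [this]; simp
  rw [key, key]
  exact (hF.contDiffAt.isSymmSndFDerivAt (by simp; exact WithTop.coe_le_coe.2 le_top)) v w

variable (e0 e1 e2 p0 : E) (T : ℝ)

/-- The point `p₀ + (T - s) e₀ + s sin θ (cos ζ e₁ + sin ζ e₂)` of the backward light cone with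
vertex at `s = 0`. -/
def conePoint (s θ ζ : ℝ) : E :=
  p0 + (T - s) • e0 + (s * Real.sin θ * Real.cos ζ) • e1 + (s * Real.sin θ * Real.sin ζ) • e2

/-- The density whose integral over the sphere of radius `s` is the spherical mean of
`v + s ∂ᵣv + s ∂ₜv`, taken at time distance `s` from the vertex, for the function `v = F e^{iz}` of
one more space variable `z = s cos θ`. If `F` solves the Klein-Gordon equation of mass one, then
`v` solves the wave equation in three dimensions. -/
def meanDensity (F : E → ℂ) (s θ ζ : ℝ) : ℂ :=
  let p := conePoint e0 e1 e2 p0 T s θ ζ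
  (Real.sin θ : ℂ) * Complex.exp (Complex.I * s * Real.cos θ) *
    (F p + s * (Real.sin θ * (Real.cos ζ * dirDeriv e1 F p + Real.sin ζ * dirDeriv e2 F p)
      + Complex.I * Real.cos θ * F p + dirDeriv e0 F p))

/-- The polar component of the flux that balances `meanDensity`. -/
def polarFlux (F : E → ℂ) (s θ ζ : ℝ) : ℂ :=
  let p := conePoint e0 e1 e2 p0 T s θ ζ
  (Real.sin θ : ℂ) * Complex.exp (Complex.I * s * Real.cos θ) *
    (Real.cos θ * (Real.cos ζ * dirDeriv e1 F p + Real.sin ζ * dirDeriv e2 F p)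
      - Complex.I * Real.sin θ * F p)

/-- The azimuthal component of the flux that balances `meanDensity`. -/
def azimuthalFlux (F : E → ℂ) (s θ ζ : ℝ) : ℂ :=
  let p := conePoint e0 e1 e2 p0 T s θ ζ
  Complex.exp (Complex.I * s * Real.cos θ) *
    (-Real.sin ζ * dirDeriv e1 F p + Real.cos ζ * dirDeriv e2 F p)

variable {e0 e1 e2 p0 T}

lemma hasDerivAt_conePoint_s {G : E → ℂ} (hG : ContDiff ℝ ∞ G) (s θ ζ : ℝ) :
    HasDerivAt (fun s => G (conePoint e0 e1 e2 p0 T s θ ζ))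
      (-dirDeriv e0 G (conePoint e0 e1 e2 p0 T s θ ζ)
        + Real.sin θ * Real.cos ζ * dirDeriv e1 G (conePoint e0 e1 e2 p0 T s θ ζ)
        + Real.sin θ * Real.sin ζ * dirDeriv e2 G (conePoint e0 e1 e2 p0 T s θ ζ)) s := by
  have h : HasDerivAt (fun s => conePoint e0 e1 e2 p0 T s θ ζ)
      ((-1 : ℝ) • e0 + (Real.sin θ * Real.cos ζ) • e1 + (Real.sin θ * Real.sin ζ) • e2) s := by
    unfold conePoint
    have h0 : HasDerivAt (fun s : ℝ => T - s) (-1) s := (hasDerivAt_id s).const_sub T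
    have h1 : HasDerivAt (fun s : ℝ => s * Real.sin θ * Real.cos ζ)
        (Real.sin θ * Real.cos ζ) s := by
      simpa using ((hasDerivAt_id s).mul_const (Real.sin θ)).mul_const (Real.cos ζ)
    have h2 : HasDerivAt (fun s : ℝ => s * Real.sin θ * Real.sin ζ)
        (Real.sin θ * Real.sin ζ) s := by
      simpa using ((hasDerivAt_id s).mul_const (Real.sin θ)).mul_const (Real.sin ζ)
    exact (((h0.smul_const e0).const_add p0).add (h1.smul_const e1)).add (h2.smul_const e2)
  have := (hG.differentiable (by simp) _).hasFDerivAt.comp_hasDerivAt s h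
  refine this.congr_deriv ?_
  simp [dirDeriv, mul_assoc]

lemma hasDerivAt_conePoint_theta {G : E → ℂ} (hG : ContDiff ℝ ∞ G) (s θ ζ : ℝ) :
    HasDerivAt (fun θ => G (conePoint e0 e1 e2 p0 T s θ ζ))
      (s * Real.cos θ * (Real.cos ζ * dirDeriv e1 G (conePoint e0 e1 e2 p0 T s θ ζ)
        + Real.sin ζ * dirDeriv e2 G (conePoint e0 e1 e2 p0 T s θ ζ))) θ := by
  have h : HasDerivAt (fun θ => conePoint e0 e1 e2 p0 T s θ ζ)
      ((s * Real.cos θ * Real.cos ζ) • e1 + (s * Real.cos θ * Real.sin ζ) • e2) θ := by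
    unfold conePoint
    have h1 := (((Real.hasDerivAt_sin θ).const_mul s).mul_const (Real.cos ζ)).smul_const e1
    have h2 := (((Real.hasDerivAt_sin θ).const_mul s).mul_const (Real.sin ζ)).smul_const e2
    exact (h1.const_add (p0 + (T - s) • e0)).add h2
  have := (hG.differentiable (by simp) _).hasFDerivAt.comp_hasDerivAt θ h
  refine this.congr_deriv ?_
  simp [dirDeriv]; ring

lemma hasDerivAt_conePoint_zeta {G : E → ℂ} (hG : ContDiff ℝ ∞ G) (s θ ζ : ℝ) :
    HasDerivAt (fun ζ => G (conePoint e0 e1 e2 p0 T s θ ζ))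
      (s * Real.sin θ * (-Real.sin ζ * dirDeriv e1 G (conePoint e0 e1 e2 p0 T s θ ζ)
        + Real.cos ζ * dirDeriv e2 G (conePoint e0 e1 e2 p0 T s θ ζ))) ζ := by
  have h : HasDerivAt (fun ζ => conePoint e0 e1 e2 p0 T s θ ζ)
      ((s * Real.sin θ * -Real.sin ζ) • e1 + (s * Real.sin θ * Real.cos ζ) • e2) ζ := by
    unfold conePoint
    have h1 := ((Real.hasDerivAt_cos ζ).const_mul (s * Real.sin θ)).smul_const e1
    have h2 := ((Real.hasDerivAt_sin ζ).const_mul (s * Real.sin θ)).smul_const e2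
    exact (h1.const_add (p0 + (T - s) • e0)).add h2
  have := (hG.differentiable (by simp) _).hasFDerivAt.comp_hasDerivAt ζ h
  refine this.congr_deriv ?_
  simp [dirDeriv]; ring

@[fun_prop]
lemma continuous_conePoint :
    Continuous (fun q : ℝ × ℝ × ℝ => conePoint e0 e1 e2 p0 T q.1 q.2.1 q.2.2) := by
  unfold conePoint; fun_prop

/-- The explicit value of `∂ₛ meanDensity`. -/
def meanDensityDeriv (e0 e1 e2 p0 : E) (T : ℝ) (F : E → ℂ) (s θ ζ : ℝ) : ℂ :=
  let p := conePoint e0 e1 e2 p0 T s θ ζ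
  let D : (E → ℂ) → ℂ := fun G => -dirDeriv e0 G p + Real.sin θ * Real.cos ζ * dirDeriv e1 G p
        + Real.sin θ * Real.sin ζ * dirDeriv e2 G p
  let A : ℂ := Real.sin θ * (Real.cos ζ * dirDeriv e1 F p + Real.sin ζ * dirDeriv e2 F p)
      + Complex.I * Real.cos θ * F p + dirDeriv e0 F p
  (Real.sin θ : ℂ) * Complex.exp (Complex.I * s * Real.cos θ) *
    (Complex.I * Real.cos θ * (F p + s * A) + D F + A +
      s * (Real.sin θ * (Real.cos ζ * D (dirDeriv e1 F) + Real.sin ζ * D (dirDeriv e2 F))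
      + Complex.I * Real.cos θ * D F + D (dirDeriv e0 F)))

lemma hasDerivAt_meanDensity {F : E → ℂ} (hF : ContDiff ℝ ∞ F) (s θ ζ : ℝ) :
    HasDerivAt (fun s => meanDensity e0 e1 e2 p0 T F s θ ζ)
      (meanDensityDeriv e0 e1 e2 p0 T F s θ ζ) s := by
  have hE : HasDerivAt (fun s : ℝ => Complex.exp (Complex.I * s * Real.cos θ))
      (Complex.exp (Complex.I * s * Real.cos θ) * (Complex.I * Real.cos θ)) s := by
    have h1 : HasDerivAt (fun s : ℝ => (s : ℂ)) 1 s := by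
      simpa using (hasDerivAt_id s).ofReal_comp
    simpa using ((h1.const_mul Complex.I).mul_const (Real.cos θ : ℂ)).cexp
  have h1 : HasDerivAt (fun s : ℝ => (s : ℂ)) 1 s := by
    simpa using (hasDerivAt_id s).ofReal_comp
  have hf := hasDerivAt_conePoint_s (e0 := e0) (e1 := e1) (e2 := e2) (p0 := p0) (T := T) hF s θ ζ
  have hf0 := hasDerivAt_conePoint_s (e0 := e0) (e1 := e1) (e2 := e2) (p0 := p0) (T := T)
    (contDiff_dirDeriv hF e0) s θ ζ
  have hf1 := hasDerivAt_conePoint_s (e0 := e0) (e1 := e1) (e2 := e2) (p0 := p0) (T := T)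
    (contDiff_dirDeriv hF e1) s θ ζ
  have hf2 := hasDerivAt_conePoint_s (e0 := e0) (e1 := e1) (e2 := e2) (p0 := p0) (T := T)
    (contDiff_dirDeriv hF e2) s θ ζ
  have := (hE.const_mul (Real.sin θ : ℂ)).mul (hf.add (h1.mul
    (((((hf1.const_mul (Real.cos ζ : ℂ)).add (hf2.const_mul (Real.sin ζ : ℂ))).const_mul
      (Real.sin θ : ℂ)).add (hf.const_mul (Complex.I * Real.cos θ))).add hf0)))
  refine (this.congr_deriv ?_)
  simp only [meanDensityDeriv, Pi.add_apply, Pi.mul_apply]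
  ring

/-- The explicit value of `∂_θ polarFlux`. -/
def polarFluxDeriv (e0 e1 e2 p0 : E) (T : ℝ) (F : E → ℂ) (s θ ζ : ℝ) : ℂ :=
  let p := conePoint e0 e1 e2 p0 T s θ ζ
  let D : (E → ℂ) → ℂ := fun G => s * Real.cos θ *
    (Real.cos ζ * dirDeriv e1 G p + Real.sin ζ * dirDeriv e2 G p)
  let X : ℂ := Complex.exp (Complex.I * s * Real.cos θ)
  let A : ℂ := Real.cos ζ * dirDeriv e1 F p + Real.sin ζ * dirDeriv e2 F p
  (Real.cos θ * X + Real.sin θ * (X * (Complex.I * s * -Real.sin θ))) *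
      (Real.cos θ * A - Complex.I * Real.sin θ * F p) +
    Real.sin θ * X * (-Real.sin θ * A +
      Real.cos θ * (Real.cos ζ * D (dirDeriv e1 F) + Real.sin ζ * D (dirDeriv e2 F)) -
      (Complex.I * Real.cos θ * F p + Complex.I * Real.sin θ * D F))

/-- The explicit value of `∂_ζ azimuthalFlux`. -/
def azimuthalFluxDeriv (e0 e1 e2 p0 : E) (T : ℝ) (F : E → ℂ) (s θ ζ : ℝ) : ℂ :=
  let p := conePoint e0 e1 e2 p0 T s θ ζ
  let D : (E → ℂ) → ℂ := fun G => s * Real.sin θ *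
    (-Real.sin ζ * dirDeriv e1 G p + Real.cos ζ * dirDeriv e2 G p)
  Complex.exp (Complex.I * s * Real.cos θ) *
    (-Real.cos ζ * dirDeriv e1 F p + -Real.sin ζ * D (dirDeriv e1 F) +
      (-Real.sin ζ * dirDeriv e2 F p + Real.cos ζ * D (dirDeriv e2 F)))

lemma hasDerivAt_polarFlux {F : E → ℂ} (hF : ContDiff ℝ ∞ F) (s θ ζ : ℝ) :
    HasDerivAt (fun θ => polarFlux e0 e1 e2 p0 T F s θ ζ)
      (polarFluxDeriv e0 e1 e2 p0 T F s θ ζ) θ := by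
  have hc : HasDerivAt (fun θ : ℝ => (Real.cos θ : ℂ)) (-Real.sin θ) θ := by
    simpa using (Real.hasDerivAt_cos θ).ofReal_comp
  have hs : HasDerivAt (fun θ : ℝ => (Real.sin θ : ℂ)) (Real.cos θ) θ := by
    simpa using (Real.hasDerivAt_sin θ).ofReal_comp
  have hE : HasDerivAt (fun θ : ℝ => Complex.exp (Complex.I * s * Real.cos θ))
      (Complex.exp (Complex.I * s * Real.cos θ) * (Complex.I * s * (-Real.sin θ))) θ :=
    (hc.const_mul (Complex.I * s)).cexp
  have hf := hasDerivAt_conePoint_theta (e0 := e0) (e1 := e1) (e2 := e2) (p0 := p0) (T := T)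
    hF s θ ζ
  have hf1 := hasDerivAt_conePoint_theta (e0 := e0) (e1 := e1) (e2 := e2) (p0 := p0) (T := T)
    (contDiff_dirDeriv hF e1) s θ ζ
  have hf2 := hasDerivAt_conePoint_theta (e0 := e0) (e1 := e1) (e2 := e2) (p0 := p0) (T := T)
    (contDiff_dirDeriv hF e2) s θ ζ
  refine ((hs.mul hE).mul ((hc.mul ((hf1.const_mul (Real.cos ζ : ℂ)).add
    (hf2.const_mul (Real.sin ζ : ℂ)))).sub ((hs.const_mul Complex.I).mul hf))).congr_deriv ?_
  simp only [polarFluxDeriv, Pi.mul_apply, Pi.add_apply, Pi.sub_apply]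

lemma hasDerivAt_azimuthalFlux {F : E → ℂ} (hF : ContDiff ℝ ∞ F) (s θ ζ : ℝ) :
    HasDerivAt (fun ζ => azimuthalFlux e0 e1 e2 p0 T F s θ ζ)
      (azimuthalFluxDeriv e0 e1 e2 p0 T F s θ ζ) ζ := by
  have hc : HasDerivAt (fun θ : ℝ => (Real.cos θ : ℂ)) (-Real.sin ζ) ζ := by
    simpa using (Real.hasDerivAt_cos ζ).ofReal_comp
  have hs : HasDerivAt (fun θ : ℝ => (Real.sin θ : ℂ)) (Real.cos ζ) ζ := by
    simpa using (Real.hasDerivAt_sin ζ).ofReal_comp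
  have hg1 := hasDerivAt_conePoint_zeta (e0 := e0) (e1 := e1) (e2 := e2) (p0 := p0) (T := T)
    (contDiff_dirDeriv hF e1) s θ ζ
  have hg2 := hasDerivAt_conePoint_zeta (e0 := e0) (e1 := e1) (e2 := e2) (p0 := p0) (T := T)
    (contDiff_dirDeriv hF e2) s θ ζ
  refine (((hs.neg.mul hg1).add (hc.mul hg2)).const_mul _).congr_deriv ?_
  simp only [azimuthalFluxDeriv, Pi.neg_apply]

/-- For a solution of the Klein-Gordon equation, `meanDensity` satisfies a conservation law on
the sphere: its `s`-derivative is a divergence in the angles, so that its integral over the sphere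
does not depend on `s`. -/
lemma meanDensityDeriv_eq {F : E → ℂ} (hF : ContDiff ℝ ∞ F)
    (hKG : ∀ p, dirDeriv e0 (dirDeriv e0 F) p =
      dirDeriv e1 (dirDeriv e1 F) p + dirDeriv e2 (dirDeriv e2 F) p - F p) (s θ ζ : ℝ) :
    meanDensityDeriv e0 e1 e2 p0 T F s θ ζ =
      -(polarFluxDeriv e0 e1 e2 p0 T F s θ ζ + azimuthalFluxDeriv e0 e1 e2 p0 T F s θ ζ) := by
  have c01 := dirDeriv_comm hF e0 e1 (conePoint e0 e1 e2 p0 T s θ ζ)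
  have c02 := dirDeriv_comm hF e0 e2 (conePoint e0 e1 e2 p0 T s θ ζ)
  have c12 := dirDeriv_comm hF e1 e2 (conePoint e0 e1 e2 p0 T s θ ζ)
  have kg := hKG (conePoint e0 e1 e2 p0 T s θ ζ)
  have q1 : (Real.sin θ : ℂ) ^ 2 = 1 - (Real.cos θ : ℂ) ^ 2 := by
    norm_cast; rw [Real.sin_sq]
  have q2 : (Real.sin ζ : ℂ) ^ 2 = 1 - (Real.cos ζ : ℂ) ^ 2 := by
    norm_cast; rw [Real.sin_sq]
  have hI : Complex.I ^ 2 = -1 := Complex.I_sq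
  simp only [meanDensityDeriv, polarFluxDeriv, azimuthalFluxDeriv]
  rw [c01, c02, c12, kg]
  -- what remains is a polynomial identity in the jet of `F` and the trigonometric functions
  generalize dirDeriv e1 (dirDeriv e1 F) (conePoint e0 e1 e2 p0 T s θ ζ) = f11
  generalize dirDeriv e2 (dirDeriv e2 F) (conePoint e0 e1 e2 p0 T s θ ζ) = f22
  generalize dirDeriv e2 (dirDeriv e1 F) (conePoint e0 e1 e2 p0 T s θ ζ) = f12
  generalize dirDeriv e1 (dirDeriv e0 F) (conePoint e0 e1 e2 p0 T s θ ζ) = f01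
  generalize dirDeriv e2 (dirDeriv e0 F) (conePoint e0 e1 e2 p0 T s θ ζ) = f02
  generalize dirDeriv e0 F (conePoint e0 e1 e2 p0 T s θ ζ) = f0
  generalize dirDeriv e1 F (conePoint e0 e1 e2 p0 T s θ ζ) = f1
  generalize dirDeriv e2 F (conePoint e0 e1 e2 p0 T s θ ζ) = f2
  generalize F (conePoint e0 e1 e2 p0 T s θ ζ) = f
  generalize Complex.exp (Complex.I * s * Real.cos θ) = X
  generalize (Real.sin θ : ℂ) = a at *
  generalize (Real.cos θ : ℂ) = b at *
  generalize (Real.sin ζ : ℂ) = c at *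
  generalize (Real.cos ζ : ℂ) = d at *
  clear c01 c02 c12 kg hKG
  generalize Complex.I = i at *
  generalize (s : ℂ) = s at *
  grind

lemma continuous_meanDensity {F : E → ℂ} (hF : ContDiff ℝ ∞ F) :
    Continuous (fun q : ℝ × ℝ × ℝ => meanDensity e0 e1 e2 p0 T F q.1 q.2.1 q.2.2) := by
  have h := hF.continuous
  have h' := fun v => (contDiff_dirDeriv hF v).continuous
  have h0 := h' e0
  have h1 := h' e1
  have h2 := h' e2
  simp only [meanDensity]
  fun_prop

lemma continuous_meanDensity_sphere {F : E → ℂ} (hF : ContDiff ℝ ∞ F) (s : ℝ) :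
    Continuous (fun q : ℝ × ℝ => meanDensity e0 e1 e2 p0 T F s q.1 q.2) := by
  have h : Continuous fun q : ℝ × ℝ => (s, q.1, q.2) := by fun_prop
  have h' := (continuous_meanDensity (e0 := e0) (e1 := e1) (e2 := e2) (p0 := p0) (T := T) hF).comp h
  simpa only [Function.comp_def] using h'

lemma continuous_meanDensity_meridian {F : E → ℂ} (hF : ContDiff ℝ ∞ F) (s ζ : ℝ) :
    Continuous (fun θ : ℝ => meanDensity e0 e1 e2 p0 T F s θ ζ) := by
  have h : Continuous fun θ : ℝ => (θ, ζ) := by fun_prop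
  have h' := (continuous_meanDensity_sphere (e0 := e0) (e1 := e1) (e2 := e2) (p0 := p0) (T := T)
    hF s).comp h
  simpa only [Function.comp_def] using h'

lemma continuous_fluxDeriv {F : E → ℂ} (hF : ContDiff ℝ ∞ F) :
    Continuous (fun q : ℝ × ℝ × ℝ => polarFluxDeriv e0 e1 e2 p0 T F q.1 q.2.1 q.2.2) ∧
    Continuous (fun q : ℝ × ℝ × ℝ => azimuthalFluxDeriv e0 e1 e2 p0 T F q.1 q.2.1 q.2.2) := by
  have h := hF.continuous
  have h' := fun v => (contDiff_dirDeriv hF v).continuous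
  have h'' := fun v w => (contDiff_dirDeriv (contDiff_dirDeriv hF v) w).continuous
  have h1 := h' e1
  have h2 := h' e2
  have h11 := h'' e1 e1
  have h12 := h'' e1 e2
  have h21 := h'' e2 e1
  have h22 := h'' e2 e2
  constructor
  · simp only [polarFluxDeriv]
    fun_prop
  · simp only [azimuthalFluxDeriv]
    fun_prop

lemma intervalIntegral_swap_of_continuous {G : Type*} [NormedAddCommGroup G] [NormedSpace ℝ G]
    {f : ℝ → ℝ → G}
    (hf : Continuous (fun q : ℝ × ℝ => f q.1 q.2)) {a b c d : ℝ} (hab : a ≤ b) (hcd : c ≤ d) :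
    ∫ x in a..b, ∫ y in c..d, f x y = ∫ y in c..d, ∫ x in a..b, f x y := by
  simp only [intervalIntegral.integral_of_le hab, intervalIntegral.integral_of_le hcd]
  apply integral_integral_swap
  rw [Measure.prod_restrict]
  exact (hf.continuousOn.integrableOn_compact (isCompact_Icc.prod isCompact_Icc)).mono_set
    (Set.prod_mono Set.Ioc_subset_Icc_self Set.Ioc_subset_Icc_self)

open Real in
/-- Kirchhoff's formula, by descent from three dimensions: the value of a solution of the
Klein-Gordon equation at the vertex of the cone is the spherical mean of its data at the base. -/
theorem integral_meanDensity {F : E → ℂ} (hF : ContDiff ℝ ∞ F)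
    (hKG : ∀ p, dirDeriv e0 (dirDeriv e0 F) p =
      dirDeriv e1 (dirDeriv e1 F) p + dirDeriv e2 (dirDeriv e2 F) p - F p)
    (hT : 0 ≤ T) :
    ∫ θ in (0 : ℝ)..π, ∫ ζ in -π..π, meanDensity e0 e1 e2 p0 T F T θ ζ
      = 4 * π * F (p0 + T • e0) := by
  obtain ⟨cA, cB⟩ := continuous_fluxDeriv (e0 := e0) (e1 := e1) (e2 := e2) (p0 := p0) (T := T) hF
  have cI := continuous_meanDensity (e0 := e0) (e1 := e1) (e2 := e2) (p0 := p0) (T := T) hF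
  set A := polarFluxDeriv e0 e1 e2 p0 T F with hA
  set B := azimuthalFluxDeriv e0 e1 e2 p0 T F with hB
  set J := meanDensity e0 e1 e2 p0 T F with hJ
  have hD : ∀ s θ ζ, HasDerivAt (fun s => J s θ ζ) (-(A s θ ζ + B s θ ζ)) s := by
    intro s θ ζ
    rw [← meanDensityDeriv_eq hF hKG]
    exact hasDerivAt_meanDensity hF s θ ζ
  have hAint : ∀ s ζ, ∫ θ in (0 : ℝ)..π, A s θ ζ = 0 := by
    intro s ζ
    rw [intervalIntegral.integral_eq_sub_of_hasDerivAt
      (fun θ _ => hasDerivAt_polarFlux hF s θ ζ)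
      ((cA.comp (f := fun θ => (s, θ, ζ)) (by fun_prop)).intervalIntegrable _ _)]
    simp [polarFlux]
  have hBint : ∀ s θ, ∫ ζ in -π..π, B s θ ζ = 0 := by
    intro s θ
    rw [intervalIntegral.integral_eq_sub_of_hasDerivAt
      (fun ζ _ => hasDerivAt_azimuthalFlux hF s θ ζ)
      ((cB.comp (f := fun ζ => (s, θ, ζ)) (by fun_prop)).intervalIntegrable _ _)]
    simp [azimuthalFlux, conePoint]
  have cA' : Continuous (fun q : ℝ × ℝ => ∫ s in (0 : ℝ)..T, A s q.1 q.2) :=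
    intervalIntegral.continuous_parametric_intervalIntegral_of_continuous' (by fun_prop) 0 T
  have cB' : Continuous (fun q : ℝ × ℝ => ∫ s in (0 : ℝ)..T, B s q.1 q.2) :=
    intervalIntegral.continuous_parametric_intervalIntegral_of_continuous' (by fun_prop) 0 T
  have hsub : ∀ θ ζ, J T θ ζ = Real.sin θ * F (p0 + T • e0) -
      ((∫ s in (0 : ℝ)..T, A s θ ζ) + ∫ s in (0 : ℝ)..T, B s θ ζ) := by
    intro θ ζ
    -- at the vertex `s = 0` the density reduces to `sin θ` times the value of `F`
    have h0 : J 0 θ ζ = Real.sin θ * F (p0 + T • e0) := by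
      simp [hJ, meanDensity, conePoint]
    have := intervalIntegral.integral_eq_sub_of_hasDerivAt (a := 0) (b := T)
      (fun s _ => hD s θ ζ) (Continuous.intervalIntegrable (by fun_prop) _ _)
    rw [intervalIntegral.integral_neg, intervalIntegral.integral_add
      (Continuous.intervalIntegrable (by fun_prop) _ _)
      (Continuous.intervalIntegrable (by fun_prop) _ _), h0] at this
    linear_combination -this
  have hpi : -π ≤ π := by linarith [pi_pos]
  have hzA : ∫ θ in (0 : ℝ)..π, ∫ ζ in -π..π, ∫ s in (0 : ℝ)..T, A s θ ζ = 0 := by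
    rw [intervalIntegral_swap_of_continuous cA' pi_pos.le hpi]
    have : ∀ ζ, ∫ θ in (0 : ℝ)..π, ∫ s in (0 : ℝ)..T, A s θ ζ = 0 := by
      intro ζ
      rw [intervalIntegral_swap_of_continuous (f := fun θ s => A s θ ζ) (by fun_prop) pi_pos.le hT]
      simp [hAint]
    simp [this]
  have hzB : ∫ θ in (0 : ℝ)..π, ∫ ζ in -π..π, ∫ s in (0 : ℝ)..T, B s θ ζ = 0 := by
    have : ∀ θ, ∫ ζ in -π..π, ∫ s in (0 : ℝ)..T, B s θ ζ = 0 := by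
      intro θ
      rw [intervalIntegral_swap_of_continuous (f := fun ζ s => B s θ ζ) (by fun_prop) hpi hT]
      simp [hBint]
    simp [this]
  have hin : ∀ θ, ∫ ζ in -π..π, J T θ ζ = 2 * π * (Real.sin θ * F (p0 + T • e0)) -
      ((∫ ζ in -π..π, ∫ s in (0 : ℝ)..T, A s θ ζ) +
        ∫ ζ in -π..π, ∫ s in (0 : ℝ)..T, B s θ ζ) := by
    intro θ
    have i1 : IntervalIntegrable (fun ζ => ∫ s in (0 : ℝ)..T, A s θ ζ) volume (-π) π :=
      (cA'.comp (f := fun ζ => (θ, ζ)) (by fun_prop)).intervalIntegrable _ _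
    have i2 : IntervalIntegrable (fun ζ => ∫ s in (0 : ℝ)..T, B s θ ζ) volume (-π) π :=
      (cB'.comp (f := fun ζ => (θ, ζ)) (by fun_prop)).intervalIntegrable _ _
    simp_rw [hsub]
    rw [intervalIntegral.integral_sub (by simp) (i1.add i2), intervalIntegral.integral_add i1 i2]
    simp
    ring
  have i1 : IntervalIntegrable (fun θ => ∫ ζ in -π..π, ∫ s in (0 : ℝ)..T, A s θ ζ) volume 0 π :=
    (intervalIntegral.continuous_parametric_intervalIntegral_of_continuous' cA' (-π) π
      ).intervalIntegrable _ _
  have i2 : IntervalIntegrable (fun θ => ∫ ζ in -π..π, ∫ s in (0 : ℝ)..T, B s θ ζ) volume 0 π :=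
    (intervalIntegral.continuous_parametric_intervalIntegral_of_continuous' cB' (-π) π
      ).intervalIntegrable _ _
  simp_rw [hin]
  rw [intervalIntegral.integral_sub (Continuous.intervalIntegrable (by fun_prop) _ _) (i1.add i2),
    intervalIntegral.integral_add i1 i2, hzA, hzB]
  have : ∫ θ in (0 : ℝ)..π, (Real.sin θ : ℂ) = 2 := by
    rw [intervalIntegral.integral_ofReal, integral_sin]; norm_num
  rw [intervalIntegral.integral_const_mul, intervalIntegral.integral_mul_const, this]
  ring

end SphericalMeans

/-! ### Dispersive decay for the Klein-Gordon equation -/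

section Decay

/-- The `j`-th coordinate vector of the plane. -/
abbrev basisVec (j : Fin 2) : Plane := EuclideanSpace.single j (1 : ℝ)

/-- The unit vector in the time direction of space-time. -/
abbrev timeVec : ℝ × Plane := (1, 0)

/-- The unit vector in the direction of the `j`-th space coordinate of space-time. -/
abbrev spaceVec (j : Fin 2) : ℝ × Plane := (0, basisVec j)

/-- The map `(a, b) ↦ x₀ + a e₁ + b e₂` preserves Lebesgue measure. -/
lemma lintegral_plane_eq (m : Plane → ℝ≥0∞) (x0 : Plane) :
    ∫⁻ q : ℝ × ℝ, m (x0 + q.1 • basisVec 0 + q.2 • basisVec 1) = ∫⁻ y, m y := by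
  have h1 := (PiLp.volume_preserving_toLp (Fin 2)).comp
    (volume_preserving_finTwoArrow ℝ).symm
  have h2 : ∀ q : ℝ × ℝ, x0 + q.1 • basisVec 0 + q.2 • basisVec 1 =
      x0 + (WithLp.toLp 2 ((MeasurableEquiv.finTwoArrow (α := ℝ)).symm q) : Plane) := by
    intro q
    rw [add_assoc]; congr 1
    ext j; fin_cases j <;> simp [MeasurableEquiv.finTwoArrow]
  simp_rw [h2]
  rw [← lintegral_add_left_eq_self m x0]
  have := h1.lintegral_comp_emb (MeasurableEquiv.measurableEmbedding
    ((MeasurableEquiv.finTwoArrow (α := ℝ)).symm.trans (MeasurableEquiv.toLp 2 (Fin 2 → ℝ))))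
    (fun y => m (x0 + y))
  exact this

/-- The point `x₀ + ρ (cos ζ, sin ζ)`. -/
def polarPoint (x0 : Plane) (ρ ζ : ℝ) : Plane :=
  x0 + (ρ * Real.cos ζ) • basisVec 0 + (ρ * Real.sin ζ) • basisVec 1

@[fun_prop]
lemma continuous_polarPoint (x0 : Plane) :
    Continuous (fun q : ℝ × ℝ => polarPoint x0 q.1 q.2) := by
  unfold polarPoint; fun_prop

lemma lintegral_polar (m : Plane → ℝ≥0∞) (hm : Measurable m) (x0 : Plane) :
    ∫⁻ ρ in Set.Ioi (0 : ℝ), ENNReal.ofReal ρ *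
      ∫⁻ ζ in Set.Ioo (-Real.pi) Real.pi, m (polarPoint x0 ρ ζ) = ∫⁻ y, m y := by
  rw [← lintegral_plane_eq m x0, ← lintegral_comp_polarCoord_symm]
  have hmeas : Measurable (fun q : ℝ × ℝ => m (polarPoint x0 q.1 q.2)) :=
    hm.comp (continuous_polarPoint x0).measurable
  have : (polarCoord.target) = Set.Ioi (0 : ℝ) ×ˢ Set.Ioo (-Real.pi) Real.pi := rfl
  have hsymm : ∀ p : ℝ × ℝ, m (x0 + (polarCoord.symm p).1 • basisVec 0 +
      (polarCoord.symm p).2 • basisVec 1) = m (polarPoint x0 p.1 p.2) := fun p => rfl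
  simp_rw [hsymm, smul_eq_mul]
  rw [this, Measure.volume_eq_prod, ← Measure.prod_restrict, lintegral_prod]
  · refine lintegral_congr fun ρ => ?_
    exact (lintegral_const_mul _
      (hmeas.comp (by fun_prop : Measurable fun ζ : ℝ => (ρ, ζ)))).symm
  · exact ((ENNReal.measurable_ofReal.comp measurable_fst).mul hmeas).aemeasurable

/-- Projecting a hemisphere of radius `T` onto the plane turns the measure `sin θ |cos θ| dθ dζ`
into `T⁻²` times Lebesgue measure; `S` is the range of the polar angle, on which the projection has
to be injective. -/
lemma lintegral_hemisphere_le (m : Plane → ℝ≥0∞) (hm : Measurable m) (x0 : Plane) {T : ℝ}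
    (hT : 0 < T) {S : Set ℝ} (hS : MeasurableSet S) (hSp : S ⊆ Set.Ioo 0 Real.pi)
    (hinj : Set.InjOn Real.sin S) :
    ∫⁻ θ in S, ENNReal.ofReal (Real.sin θ * |Real.cos θ|) *
      ∫⁻ ζ in Set.Ioo (-Real.pi) Real.pi, m (polarPoint x0 (T * Real.sin θ) ζ) ≤
      ENNReal.ofReal (1 / T ^ 2) * ∫⁻ y, m y := by
  set g : ℝ → ℝ≥0∞ := fun ρ => ∫⁻ ζ in Set.Ioo (-Real.pi) Real.pi, m (polarPoint x0 ρ ζ) with hg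
  have hsub := lintegral_image_eq_lintegral_abs_deriv_mul hS
    (f := fun θ => T * Real.sin θ) (f' := fun θ => T * Real.cos θ)
    (fun θ _ => ((Real.hasDerivAt_sin θ).const_mul T).hasDerivWithinAt)
    (fun a ha b hb hab => hinj ha hb (mul_left_cancel₀ hT.ne' hab))
    (fun ρ => ENNReal.ofReal ρ * g ρ)
  have himg : (fun θ => T * Real.sin θ) '' S ⊆ Set.Ioi 0 := by
    rintro _ ⟨θ, hθ, rfl⟩
    exact mul_pos hT (Real.sin_pos_of_pos_of_lt_pi (hSp hθ).1 (hSp hθ).2)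
  have hle : ∫⁻ θ in S, ENNReal.ofReal |T * Real.cos θ| *
      (ENNReal.ofReal (T * Real.sin θ) * g (T * Real.sin θ)) ≤ ∫⁻ y, m y := by
    rw [← hsub, ← lintegral_polar m hm x0]
    exact lintegral_mono_set himg
  calc _ = ∫⁻ θ in S, ENNReal.ofReal (1 / T ^ 2) * (ENNReal.ofReal |T * Real.cos θ| *
        (ENNReal.ofReal (T * Real.sin θ) * g (T * Real.sin θ))) := by
        refine setLIntegral_congr_fun hS fun θ hθ => ?_
        have hs := (Real.sin_pos_of_pos_of_lt_pi (hSp hθ).1 (hSp hθ).2).le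
        simp only [← mul_assoc]
        congr 1
        rw [← ENNReal.ofReal_mul (by positivity), ← ENNReal.ofReal_mul (by positivity)]
        congr 1
        rw [abs_mul, abs_of_pos hT]; field_simp
    _ = ENNReal.ofReal (1 / T ^ 2) * ∫⁻ θ in S, (ENNReal.ofReal |T * Real.cos θ| *
        (ENNReal.ofReal (T * Real.sin θ) * g (T * Real.sin θ))) :=
        lintegral_const_mul' _ _ ENNReal.ofReal_ne_top
    _ ≤ _ := by gcongr

/-- The two hemispheres together give the factor two. -/
lemma lintegral_sphere_le (m : Plane → ℝ≥0∞) (hm : Measurable m) (x0 : Plane) {T : ℝ}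
    (hT : 0 < T) :
    ∫⁻ θ in Set.Ioc 0 Real.pi, ENNReal.ofReal (Real.sin θ * |Real.cos θ|) *
      ∫⁻ ζ in Set.Ioo (-Real.pi) Real.pi, m (polarPoint x0 (T * Real.sin θ) ζ) ≤
      ENNReal.ofReal (2 / T ^ 2) * ∫⁻ y, m y := by
  have hp := Real.pi_pos
  have hsplit : (Set.Ioo 0 Real.pi : Set ℝ) ⊆
      Set.Ioo 0 (Real.pi / 2) ∪ (Set.Ioo (Real.pi / 2) Real.pi ∪ {Real.pi / 2}) := by
    intro x hx
    rcases lt_trichotomy x (Real.pi / 2) with h | h | h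
    · exact Or.inl ⟨hx.1, h⟩
    · exact Or.inr (Or.inr h)
    · exact Or.inr (Or.inl ⟨h, hx.2⟩)
  have hi1 : Set.InjOn Real.sin (Set.Ioo 0 (Real.pi / 2)) :=
    Real.injOn_sin.mono fun x hx => Set.mem_Icc.2 ⟨by linarith [hx.1], hx.2.le⟩
  have hi2 : Set.InjOn Real.sin (Set.Ioo (Real.pi / 2) Real.pi) := by
    intro a ha b hb hab
    rw [← Real.sin_pi_sub a, ← Real.sin_pi_sub b] at hab
    have ma : Real.pi - a ∈ Set.Icc (-(Real.pi / 2)) (Real.pi / 2) :=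
      ⟨by linarith [ha.2], by linarith [ha.1]⟩
    have mb : Real.pi - b ∈ Set.Icc (-(Real.pi / 2)) (Real.pi / 2) :=
      ⟨by linarith [hb.2], by linarith [hb.1]⟩
    have := Real.injOn_sin ma mb hab
    linarith
  rw [setLIntegral_congr Ioo_ae_eq_Ioc.symm]
  refine (lintegral_mono_set hsplit).trans ((lintegral_union_le _ _ _).trans ?_)
  refine (add_le_add (lintegral_hemisphere_le m hm x0 hT measurableSet_Ioo
    (Set.Ioo_subset_Ioo_right (by linarith)) hi1) ((lintegral_union_le _ _ _).trans
    (add_le_add (lintegral_hemisphere_le m hm x0 hT measurableSet_Ioo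
    (Set.Ioo_subset_Ioo_left (by linarith)) hi2) (le_of_eq (b := 0) (by simp))))).trans ?_
  rw [add_zero, ← add_mul, ← ENNReal.ofReal_add (by positivity) (by positivity)]
  apply le_of_eq; congr 2; ring

lemma integral_sphere_le {M : Plane → ℝ} (hM : Continuous M) (hM0 : ∀ y, 0 ≤ M y)
    (hMi : Integrable M) (x0 : Plane) {T : ℝ} (hT : 0 < T) :
    ∫ θ in (0 : ℝ)..Real.pi, ∫ ζ in -Real.pi..Real.pi,
      Real.sin θ * |Real.cos θ| * M (polarPoint x0 (T * Real.sin θ) ζ) ≤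
      2 / T ^ 2 * ∫ y, M y := by
  have hp := Real.pi_pos
  have hcont : Continuous (fun q : ℝ × ℝ =>
      Real.sin q.1 * |Real.cos q.1| * M (polarPoint x0 (T * Real.sin q.1) q.2)) := by
    fun_prop
  have hin : ∀ θ ∈ Set.Ioc 0 Real.pi, ENNReal.ofReal (∫ ζ in -Real.pi..Real.pi,
      Real.sin θ * |Real.cos θ| * M (polarPoint x0 (T * Real.sin θ) ζ)) =
      ENNReal.ofReal (Real.sin θ * |Real.cos θ|) *
      ∫⁻ ζ in Set.Ioo (-Real.pi) Real.pi,
        ENNReal.ofReal (M (polarPoint x0 (T * Real.sin θ) ζ)) := by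
    intro θ hθ
    have hs := Real.sin_nonneg_of_nonneg_of_le_pi hθ.1.le hθ.2
    rw [intervalIntegral.integral_const_mul, ENNReal.ofReal_mul (by positivity),
      intervalIntegral.integral_of_le (by linarith), ofReal_integral_eq_lintegral_ofReal,
      setLIntegral_congr Ioo_ae_eq_Ioc.symm]
    · exact (Continuous.integrableOn_Ioc (by fun_prop))
    · exact ae_of_all _ fun _ => hM0 _
  have hnn : ∀ θ ∈ Set.Ioc 0 Real.pi, 0 ≤ ∫ ζ in -Real.pi..Real.pi,
      Real.sin θ * |Real.cos θ| * M (polarPoint x0 (T * Real.sin θ) ζ) := by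
    intro θ hθ
    have hs := Real.sin_nonneg_of_nonneg_of_le_pi hθ.1.le hθ.2
    exact intervalIntegral.integral_nonneg (by linarith) fun ζ _ =>
      mul_nonneg (by positivity) (hM0 _)
  have hI0 : 0 ≤ ∫ y, M y := integral_nonneg hM0
  rw [← ENNReal.ofReal_le_ofReal_iff (by positivity), ENNReal.ofReal_mul (by positivity),
    ofReal_integral_eq_lintegral_ofReal hMi (ae_of_all _ hM0),
    intervalIntegral.integral_of_le hp.le, ofReal_integral_eq_lintegral_ofReal]
  · rw [setLIntegral_congr_fun measurableSet_Ioc hin]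
    exact lintegral_sphere_le _ (hM.measurable.ennreal_ofReal) x0 hT
  · exact (intervalIntegral.continuous_parametric_intervalIntegral_of_continuous' hcont
      (-Real.pi) Real.pi).integrableOn_Ioc
  · exact (ae_restrict_iff' measurableSet_Ioc).2 (ae_of_all _ hnn)

set_option maxHeartbeats 400000 in
/-- Integration by parts in the polar angle: the factor `T sin θ` is absorbed by the phase
`e^{iT cos θ}`, whose `θ`-derivative is `-iT sin θ e^{iT cos θ}`. Writing `1 = cos² θ + sin² θ`,
the `cos²`-part is left alone and the `sin²`-part, which vanishes at both poles, is integrated by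
parts, so that every remaining term carries a factor `sin θ |cos θ|`. -/
lemma norm_integral_meanDensity_le {F : ℝ × Plane → ℂ} (hF : ContDiff ℝ ∞ F) {M : Plane → ℝ}
    (hMc : Continuous M) (hM : ∀ y, ‖F (0, y)‖ ≤ M y)
    (hM0 : ∀ y, ‖dirDeriv timeVec F (0, y)‖ ≤ M y)
    (hM1 : ∀ j y, ‖dirDeriv (spaceVec j) F (0, y)‖ ≤ M y)
    (hM01 : ∀ j y, ‖dirDeriv (spaceVec j) (dirDeriv timeVec F) (0, y)‖ ≤ M y)
    (hM2 : ∀ i j y, ‖dirDeriv (spaceVec i) (dirDeriv (spaceVec j) F) (0, y)‖ ≤ M y)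
    (x0 : Plane) {T : ℝ} (hT : 1 ≤ T) (ζ : ℝ) :
    ‖∫ θ in (0 : ℝ)..Real.pi, meanDensity timeVec (spaceVec 0) (spaceVec 1) (0, x0) T F T θ ζ‖ ≤
      ∫ θ in (0 : ℝ)..Real.pi, 23 * T * (Real.sin θ * |Real.cos θ| *
        M (polarPoint x0 (T * Real.sin θ) ζ)) := by
  have hp := Real.pi_pos
  have hT0 : (0 : ℝ) < T := by linarith
  have hTC : (T : ℂ) ≠ 0 := by exact_mod_cast hT0.ne'
  set P : ℝ → ℝ × Plane := fun θ => conePoint timeVec (spaceVec 0) (spaceVec 1) (0, x0) T T θ ζ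
    with hP
  have hPeq : ∀ θ, P θ = (0, polarPoint x0 (T * Real.sin θ) ζ) := by
    intro θ; simp [hP, conePoint, polarPoint]
  have hPc : Continuous P := by
    have := continuous_conePoint (e0 := timeVec) (e1 := spaceVec 0) (e2 := spaceVec 1)
      (p0 := ((0 : ℝ), x0)) (T := T)
    exact this.comp (by fun_prop : Continuous fun θ : ℝ => (T, θ, ζ))
  have hF1 := contDiff_dirDeriv hF (spaceVec 0)
  have hF2 := contDiff_dirDeriv hF (spaceVec 1)
  have hF0 := contDiff_dirDeriv hF timeVec
  -- the derivative of `G` in the direction `(cos ζ, sin ζ)`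
  set De : (ℝ × Plane → ℂ) → ℝ → ℂ := fun G θ =>
    Real.cos ζ * dirDeriv (spaceVec 0) G (P θ) + Real.sin ζ * dirDeriv (spaceVec 1) G (P θ)
    with hDe
  have hd : ∀ {G : ℝ × Plane → ℂ}, ContDiff ℝ ∞ G → ∀ θ,
      HasDerivAt (fun θ => G (P θ)) (T * Real.cos θ * De G θ) θ :=
    fun hG θ => hasDerivAt_conePoint_theta hG T θ ζ
  set DDe : ℝ → ℂ := fun θ => Real.cos ζ * De (dirDeriv (spaceVec 0) F) θ +
    Real.sin ζ * De (dirDeriv (spaceVec 1) F) θ with hDDe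
  have hDed : ∀ θ, HasDerivAt (fun θ => De F θ) (T * Real.cos θ * DDe θ) θ := by
    intro θ
    refine (((hd hF1 θ).const_mul (Real.cos ζ : ℂ)).add
      ((hd hF2 θ).const_mul (Real.sin ζ : ℂ))).congr_deriv ?_
    simp only [hDDe]; ring
  set X : ℝ → ℂ := fun θ => Complex.exp (Complex.I * T * Real.cos θ) with hX
  have hc : ∀ θ : ℝ, HasDerivAt (fun θ : ℝ => (Real.cos θ : ℂ)) (-Real.sin θ) θ := fun θ => by
    simpa using (Real.hasDerivAt_cos θ).ofReal_comp
  have hs : ∀ θ : ℝ, HasDerivAt (fun θ : ℝ => (Real.sin θ : ℂ)) (Real.cos θ) θ := fun θ => by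
    simpa using (Real.hasDerivAt_sin θ).ofReal_comp
  have hXd : ∀ θ : ℝ, HasDerivAt X (X θ * (Complex.I * T * -Real.sin θ)) θ := fun θ =>
    ((hc θ).const_mul (Complex.I * T)).cexp
  have hXn : ∀ θ, ‖X θ‖ = 1 := by
    intro θ
    have : Complex.I * T * Real.cos θ = ((T * Real.cos θ : ℝ) : ℂ) * Complex.I := by
      push_cast; ring
    simp only [hX]
    rw [this, Complex.norm_exp_ofReal_mul_I]
  -- `meanDensity = sin θ X (T h + i T cos θ F)`: only the term `T h` lacks a factor `cos θ`
  set h : ℝ → ℂ := fun θ => F (P θ) / T + Real.sin θ * De F θ + dirDeriv timeVec F (P θ) with hh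
  set h' : ℝ → ℂ := fun θ => De F θ + De F θ + T * Real.sin θ * DDe θ +
    T * De (dirDeriv timeVec F) θ with hh'
  have hhd : ∀ θ, HasDerivAt h (Real.cos θ * h' θ) θ := by
    intro θ
    refine ((((hd hF θ).div_const (T : ℂ)).add ((hs θ).mul (hDed θ))).add (hd hF0 θ)).congr_deriv ?_
    simp only [hh']
    field_simp
    ring
  -- the boundary term of the integration by parts
  set G : ℝ → ℂ := fun θ => Real.sin θ * Real.sin θ * (Complex.I * X θ * h θ) with hG
  set R : ℝ → ℂ := fun θ => Real.sin θ * Real.cos θ * X θ * (Real.cos θ * T * h θ +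
    Complex.I * T * F (P θ) - Complex.I * (2 * h θ + Real.sin θ * h' θ)) with hR
  have hGd : ∀ θ, HasDerivAt G
      (meanDensity timeVec (spaceVec 0) (spaceVec 1) (0, x0) T F T θ ζ - R θ) θ := by
    intro θ
    refine (((hs θ).mul (hs θ)).mul (((hXd θ).const_mul Complex.I).mul (hhd θ))).congr_deriv ?_
    have hm : meanDensity timeVec (spaceVec 0) (spaceVec 1) (0, x0) T F T θ ζ =
        Real.sin θ * X θ * (T * h θ + T * (Complex.I * Real.cos θ * F (P θ))) := by
      simp only [meanDensity, hh, hX, hDe, hP]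
      field_simp
      ring
    rw [hm]
    simp only [hR, Pi.mul_apply]
    have q1 : (Real.cos θ : ℂ) ^ 2 = 1 - (Real.sin θ : ℂ) ^ 2 := by
      norm_cast; rw [Real.cos_sq']
    have hI : Complex.I ^ 2 = -1 := Complex.I_sq
    generalize (Real.sin θ : ℂ) = a at *
    generalize (Real.cos θ : ℂ) = b at *
    generalize Complex.I = i at *
    linear_combination (-a ^ 3 * X θ * T * h θ) * hI + (a * X θ * T * h θ) * q1
  have hcc : ∀ {G : ℝ × Plane → ℂ}, ContDiff ℝ ∞ G → Continuous (fun θ => G (P θ)) :=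
    fun hG => hG.continuous.comp hPc
  have hDec : ∀ {G : ℝ × Plane → ℂ}, ContDiff ℝ ∞ G → Continuous (De G) := fun hG =>
    (continuous_const.mul (hcc (contDiff_dirDeriv hG _))).add
      (continuous_const.mul (hcc (contDiff_dirDeriv hG _)))
  have k0 := hcc hF
  have k1 := hcc hF0
  have k2 := hDec hF
  have k3 := hDec hF0
  have k4 := hDec hF1
  have k5 := hDec hF2
  have hDDc : Continuous DDe := by fun_prop
  have hhc : Continuous h := by fun_prop
  have hhc' : Continuous h' := by fun_prop
  have hXc : Continuous X := by fun_prop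
  have hRc : Continuous R := by fun_prop
  have hJc : Continuous
      (fun θ => meanDensity timeVec (spaceVec 0) (spaceVec 1) (0, x0) T F T θ ζ) :=
    continuous_meanDensity_meridian hF T ζ
  have hint : ∫ θ in (0 : ℝ)..Real.pi,
      meanDensity timeVec (spaceVec 0) (spaceVec 1) (0, x0) T F T θ ζ =
      ∫ θ in (0 : ℝ)..Real.pi, R θ := by
    have := intervalIntegral.integral_eq_sub_of_hasDerivAt (a := 0) (b := Real.pi)
      (fun θ _ => hGd θ) ((hJc.sub hRc).intervalIntegrable _ _)
    rw [intervalIntegral.integral_sub (hJc.intervalIntegrable _ _) (hRc.intervalIntegrable _ _)]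
      at this
    simpa [hG, sub_eq_zero] using this
  rw [hint]
  refine intervalIntegral.norm_integral_le_of_norm_le hp.le (ae_of_all _ fun θ hθ => ?_)
    (Continuous.intervalIntegrable (by fun_prop) _ _)
  have hsin := Real.sin_nonneg_of_nonneg_of_le_pi hθ.1.le hθ.2
  have hsin1 := Real.sin_le_one θ
  have hcos1 := Real.abs_cos_le_one θ
  set m := M (polarPoint x0 (T * Real.sin θ) ζ) with hm
  have hm0 : 0 ≤ m := (norm_nonneg _).trans (hM _)
  have hDen : ∀ G : ℝ × Plane → ℂ, (∀ j, ‖dirDeriv (spaceVec j) G (P θ)‖ ≤ m) →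
      ‖De G θ‖ ≤ 2 * m := by
    intro G hG
    refine (norm_add_le _ _).trans ?_
    rw [norm_mul, norm_mul, Complex.norm_real, Complex.norm_real]
    have := mul_le_mul (Real.abs_cos_le_one ζ) (hG 0) (norm_nonneg _) zero_le_one
    have := mul_le_mul (Real.abs_sin_le_one ζ) (hG 1) (norm_nonneg _) zero_le_one
    simp only [Real.norm_eq_abs]
    linarith
  have b0 : ‖F (P θ)‖ ≤ m := by rw [hPeq]; exact hM _
  have b1 : ‖dirDeriv timeVec F (P θ)‖ ≤ m := by rw [hPeq]; exact hM0 _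
  have b2 : ‖De F θ‖ ≤ 2 * m := hDen F fun j => by rw [hPeq]; exact hM1 j _
  have b3 : ‖De (dirDeriv timeVec F) θ‖ ≤ 2 * m := hDen _ fun j => by rw [hPeq]; exact hM01 j _
  have b4 : ∀ i, ‖De (dirDeriv (spaceVec i) F) θ‖ ≤ 2 * m :=
    fun i => hDen _ fun j => by rw [hPeq]; exact hM2 j i _
  have b5 : ‖DDe θ‖ ≤ 4 * m := by
    refine (norm_add_le _ _).trans ?_
    rw [norm_mul, norm_mul, Complex.norm_real, Complex.norm_real]
    have := mul_le_mul (Real.abs_cos_le_one ζ) (b4 0) (norm_nonneg _) zero_le_one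
    have := mul_le_mul (Real.abs_sin_le_one ζ) (b4 1) (norm_nonneg _) zero_le_one
    simp only [Real.norm_eq_abs]
    linarith
  have hnT : ‖(T : ℂ)‖ = T := by rw [Complex.norm_real, Real.norm_of_nonneg hT0.le]
  have hnS : ‖(Real.sin θ : ℂ)‖ = Real.sin θ := by
    rw [Complex.norm_real, Real.norm_of_nonneg hsin]
  have hnC : ‖(Real.cos θ : ℂ)‖ = |Real.cos θ| := by
    rw [Complex.norm_real, Real.norm_eq_abs]
  have b6 : ‖h θ‖ ≤ 4 * m := by
    refine (norm_add₃_le).trans ?_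
    rw [norm_div, norm_mul, hnT, hnS]
    have h1 : ‖F (P θ)‖ / T ≤ m := (div_le_self (norm_nonneg _) hT).trans b0
    have h2 := mul_le_mul hsin1 b2 (norm_nonneg _) zero_le_one
    linarith
  have b7 : ‖h' θ‖ ≤ 10 * T * m := by
    refine (norm_add_le _ _).trans ((add_le_add_left norm_add₃_le _).trans ?_)
    rw [norm_mul, norm_mul, norm_mul, hnT, hnS]
    have h2 : T * Real.sin θ * ‖DDe θ‖ ≤ T * 1 * (4 * m) := by gcongr
    have h3 : T * ‖De (dirDeriv timeVec F) θ‖ ≤ T * (2 * m) := by gcongr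
    nlinarith
  -- `23 = 4 + 1 + 8 + 10`, from `‖h‖ ≤ 4m`, `‖F‖ ≤ m` and `‖h'‖ ≤ 10Tm`, and from `1 ≤ T`
  have b8 : ‖(Real.cos θ * T * h θ + Complex.I * T * F (P θ) -
      Complex.I * (2 * h θ + Real.sin θ * h' θ) : ℂ)‖ ≤ 23 * T * m := by
    refine (norm_sub_le _ _).trans ?_
    have h1 := norm_add_le (Real.cos θ * T * h θ : ℂ) (Complex.I * T * F (P θ))
    have h2 := norm_add_le (2 * h θ : ℂ) (Real.sin θ * h' θ)
    simp only [norm_mul, hnT, hnS, hnC, Complex.norm_I, one_mul, Complex.norm_ofNat] at h1 h2 ⊢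
    have h3 : |Real.cos θ| * T * ‖h θ‖ ≤ 1 * T * (4 * m) := by gcongr
    have h4 : T * ‖F (P θ)‖ ≤ T * m := by gcongr
    have h5 : Real.sin θ * ‖h' θ‖ ≤ 1 * (10 * T * m) := by gcongr
    nlinarith
  calc ‖R θ‖ = Real.sin θ * |Real.cos θ| * ‖(Real.cos θ * T * h θ + Complex.I * T * F (P θ) -
      Complex.I * (2 * h θ + Real.sin θ * h' θ) : ℂ)‖ := by
        simp only [hR]
        rw [norm_mul, norm_mul, norm_mul, hnS, hnC, hXn, mul_one]
    _ ≤ Real.sin θ * |Real.cos θ| * (23 * T * m) := by gcongr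
    _ = _ := by ring

set_option maxHeartbeats 400000 in
/-- The dispersive estimate for the Klein-Gordon equation in the plane: smooth solutions with
data in `W^{2,1}` decay like `1/t`. -/
theorem kleinGordon_decay {F : ℝ × Plane → ℂ} (hF : ContDiff ℝ ∞ F)
    (hKG : ∀ p, dirDeriv timeVec (dirDeriv timeVec F) p =
      dirDeriv (spaceVec 0) (dirDeriv (spaceVec 0) F) p +
        dirDeriv (spaceVec 1) (dirDeriv (spaceVec 1) F) p - F p)
    {M : Plane → ℝ} (hMc : Continuous M) (hMi : Integrable M) (hM : ∀ y, ‖F (0, y)‖ ≤ M y)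
    (hM0 : ∀ y, ‖dirDeriv timeVec F (0, y)‖ ≤ M y)
    (hM1 : ∀ j y, ‖dirDeriv (spaceVec j) F (0, y)‖ ≤ M y)
    (hM01 : ∀ j y, ‖dirDeriv (spaceVec j) (dirDeriv timeVec F) (0, y)‖ ≤ M y)
    (hM2 : ∀ i j y, ‖dirDeriv (spaceVec i) (dirDeriv (spaceVec j) F) (0, y)‖ ≤ M y)
    (x0 : Plane) {T : ℝ} (hT : 1 ≤ T) :
    ‖F (T, x0)‖ ≤ 4 / T * ∫ y, M y := by
  have hp := Real.pi_pos
  have hT0 : (0 : ℝ) < T := by linarith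
  have hMn : ∀ y, 0 ≤ M y := fun y => (norm_nonneg _).trans (hM y)
  have hK := integral_meanDensity (p0 := ((0 : ℝ), x0)) hF hKG hT0.le
  have hJc : Continuous (fun q : ℝ × ℝ =>
      meanDensity timeVec (spaceVec 0) (spaceVec 1) (0, x0) T F T q.1 q.2) :=
    continuous_meanDensity_sphere hF T
  rw [intervalIntegral_swap_of_continuous hJc hp.le (by linarith)] at hK
  have hcont : Continuous (fun q : ℝ × ℝ => 23 * T * (Real.sin q.1 * |Real.cos q.1| *
      M (polarPoint x0 (T * Real.sin q.1) q.2))) := by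
    fun_prop
  have hn := intervalIntegral.norm_integral_le_of_norm_le (a := -Real.pi) (b := Real.pi)
    (by linarith) (ae_of_all volume fun ζ _ =>
      norm_integral_meanDensity_le hF hMc hM hM0 hM1 hM01 hM2 x0 hT ζ)
    ((intervalIntegral.continuous_parametric_intervalIntegral_of_continuous'
      (f := fun ζ θ => 23 * T * (Real.sin θ * |Real.cos θ| *
        M (polarPoint x0 (T * Real.sin θ) ζ))) (by fun_prop) 0 Real.pi).intervalIntegrable _ _)
  rw [hK] at hn
  have hsw : ∫ ζ in -Real.pi..Real.pi, ∫ θ in (0 : ℝ)..Real.pi, 23 * T *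
      (Real.sin θ * |Real.cos θ| * M (polarPoint x0 (T * Real.sin θ) ζ)) =
      23 * T * ∫ θ in (0 : ℝ)..Real.pi, ∫ ζ in -Real.pi..Real.pi,
        (Real.sin θ * |Real.cos θ| * M (polarPoint x0 (T * Real.sin θ) ζ)) := by
    rw [intervalIntegral_swap_of_continuous (by fun_prop) (by linarith) hp.le]
    simp only [intervalIntegral.integral_const_mul]
  rw [hsw] at hn
  have hS := integral_sphere_le hMc hMn hMi x0 hT0
  have hI0 : 0 ≤ ∫ y, M y := integral_nonneg hMn
  have hval : ‖4 * (Real.pi : ℂ) * F ((0, x0) + T • timeVec)‖ = 4 * Real.pi * ‖F (T, x0)‖ := by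
    have : ((0, x0) + T • timeVec : ℝ × Plane) = (T, x0) := by simp
    rw [this, norm_mul, norm_mul, Complex.norm_real, Real.norm_of_nonneg hp.le]
    norm_num
  rw [hval] at hn
  -- `4 π ‖F‖ ≤ 23 T · (2 / T²) ∫ M`, and `46 / (4 π) ≤ 4`
  have h1 : 4 * Real.pi * ‖F (T, x0)‖ ≤ 46 / T * ∫ y, M y := by
    refine hn.trans ((mul_le_mul_of_nonneg_left hS (by positivity)).trans (le_of_eq ?_))
    field_simp
    ring
  have h2 : 12 * ‖F (T, x0)‖ ≤ 46 / T * ∫ y, M y := by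
    have := Real.pi_gt_three
    nlinarith [norm_nonneg (F (T, x0))]
  have h3 : 46 / T * ∫ y, M y ≤ 12 * (4 / T * ∫ y, M y) := by
    rw [← mul_assoc]
    gcongr
    rw [mul_div_assoc']
    gcongr; norm_num
  linarith

end Decay

/-! ### Integrated balance laws -/

section BalanceLaw

lemma dirDeriv_mul {E : Type*} [NormedAddCommGroup E] [NormedSpace ℝ E] {F G : E → ℂ}
    (hF : ContDiff ℝ ∞ F) (hG : ContDiff ℝ ∞ G) (v p : E) :
    dirDeriv v (fun q => F q * G q) p = dirDeriv v F p * G p + F p * dirDeriv v G p := by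
  unfold dirDeriv
  rw [fderiv_fun_mul (hF.differentiable (by simp) p) (hG.differentiable (by simp) p)]
  simp; ring

lemma hasDerivAt_time_slice {G : ℝ × Plane → ℂ} (hG : ContDiff ℝ ∞ G) (t : ℝ) (x : Plane) :
    HasDerivAt (fun t => G (t, x)) (dirDeriv timeVec G (t, x)) t := by
  have h : HasDerivAt (fun t : ℝ => (t, x)) timeVec t :=
    (hasDerivAt_id t).prodMk (hasDerivAt_const t x)
  exact (hG.differentiable (by simp) _).hasFDerivAt.comp_hasDerivAt t h

lemma fderiv_space_slice {E : Type*} [NormedAddCommGroup E] [NormedSpace ℝ E]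
    {G : ℝ × Plane → E} (hG : Differentiable ℝ G) (t : ℝ) (x v : Plane) :
    fderiv ℝ (fun x => G (t, x)) x v = fderiv ℝ G (t, x) (0, v) := by
  have h : HasFDerivAt (fun x : Plane => (t, x)) (ContinuousLinearMap.inr ℝ ℝ Plane) x :=
    hasFDerivAt_prodMk_right t x
  have := ((hG (t, x)).hasFDerivAt.comp x h).fderiv
  rw [show (fun x => G (t, x)) = G ∘ fun x => (t, x) from rfl, this]
  simp

/-- The support of `η` in the space variable is bounded, locally uniformly in time. -/
def HasBoundedSlices (η : ℝ × Plane → ℂ) : Prop :=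
  ∀ t₀ : ℝ, ∃ r : ℝ, ∀ t x, |t - t₀| < 2 → r ≤ ‖x‖ → η (t, x) = 0

lemma HasBoundedSlices.hasCompactSupport {η : ℝ × Plane → ℂ} (h : HasBoundedSlices η) (t : ℝ) :
    HasCompactSupport (fun x => η (t, x)) := by
  obtain ⟨r, hr⟩ := h t
  refine HasCompactSupport.intro (isCompact_closedBall (0 : Plane) r) fun x hx => ?_
  refine hr t x (by simp) ?_
  simp only [Metric.mem_closedBall, dist_zero_right, not_le] at hx
  exact hx.le

lemma HasBoundedSlices.mul {η m : ℝ × Plane → ℂ} (h : HasBoundedSlices η) :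
    HasBoundedSlices (fun p => η p * m p) := fun t₀ =>
  (h t₀).imp fun r hr t x ht hx => by simp [hr t x ht hx]

lemma integral_fderiv_eq_zero {g : Plane → ℂ} (hg : ContDiff ℝ ∞ g) (hs : HasCompactSupport g)
    (v : Plane) : ∫ x, fderiv ℝ g x v = 0 := by
  have hgc : Continuous (fun x => fderiv ℝ g x v) :=
    (hg.continuous_fderiv (by simp)).clm_apply continuous_const
  have hi : Integrable (fun x => fderiv ℝ g x v) :=
    hgc.integrable_of_hasCompactSupport (hs.fderiv_apply ℝ v)
  have := integral_mul_fderiv_eq_neg_fderiv_mul_of_integrable (μ := (volume : Measure Plane))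
    (f := fun _ => (1 : ℂ)) (g := g) (v := v) (𝕜 := ℂ) (by simp) (by simpa using hi)
    (by simpa using hg.continuous.integrable_of_hasCompactSupport hs)
    (fun x _ => by fun_prop) (fun x _ => hg.differentiable (by simp) x)
  simpa using this

lemma integral_dirDeriv_space_eq_zero {G : ℝ × Plane → ℂ} (hG : ContDiff ℝ ∞ G)
    (hs : HasBoundedSlices G) (j : Fin 2) (t : ℝ) :
    ∫ x, dirDeriv (spaceVec j) G (t, x) = 0 := by
  have := integral_fderiv_eq_zero (g := fun x => G (t, x)) (hG.comp (by fun_prop))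
    (hs.hasCompactSupport t) (basisVec j)
  simp only [fderiv_space_slice (hG.differentiable (by simp))] at this
  exact this

/-- Differentiation under the integral sign for smooth functions with bounded slices. -/
lemma hasDerivAt_integral_slice {G : ℝ × Plane → ℂ} (hG : ContDiff ℝ ∞ G)
    (hs : HasBoundedSlices G) (t : ℝ) :
    Integrable (fun x => dirDeriv timeVec G (t, x)) ∧
    HasDerivAt (fun t => ∫ x, G (t, x)) (∫ x, dirDeriv timeVec G (t, x)) t := by
  obtain ⟨r, hr⟩ := hs t
  have hGc := (contDiff_dirDeriv hG timeVec).continuous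
  obtain ⟨C, hC⟩ := ((isCompact_closedBall t 1).prod
    (isCompact_closedBall (0 : Plane) r)).exists_bound_of_continuousOn hGc.continuousOn
  refine hasDerivAt_integral_of_dominated_loc_of_deriv_le (Metric.ball_mem_nhds t one_pos)
    (F := fun t x => G (t, x)) (F' := fun t x => dirDeriv timeVec G (t, x))
    (bound := (Metric.closedBall (0 : Plane) r).indicator fun _ => C) ?_ ?_ ?_ ?_ ?_ ?_
  · exact Eventually.of_forall fun s =>
      (hG.continuous.comp (by fun_prop : Continuous fun x : Plane => (s, x))).aestronglyMeasurable
  · exact (hG.continuous.comp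
      (by fun_prop : Continuous fun x : Plane => (t, x))).integrable_of_hasCompactSupport
        (hs.hasCompactSupport t)
  · exact (hGc.comp (by fun_prop : Continuous fun x : Plane => (t, x))).aestronglyMeasurable
  · refine ae_of_all _ fun x s hst => ?_
    by_cases hx : x ∈ Metric.closedBall (0 : Plane) r
    · rw [Set.indicator_of_mem hx]
      exact hC (s, x) ⟨Metric.ball_subset_closedBall hst, hx⟩
    · rw [Set.indicator_of_notMem hx]
      have hev : (fun τ => G (τ, x)) =ᶠ[𝓝 s] fun _ => 0 := by
        filter_upwards [Metric.ball_mem_nhds s one_pos] with τ hτ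
        refine hr τ x ?_ ?_
        · have h1 : |τ - s| < 1 := hτ
          have h2 : |s - t| < 1 := hst
          calc |τ - t| = |(τ - s) + (s - t)| := by ring_nf
            _ ≤ |τ - s| + |s - t| := abs_add_le _ _
            _ < 2 := by linarith
        · simp only [Metric.mem_closedBall, dist_zero_right, not_le] at hx
          exact hx.le
      have h0 : HasDerivAt (fun τ => G (τ, x)) 0 s :=
        (hasDerivAt_const s (0 : ℂ)).congr_of_eventuallyEq hev
      rw [(hasDerivAt_time_slice hG s x).unique h0]; simp
  · exact (integrable_indicator_iff measurableSet_closedBall).2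
      (integrableOn_const (measure_closedBall_lt_top.ne))
  · exact ae_of_all _ fun x s _ => hasDerivAt_time_slice hG s x

/-- The integrated form of the local balance law `∂ₜm + ∑ⱼ ∂ⱼfⱼ = S` against a weight `η`. -/
theorem hasDerivAt_integral_balance {η m S : ℝ × Plane → ℂ} {f : Fin 2 → ℝ × Plane → ℂ}
    (hη : ContDiff ℝ ∞ η) (hs : HasBoundedSlices η) (hm : ContDiff ℝ ∞ m)
    (hf : ∀ j, ContDiff ℝ ∞ (f j))
    (hbal : ∀ p, dirDeriv timeVec m p + ∑ j, dirDeriv (spaceVec j) (f j) p = S p) (t : ℝ) :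
    HasDerivAt (fun t => ∫ x, η (t, x) * m (t, x))
      (∫ x, (dirDeriv timeVec η (t, x) * m (t, x) +
        ∑ j, dirDeriv (spaceVec j) η (t, x) * f j (t, x) + η (t, x) * S (t, x))) t := by
  obtain ⟨hi, hd⟩ := hasDerivAt_integral_slice (hη.mul hm) hs.mul t
  convert hd using 1
  have hz : ∀ j, ∫ x, dirDeriv (spaceVec j) (fun q => η q * f j q) (t, x) = 0 := fun j =>
    integral_dirDeriv_space_eq_zero (hη.mul (hf j)) hs.mul j t
  have hj : ∀ j, Integrable (fun x => dirDeriv (spaceVec j) (fun q => η q * f j q) (t, x)) := by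
    intro j
    have hc := (contDiff_dirDeriv (hη.mul (hf j)) (spaceVec j)).continuous
    refine (hc.comp (by fun_prop : Continuous fun x : Plane =>
      (t, x))).integrable_of_hasCompactSupport ?_
    have := ((hs.mul (m := f j)).hasCompactSupport t).fderiv_apply ℝ (basisVec j)
    simp only [fderiv_space_slice ((hη.mul (hf j)).differentiable (by simp))] at this
    exact this
  have : ∀ x, dirDeriv timeVec η (t, x) * m (t, x) +
        ∑ j, dirDeriv (spaceVec j) η (t, x) * f j (t, x) + η (t, x) * S (t, x) =
      dirDeriv timeVec (fun q => η q * m q) (t, x) +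
        ∑ j, dirDeriv (spaceVec j) (fun q => η q * f j q) (t, x) := by
    intro x
    rw [← hbal, dirDeriv_mul hη hm]
    simp_rw [fun j => dirDeriv_mul hη (hf j) (spaceVec j) (t, x)]
    rw [Finset.sum_add_distrib, ← Finset.mul_sum]
    ring
  simp_rw [this]
  rw [integral_add hi (integrable_finsetSum _ fun j _ => hj j),
    integral_finsetSum _ fun j _ => hj j]
  simp [hz]

end BalanceLaw

/-! ### The Dirac equation in components -/

section DiracComponents

/-- The `k`-th component of a spinor field, as a function on space-time. -/
def component (ψ : ℝ → Plane → Spinor) (k : Fin 2) (p : ℝ × Plane) : ℂ := ψ p.1 p.2 k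

/-- The `k`-th coordinate of a spinor, as a real-linear map. -/
def spinorCoord (k : Fin 2) : Spinor →L[ℝ] ℂ := (EuclideanSpace.proj k).restrictScalars ℝ

/-- Joint smoothness of a spinor field in time and space. -/
abbrev JointlySmooth (ψ : ℝ → Plane → Spinor) : Prop :=
  ContDiff ℝ ∞ (fun p : ℝ × Plane => ψ p.1 p.2)

variable {ψ φ N M : ℝ → Plane → Spinor}

lemma contDiff_component (hψ : JointlySmooth ψ) (k : Fin 2) : ContDiff ℝ ∞ (component ψ k) :=
  (spinorCoord k).contDiff.comp hψ

lemma dirDeriv_component (hψ : JointlySmooth ψ) (k : Fin 2) (v p : ℝ × Plane) :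
    dirDeriv v (component ψ k) p = fderiv ℝ (fun p : ℝ × Plane => ψ p.1 p.2) p v k := by
  have := ((spinorCoord k).hasFDerivAt.comp p (hψ.differentiable (by simp) p).hasFDerivAt).fderiv
  unfold dirDeriv
  rw [show component ψ k = spinorCoord k ∘ fun p : ℝ × Plane => ψ p.1 p.2 from rfl, this]
  rfl

lemma deriv_apply_eq (hψ : JointlySmooth ψ) (t : ℝ) (x : Plane) (k : Fin 2) :
    deriv (fun τ => ψ τ x) t k = dirDeriv timeVec (component ψ k) (t, x) := by
  rw [dirDeriv_component hψ]
  have h : HasDerivAt (fun t : ℝ => (t, x)) timeVec t :=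
    (hasDerivAt_id t).prodMk (hasDerivAt_const t x)
  have := ((hψ.differentiable (by simp) (t, x)).hasFDerivAt.comp_hasDerivAt t h).deriv
  exact congrArg (fun v : Spinor => v k) this

lemma partialDeriv_apply_eq (hψ : JointlySmooth ψ) (t : ℝ) (x : Plane) (j k : Fin 2) :
    partialDeriv j (ψ t) x k = dirDeriv (spaceVec j) (component ψ k) (t, x) := by
  rw [dirDeriv_component hψ]
  have := fderiv_space_slice (G := fun p : ℝ × Plane => ψ p.1 p.2)
    (hψ.differentiable (by simp)) t x (basisVec j)
  exact congrArg (fun v : Spinor => v k) this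

lemma act_alpha_zero (v : Spinor) : act (alpha 0) v 0 = v 1 ∧ act (alpha 0) v 1 = v 0 := by
  simp [act, alpha, Matrix.toLpLin_apply, dotProduct, Fin.sum_univ_two]

lemma act_alpha_one (v : Spinor) :
    act (alpha 1) v 0 = -Complex.I * v 1 ∧ act (alpha 1) v 1 = Complex.I * v 0 := by
  simp [act, alpha, Matrix.toLpLin_apply, dotProduct, Fin.sum_univ_two]

lemma act_beta (v : Spinor) : act beta v 0 = v 0 ∧ act beta v 1 = -v 1 := by
  simp [act, beta, Matrix.toLpLin_apply, dotProduct, Fin.sum_univ_two]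

lemma dot_eq (u v : Spinor) :
    dot u v = u 0 * (starRingEnd ℂ) (v 0) + u 1 * (starRingEnd ℂ) (v 1) := by
  simp [dot, Fin.sum_univ_two]

/-- The Dirac equation with source `N`, solved for the time derivatives of the two components. -/
lemma time_deriv_component (hψ : JointlySmooth ψ) (hN : ∀ t x, diracEvol ψ t x = N t x)
    (p : ℝ × Plane) :
    dirDeriv timeVec (component ψ 0) p = -dirDeriv (spaceVec 0) (component ψ 1) p +
      Complex.I * dirDeriv (spaceVec 1) (component ψ 1) p - Complex.I * component ψ 0 p +
      Complex.I * N p.1 p.2 0 ∧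
    dirDeriv timeVec (component ψ 1) p = -dirDeriv (spaceVec 0) (component ψ 0) p -
      Complex.I * dirDeriv (spaceVec 1) (component ψ 0) p + Complex.I * component ψ 1 p +
      Complex.I * N p.1 p.2 1 := by
  obtain ⟨t, x⟩ := p
  have h := hN t x
  have h0 := congrArg (fun v : Spinor => v 0) h
  have h1 := congrArg (fun v : Spinor => v 1) h
  simp only [diracEvol, diracOp, PiLp.add_apply, PiLp.smul_apply, Fin.sum_univ_two, act_alpha_zero,
    act_alpha_one, act_beta, smul_eq_mul, deriv_apply_eq hψ, partialDeriv_apply_eq hψ] at h0 h1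
  have c : ∀ k, component ψ k (t, x) = ψ t x k := fun k => rfl
  simp only [c]
  have hI : Complex.I ^ 2 = -1 := Complex.I_sq
  constructor
  · linear_combination Complex.I * h0 + (dirDeriv timeVec (component ψ 0) (t, x) +
      dirDeriv (spaceVec 0) (component ψ 1) (t, x) -
      Complex.I * dirDeriv (spaceVec 1) (component ψ 1) (t, x)) * hI
  · linear_combination Complex.I * h1 + (dirDeriv timeVec (component ψ 1) (t, x) +
      dirDeriv (spaceVec 0) (component ψ 0) (t, x) +
      Complex.I * dirDeriv (spaceVec 1) (component ψ 0) (t, x)) * hI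

lemma contDiff_conj {F : ℝ × Plane → ℂ} (hF : ContDiff ℝ ∞ F) :
    ContDiff ℝ ∞ (fun p => (starRingEnd ℂ) (F p)) :=
  (Complex.conjCLE : ℂ →L[ℝ] ℂ).contDiff.comp hF

lemma dirDeriv_conj {F : ℝ × Plane → ℂ} (hF : ContDiff ℝ ∞ F) (v p : ℝ × Plane) :
    dirDeriv v (fun p => (starRingEnd ℂ) (F p)) p = (starRingEnd ℂ) (dirDeriv v F p) := by
  have := ((Complex.conjCLE : ℂ →L[ℝ] ℂ).hasFDerivAt.comp p
    (hF.differentiable (by simp) p).hasFDerivAt).fderiv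
  unfold dirDeriv
  rw [show (fun p => (starRingEnd ℂ) (F p)) = (Complex.conjCLE : ℂ →L[ℝ] ℂ) ∘ F from rfl, this]
  rfl

lemma dirDeriv_add {F G : ℝ × Plane → ℂ} (hF : ContDiff ℝ ∞ F) (hG : ContDiff ℝ ∞ G)
    (v p : ℝ × Plane) :
    dirDeriv v (fun q => F q + G q) p = dirDeriv v F p + dirDeriv v G p := by
  unfold dirDeriv
  rw [fderiv_fun_add (hF.differentiable (by simp) p) (hG.differentiable (by simp) p)]
  simp

lemma dirDeriv_const_mul {F : ℝ × Plane → ℂ} (hF : ContDiff ℝ ∞ F) (c : ℂ) (v p : ℝ × Plane) :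
    dirDeriv v (fun q => c * F q) p = c * dirDeriv v F p := by
  unfold dirDeriv
  rw [fderiv_const_mul (hF.differentiable (by simp) p)]
  simp

/-- The derivatives of `time_deriv_component` for the free Dirac equation. -/
lemma dirDeriv_time_deriv_component (hφ : JointlySmooth φ) (h : ∀ t x, diracEvol φ t x = 0)
    (v p : ℝ × Plane) :
    dirDeriv v (dirDeriv timeVec (component φ 0)) p =
      -1 * dirDeriv v (dirDeriv (spaceVec 0) (component φ 1)) p +
      (Complex.I * dirDeriv v (dirDeriv (spaceVec 1) (component φ 1)) p +
        -Complex.I * dirDeriv v (component φ 0) p) ∧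
    dirDeriv v (dirDeriv timeVec (component φ 1)) p =
      -1 * dirDeriv v (dirDeriv (spaceVec 0) (component φ 0)) p +
      (-Complex.I * dirDeriv v (dirDeriv (spaceVec 1) (component φ 0)) p +
        Complex.I * dirDeriv v (component φ 1) p) := by
  have a := contDiff_component hφ 0
  have b := contDiff_component hφ 1
  have d : ∀ {F : ℝ × Plane → ℂ}, ContDiff ℝ ∞ F → ∀ v, ContDiff ℝ ∞ (dirDeriv v F) :=
    fun hF v => contDiff_dirDeriv hF v
  have ea : dirDeriv timeVec (component φ 0) = fun q =>
      -1 * dirDeriv (spaceVec 0) (component φ 1) q +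
      (Complex.I * dirDeriv (spaceVec 1) (component φ 1) q + -Complex.I * component φ 0 q) := by
    funext q; rw [(time_deriv_component hφ h q).1]; simp; ring
  have eb : dirDeriv timeVec (component φ 1) = fun q =>
      -1 * dirDeriv (spaceVec 0) (component φ 0) q +
      (-Complex.I * dirDeriv (spaceVec 1) (component φ 0) q + Complex.I * component φ 1 q) := by
    funext q; rw [(time_deriv_component hφ h q).2]; simp; ring
  constructor
  · rw [ea, dirDeriv_add (contDiff_const.mul (d b _)) ((contDiff_const.mul (d b _)).add
      (contDiff_const.mul a)), dirDeriv_add (contDiff_const.mul (d b _)) (contDiff_const.mul a),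
      dirDeriv_const_mul (d b _), dirDeriv_const_mul (d b _), dirDeriv_const_mul a]
  · rw [eb, dirDeriv_add (contDiff_const.mul (d a _)) ((contDiff_const.mul (d a _)).add
      (contDiff_const.mul b)), dirDeriv_add (contDiff_const.mul (d a _)) (contDiff_const.mul b),
      dirDeriv_const_mul (d a _), dirDeriv_const_mul (d a _), dirDeriv_const_mul b]

/-- The components of a solution of the free Dirac equation solve the Klein-Gordon equation. -/
lemma component_kleinGordon (hφ : JointlySmooth φ) (h : ∀ t x, diracEvol φ t x = 0) (k : Fin 2)
    (p : ℝ × Plane) :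
    dirDeriv timeVec (dirDeriv timeVec (component φ k)) p =
      dirDeriv (spaceVec 0) (dirDeriv (spaceVec 0) (component φ k)) p +
        dirDeriv (spaceVec 1) (dirDeriv (spaceVec 1) (component φ k)) p - component φ k p := by
  have a := contDiff_component hφ 0
  have b := contDiff_component hφ 1
  have da := fun v => (dirDeriv_time_deriv_component hφ h v p).1
  have db := fun v => (dirDeriv_time_deriv_component hφ h v p).2
  have ea' := (time_deriv_component hφ h p).1
  have eb' := (time_deriv_component hφ h p).2
  simp only [PiLp.zero_apply, mul_zero, add_zero] at ea' eb'
  have ca := fun v w => dirDeriv_comm a v w p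
  have cb := fun v w => dirDeriv_comm b v w p
  have hI : Complex.I ^ 2 = -1 := Complex.I_sq
  fin_cases k
  · simp only [Fin.zero_eta]
    rw [da, cb timeVec, cb timeVec, db, db, ea', ca (spaceVec 1) (spaceVec 0)]
    linear_combination (component φ 0 p - dirDeriv (spaceVec 1) (dirDeriv (spaceVec 1) (component φ 0)) p) * hI
  · simp only [Fin.mk_one]
    rw [db, ca timeVec, ca timeVec, da, da, eb', cb (spaceVec 1) (spaceVec 0)]
    linear_combination (component φ 1 p - dirDeriv (spaceVec 1) (dirDeriv (spaceVec 1) (component φ 1)) p) * hI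

lemma contDiff_dot (hψ : JointlySmooth ψ) (hφ : JointlySmooth φ) :
    ContDiff ℝ ∞ (fun p : ℝ × Plane => dot (ψ p.1 p.2) (φ p.1 p.2)) := by
  simp only [dot_eq]
  exact ((contDiff_component hψ 0).mul (contDiff_conj (contDiff_component hφ 0))).add
    ((contDiff_component hψ 1).mul (contDiff_conj (contDiff_component hφ 1)))

lemma jointlySmooth_act (A : Matrix (Fin 2) (Fin 2) ℂ) (hψ : JointlySmooth ψ) :
    JointlySmooth (fun t x => act A (ψ t x)) :=
  ((Matrix.toEuclideanLin A).toContinuousLinearMap.restrictScalars ℝ).contDiff.comp hψ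

/-- The local balance law for the inner product of two solutions of the Dirac equation with
source terms `N` and `M`: the flux is `⟨αʲψ, φ⟩`, and the mass terms cancel because `β` is
Hermitian. -/
lemma dot_balance (hψ : JointlySmooth ψ) (hφ : JointlySmooth φ)
    (hN : ∀ t x, diracEvol ψ t x = N t x) (hM : ∀ t x, diracEvol φ t x = M t x) (p : ℝ × Plane) :
    dirDeriv timeVec (fun p => dot (ψ p.1 p.2) (φ p.1 p.2)) p +
      ∑ j, dirDeriv (spaceVec j) (fun p => dot (act (alpha j) (ψ p.1 p.2)) (φ p.1 p.2)) p =
      Complex.I * (dot (N p.1 p.2) (φ p.1 p.2) - dot (ψ p.1 p.2) (M p.1 p.2)) := by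
  obtain ⟨h1, h2⟩ := time_deriv_component hψ hN p
  obtain ⟨h3, h4⟩ := time_deriv_component hφ hM p
  have a := contDiff_component hψ 0
  have b := contDiff_component hψ 1
  have a' := contDiff_component hφ 0
  have b' := contDiff_component hφ 1
  have ca' := contDiff_conj a'
  have cb' := contDiff_conj b'
  have d : ∀ v, dirDeriv v (fun p => dot (ψ p.1 p.2) (φ p.1 p.2)) p =
      dirDeriv v (component ψ 0) p * (starRingEnd ℂ) (component φ 0 p) +
        component ψ 0 p * (starRingEnd ℂ) (dirDeriv v (component φ 0) p) +
      (dirDeriv v (component ψ 1) p * (starRingEnd ℂ) (component φ 1 p) +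
        component ψ 1 p * (starRingEnd ℂ) (dirDeriv v (component φ 1) p)) := by
    intro v
    have e : (fun p : ℝ × Plane => dot (ψ p.1 p.2) (φ p.1 p.2)) = fun p =>
        component ψ 0 p * (starRingEnd ℂ) (component φ 0 p) +
        component ψ 1 p * (starRingEnd ℂ) (component φ 1 p) := by
      funext p; exact dot_eq _ _
    rw [e, dirDeriv_add (a.mul ca') (b.mul cb'), dirDeriv_mul a ca', dirDeriv_mul b cb',
      dirDeriv_conj a', dirDeriv_conj b']
  have d0 : ∀ v, dirDeriv v (fun p => dot (act (alpha 0) (ψ p.1 p.2)) (φ p.1 p.2)) p =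
      dirDeriv v (component ψ 1) p * (starRingEnd ℂ) (component φ 0 p) +
        component ψ 1 p * (starRingEnd ℂ) (dirDeriv v (component φ 0) p) +
      (dirDeriv v (component ψ 0) p * (starRingEnd ℂ) (component φ 1 p) +
        component ψ 0 p * (starRingEnd ℂ) (dirDeriv v (component φ 1) p)) := by
    intro v
    have e : (fun p : ℝ × Plane => dot (act (alpha 0) (ψ p.1 p.2)) (φ p.1 p.2)) = fun p =>
        component ψ 1 p * (starRingEnd ℂ) (component φ 0 p) +
        component ψ 0 p * (starRingEnd ℂ) (component φ 1 p) := by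
      funext p; rw [dot_eq, (act_alpha_zero _).1, (act_alpha_zero _).2]; rfl
    rw [e, dirDeriv_add (b.mul ca') (a.mul cb'), dirDeriv_mul b ca', dirDeriv_mul a cb',
      dirDeriv_conj a', dirDeriv_conj b']
  have d1 : ∀ v, dirDeriv v (fun p => dot (act (alpha 1) (ψ p.1 p.2)) (φ p.1 p.2)) p =
      -Complex.I * (dirDeriv v (component ψ 1) p * (starRingEnd ℂ) (component φ 0 p) +
        component ψ 1 p * (starRingEnd ℂ) (dirDeriv v (component φ 0) p)) +
      Complex.I * (dirDeriv v (component ψ 0) p * (starRingEnd ℂ) (component φ 1 p) +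
        component ψ 0 p * (starRingEnd ℂ) (dirDeriv v (component φ 1) p)) := by
    intro v
    have e : (fun p : ℝ × Plane => dot (act (alpha 1) (ψ p.1 p.2)) (φ p.1 p.2)) = fun p =>
        -Complex.I * (component ψ 1 p * (starRingEnd ℂ) (component φ 0 p)) +
        Complex.I * (component ψ 0 p * (starRingEnd ℂ) (component φ 1 p)) := by
      funext p; rw [dot_eq, (act_alpha_one _).1, (act_alpha_one _).2]; simp only [component]; ring
    rw [e, dirDeriv_add (contDiff_const.mul (b.mul ca')) (contDiff_const.mul (a.mul cb')),
      dirDeriv_const_mul (b.mul ca'), dirDeriv_const_mul (a.mul cb'),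
      dirDeriv_mul b ca', dirDeriv_mul a cb', dirDeriv_conj a', dirDeriv_conj b']
  rw [Fin.sum_univ_two, d, d0, d1, h1, h2, h3, h4, dot_eq, dot_eq]
  simp only [map_add, map_sub, map_mul, map_neg, Complex.conj_I]
  have c : ∀ k, ψ p.1 p.2 k = component ψ k p := fun k => rfl
  have c' : ∀ k, φ p.1 p.2 k = component φ k p := fun k => rfl
  simp only [c, c']
  ring

end DiracComponents

/-! ### Decay of free Dirac fields -/

section DiracDecay

lemma norm_coord_le (v : Spinor) (k : Fin 2) : ‖v k‖ ≤ ‖v‖ := PiLp.norm_apply_le v k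

lemma norm_spinor_le (v : Spinor) : ‖v‖ ≤ ‖v 0‖ + ‖v 1‖ := by
  rw [EuclideanSpace.norm_eq, Fin.sum_univ_two]
  apply Real.sqrt_le_iff.2 ⟨by positivity, ?_⟩
  nlinarith [norm_nonneg (v 0), norm_nonneg (v 1)]

variable {φ : ℝ → Plane → Spinor}

lemma norm_dirDeriv_space_component_le (hφ : JointlySmooth φ) (j k : Fin 2) (y : Plane) :
    ‖dirDeriv (spaceVec j) (component φ k) (0, y)‖ ≤ ‖iteratedFDeriv ℝ 1 (φ 0) y‖ := by
  rw [dirDeriv_component hφ, ← fderiv_space_slice (G := fun p : ℝ × Plane => φ p.1 p.2)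
    (hφ.differentiable (by simp)), norm_iteratedFDeriv_one]
  refine (norm_coord_le _ _).trans ((ContinuousLinearMap.le_opNorm _ _).trans ?_)
  simp

lemma norm_dirDeriv_space_space_component_le (hφ : JointlySmooth φ) (i j k : Fin 2) (y : Plane) :
    ‖dirDeriv (spaceVec i) (dirDeriv (spaceVec j) (component φ k)) (0, y)‖ ≤
      ‖iteratedFDeriv ℝ 2 (φ 0) y‖ := by
  have h0 : ContDiff ℝ ∞ (φ 0) := hφ.comp (by fun_prop : ContDiff ℝ ∞ fun x : Plane => ((0:ℝ), x))
  have hd : DifferentiableAt ℝ (fderiv ℝ (φ 0)) y :=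
    (h0.fderiv_right (m := ∞) (by simp)).differentiable (by simp) y
  have hG := (contDiff_dirDeriv (contDiff_component hφ k) (spaceVec j)).differentiable (by simp)
  have e1 : dirDeriv (spaceVec i) (dirDeriv (spaceVec j) (component φ k)) (0, y) =
      fderiv ℝ (fun x => dirDeriv (spaceVec j) (component φ k) (0, x)) y (basisVec i) :=
    (fderiv_space_slice hG 0 y (basisVec i)).symm
  have e2 : (fun x => dirDeriv (spaceVec j) (component φ k) (0, x)) =
      fun x => spinorCoord k (fderiv ℝ (φ 0) x (basisVec j)) := by
    funext x
    rw [dirDeriv_component hφ, ← fderiv_space_slice (G := fun p : ℝ × Plane => φ p.1 p.2)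
      (hφ.differentiable (by simp))]
    rfl
  have e3 : fderiv ℝ (fun x => spinorCoord k (fderiv ℝ (φ 0) x (basisVec j))) y (basisVec i) =
      spinorCoord k (fderiv ℝ (fderiv ℝ (φ 0)) y (basisVec i) (basisVec j)) := by
    have := ((spinorCoord k).hasFDerivAt.comp y
      (hd.hasFDerivAt.clm_apply (hasFDerivAt_const (basisVec j) y))).fderiv
    rw [show (fun x => spinorCoord k (fderiv ℝ (φ 0) x (basisVec j))) =
      spinorCoord k ∘ fun x => fderiv ℝ (φ 0) x (basisVec j) from rfl, this]
    simp
  rw [e1, e2, e3]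
  calc _ ≤ ‖fderiv ℝ (fderiv ℝ (φ 0)) y (basisVec i) (basisVec j)‖ := norm_coord_le _ _
    _ = ‖iteratedFDeriv ℝ 2 (φ 0) y ![basisVec i, basisVec j]‖ := by
      rw [iteratedFDeriv_two_apply]; rfl
    _ ≤ ‖iteratedFDeriv ℝ 2 (φ 0) y‖ * ∏ l, ‖![basisVec i, basisVec j] l‖ :=
      ContinuousMultilinearMap.le_opNorm _ _
    _ = _ := by simp [Fin.prod_univ_two]

/-- Solutions of the free Dirac equation decay like `1/t`: the components solve the Klein-Gordon
equation, and the equation itself expresses the time derivatives of the data by space derivatives. -/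
theorem IsSmoothLinearSolution.exists_decay (hφ : IsSmoothLinearSolution φ) :
    ∃ C : ℝ, 0 < C ∧ ∀ t, 1 ≤ t → ∀ x, ‖φ t x‖ ≤ C / t := by
  have hs : JointlySmooth φ := hφ.smooth
  have h0 : ContDiff ℝ ∞ (φ 0) := hs.comp (by fun_prop : ContDiff ℝ ∞ fun x : Plane => ((0:ℝ), x))
  set m : ℕ → Plane → ℝ := fun n y => ‖iteratedFDeriv ℝ n (φ 0) y‖ with hm
  -- each derivative of the data that enters the dispersive estimate is a sum of at most three terms
  set M : Plane → ℝ := fun y => 3 * (m 0 y + m 1 y + m 2 y) with hM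
  have hmc : ∀ n, Continuous (m n) := fun n =>
    (h0.continuous_iteratedFDeriv (by exact_mod_cast le_top)).norm
  have hmi : ∀ n, Integrable (m n) := fun n => (hφ.integrable_data n).norm
  have hm0 : ∀ n y, 0 ≤ m n y := fun n y => norm_nonneg _
  have hMc : Continuous M := by fun_prop
  have hMi : Integrable M := (((hmi 0).add (hmi 1)).add (hmi 2)).const_mul 3
  have b0 : ∀ k y, ‖component φ k (0, y)‖ ≤ m 0 y := fun k y => by
    simp only [hm, norm_iteratedFDeriv_zero]; exact norm_coord_le _ _
  have b1 : ∀ j k y, ‖dirDeriv (spaceVec j) (component φ k) (0, y)‖ ≤ m 1 y :=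
    fun j k y => norm_dirDeriv_space_component_le hs j k y
  have b2 : ∀ i j k y, ‖dirDeriv (spaceVec i) (dirDeriv (spaceVec j) (component φ k)) (0, y)‖ ≤
      m 2 y := fun i j k y => norm_dirDeriv_space_space_component_le hs i j k y
  have tri : ∀ (a b c : ℂ), ‖-1 * a + (Complex.I * b + -Complex.I * c)‖ ≤ ‖a‖ + ‖b‖ + ‖c‖ ∧
      ‖-1 * a + (-Complex.I * b + Complex.I * c)‖ ≤ ‖a‖ + ‖b‖ + ‖c‖ := by
    intro a b c
    constructor <;>
    · refine (norm_add_le _ _).trans ?_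
      refine (add_le_add_right (norm_add_le _ _) _).trans (le_of_eq ?_)
      simp [add_assoc]
  have key : ∀ k t, 1 ≤ t → ∀ x, ‖component φ k (t, x)‖ ≤ 4 / t * ∫ y, M y := by
    intro k t ht x
    refine kleinGordon_decay (contDiff_component hs k) (component_kleinGordon hs hφ.equation k)
      hMc hMi ?_ ?_ ?_ ?_ ?_ x ht
    · intro y
      have := b0 k y; have := hm0 0 y; have := hm0 1 y; have := hm0 2 y
      simp only [hM]; linarith
    · intro y
      have hT := time_deriv_component hs hφ.equation (0, y)
      have := hm0 0 y; have := hm0 1 y; have := hm0 2 y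
      have e : ∀ a b c d : ℂ, -a + Complex.I * b - Complex.I * c + Complex.I * 0 =
          -1 * a + (Complex.I * b + -Complex.I * c) := by intros; ring
      have e' : ∀ a b c d : ℂ, -a - Complex.I * b + Complex.I * c + Complex.I * 0 =
          -1 * a + (-Complex.I * b + Complex.I * c) := by intros; ring
      fin_cases k
      · simp only [Fin.zero_eta]
        rw [hT.1, PiLp.zero_apply, e _ _ _ 0]
        refine (tri _ _ _).1.trans ?_
        have := b1 0 1 y; have := b1 1 1 y; have := b0 0 y
        simp only [hM]; linarith
      · simp only [Fin.mk_one]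
        rw [hT.2, PiLp.zero_apply, e' _ _ _ 0]
        refine (tri _ _ _).2.trans ?_
        have := b1 0 0 y; have := b1 1 0 y; have := b0 1 y
        simp only [hM]; linarith
    · intro j y
      have := b1 j k y; have := hm0 0 y; have := hm0 1 y; have := hm0 2 y
      simp only [hM]; linarith
    · intro j y
      have hT := dirDeriv_time_deriv_component hs hφ.equation (spaceVec j) (0, y)
      have := hm0 0 y; have := hm0 1 y; have := hm0 2 y
      fin_cases k
      · simp only [Fin.zero_eta]
        rw [hT.1]
        refine (tri _ _ _).1.trans ?_
        have := b2 j 0 1 y; have := b2 j 1 1 y; have := b1 j 0 y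
        simp only [hM]; linarith
      · simp only [Fin.mk_one]
        rw [hT.2]
        refine (tri _ _ _).2.trans ?_
        have := b2 j 0 0 y; have := b2 j 1 0 y; have := b1 j 1 y
        simp only [hM]; linarith
    · intro i j y
      have := b2 i j k y; have := hm0 0 y; have := hm0 1 y; have := hm0 2 y
      simp only [hM]; linarith
  have hI : 0 ≤ ∫ y, M y := integral_nonneg fun y => by
    have := hm0 0 y; have := hm0 1 y; have := hm0 2 y
    simp only [hM, Pi.zero_apply]; linarith
  refine ⟨8 * (∫ y, M y) + 1, by positivity, fun t ht x => ?_⟩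
  have ht0 : 0 < t := by linarith
  calc ‖φ t x‖ ≤ ‖φ t x 0‖ + ‖φ t x 1‖ := norm_spinor_le _
    _ ≤ 4 / t * (∫ y, M y) + 4 / t * ∫ y, M y := add_le_add (key 0 t ht x) (key 1 t ht x)
    _ = (8 * ∫ y, M y) / t := by ring
    _ ≤ _ := by gcongr; linarith

end DiracDecay

/-! ### Conservation of charge and finite speed of propagation -/

section Cutoffs

/-- The Japanese bracket `⟨x⟩ = √(1 + |x|²)`. -/
def bracket (x : Plane) : ℝ := Real.sqrt (1 + ‖x‖ ^ 2)

lemma bracket_pos (x : Plane) : 0 < bracket x := Real.sqrt_pos.2 (by positivity)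

lemma norm_le_bracket (x : Plane) : ‖x‖ ≤ bracket x :=
  Real.le_sqrt_of_sq_le (by linarith)

lemma contDiff_bracket : ContDiff ℝ ∞ bracket :=
  ContDiff.sqrt (contDiff_const.add (contDiff_norm_sq ℝ)) fun x => by positivity

lemma fderiv_bracket (x v : Plane) : fderiv ℝ bracket x v = inner ℝ x v / bracket x := by
  have h1 : HasFDerivAt (fun x : Plane => 1 + ‖x‖ ^ 2) (2 • (innerSL ℝ x)) x :=
    (hasStrictFDerivAt_norm_sq x).hasFDerivAt.const_add 1
  have := (h1.sqrt (by positivity)).fderiv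
  rw [show bracket = fun x => Real.sqrt (1 + ‖x‖ ^ 2) from rfl, this]
  simp
  field_simp

/-- The argument `R - σ t - ε ⟨x⟩` of the cutoff functions. -/
def cutoffPhase (R σ ε : ℝ) (p : ℝ × Plane) : ℝ := R - σ * p.1 - ε * bracket p.2

/-- A smooth cutoff to the region `ε ⟨x⟩ ≤ R - 1 - σ t`, vanishing where `ε ⟨x⟩ ≥ R - σ t`. For
`ε = 1` and `σ = ±1` the region is a backward or a forward light cone. -/
def cutoff (R σ ε : ℝ) (p : ℝ × Plane) : ℝ := Real.smoothTransition (cutoffPhase R σ ε p)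

variable {R σ ε : ℝ}

lemma contDiff_cutoffPhase : ContDiff ℝ ∞ (cutoffPhase R σ ε) := by
  have := contDiff_bracket.comp (contDiff_snd (𝕜 := ℝ) (E := ℝ) (F := Plane))
  exact (contDiff_const.sub (contDiff_const.mul contDiff_fst)).sub (contDiff_const.mul this)

lemma contDiff_cutoff : ContDiff ℝ ∞ (cutoff R σ ε) :=
  (Real.smoothTransition.contDiff (n := ⊤)).comp contDiff_cutoffPhase

lemma cutoff_nonneg (p : ℝ × Plane) : 0 ≤ cutoff R σ ε p := Real.smoothTransition.nonneg _

lemma cutoff_le_one (p : ℝ × Plane) : cutoff R σ ε p ≤ 1 := Real.smoothTransition.le_one _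

lemma fderiv_cutoffPhase (p v : ℝ × Plane) : fderiv ℝ (cutoffPhase R σ ε) p v =
    -σ * v.1 - ε * (inner ℝ p.2 v.2 / bracket p.2) := by
  have h1 : HasFDerivAt (fun p : ℝ × Plane => bracket p.2)
      ((fderiv ℝ bracket p.2).comp (ContinuousLinearMap.snd ℝ ℝ Plane)) p :=
    ((contDiff_bracket.differentiable (by simp) p.2).hasFDerivAt).comp p hasFDerivAt_snd
  have h2 : HasFDerivAt (fun p : ℝ × Plane => p.1) (ContinuousLinearMap.fst ℝ ℝ Plane) p :=
    hasFDerivAt_fst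
  have := (((h2.const_mul σ).const_sub R).sub (h1.const_mul ε)).fderiv
  rw [show cutoffPhase R σ ε = (fun p : ℝ × Plane => R - σ * p.1) - fun p => ε * bracket p.2
    from rfl]
  rw [this]
  simp [fderiv_bracket]

lemma dirDeriv_cutoff (p v : ℝ × Plane) :
    dirDeriv v (fun p => (cutoff R σ ε p : ℂ)) p =
      ((deriv Real.smoothTransition (cutoffPhase R σ ε p) *
        (-σ * v.1 - ε * (inner ℝ p.2 v.2 / bracket p.2)) : ℝ) : ℂ) := by
  have h1 : HasDerivAt Real.smoothTransition (deriv Real.smoothTransition (cutoffPhase R σ ε p))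
      (cutoffPhase R σ ε p) :=
    ((Real.smoothTransition.contDiff (n := ⊤)).differentiable (by simp) _).hasDerivAt
  have h2 := h1.comp_hasFDerivAt p (contDiff_cutoffPhase.differentiable (by simp) p).hasFDerivAt
  have h3 := (Complex.ofRealCLM.hasFDerivAt.comp p h2).fderiv
  unfold dirDeriv
  rw [show (fun p => (cutoff R σ ε p : ℂ)) =
    Complex.ofRealCLM ∘ (Real.smoothTransition ∘ cutoffPhase R σ ε) from rfl, h3]
  simp [fderiv_cutoffPhase]

lemma contDiff_ofReal_cutoff : ContDiff ℝ ∞ (fun p => (cutoff R σ ε p : ℂ)) :=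
  Complex.ofRealCLM.contDiff.comp contDiff_cutoff

lemma hasBoundedSlices_cutoff (hε : 0 < ε) : HasBoundedSlices (fun p => (cutoff R σ ε p : ℂ)) := by
  intro t₀
  refine ⟨(R + |σ| * (|t₀| + 2)) / ε, fun t x ht hx => ?_⟩
  rw [div_le_iff₀ hε] at hx
  have h1 : |t| ≤ |t₀| + 2 := by
    have := abs_sub_abs_le_abs_sub t t₀; linarith
  have h2 : -(σ * t) ≤ |σ| * (|t₀| + 2) := by
    calc -(σ * t) ≤ |σ * t| := neg_le_abs _
      _ = |σ| * |t| := abs_mul _ _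
      _ ≤ _ := by gcongr
  have h3 := mul_le_mul_of_nonneg_left (norm_le_bracket x) hε.le
  have : cutoff R σ ε (t, x) = 0 := Real.smoothTransition.zero_of_nonpos (by
    simp only [cutoffPhase]; linarith)
  simp [this]

lemma deriv_smoothTransition_nonneg (x : ℝ) : 0 ≤ deriv Real.smoothTransition x :=
  Real.smoothTransition.monotone.deriv_nonneg

lemma exists_deriv_smoothTransition_le :
    ∃ C : ℝ, 0 ≤ C ∧ ∀ x, deriv Real.smoothTransition x ≤ C := by
  have hc : Continuous (deriv Real.smoothTransition) :=
    (Real.smoothTransition.contDiff (n := ⊤)).continuous_deriv (by simp)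
  obtain ⟨C, hC⟩ := isCompact_Icc (a := (0 : ℝ)) (b := 1) |>.exists_bound_of_continuousOn
    hc.continuousOn
  refine ⟨max C 0, le_max_right _ _, fun x => ?_⟩
  by_cases hx : x ∈ Set.Icc (0 : ℝ) 1
  · exact (le_abs_self _).trans ((hC x hx).trans (le_max_left _ _))
  · have : deriv Real.smoothTransition x = 0 := by
      rw [Set.mem_Icc, not_and_or, not_le, not_le] at hx
      rcases hx with h | h
      · have : Real.smoothTransition =ᶠ[𝓝 x] fun _ => 0 := by
          filter_upwards [Iio_mem_nhds h] with y hy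
          exact Real.smoothTransition.zero_of_nonpos (le_of_lt hy)
        rw [this.deriv_eq]; simp
      · have : Real.smoothTransition =ᶠ[𝓝 x] fun _ => 1 := by
          filter_upwards [Ioi_mem_nhds h] with y hy
          exact Real.smoothTransition.one_of_one_le (le_of_lt hy)
        rw [this.deriv_eq]; simp
    rw [this]; exact le_max_right _ _

lemma inner_basisVec (x : Plane) (j : Fin 2) : inner ℝ x (basisVec j) = x j := by
  simp [EuclideanSpace.inner_single_right]

end Cutoffs

section FluxBounds

lemma norm_sq_spinor (u : Spinor) : ‖u‖ ^ 2 = ‖u 0‖ ^ 2 + ‖u 1‖ ^ 2 := by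
  rw [EuclideanSpace.norm_sq_eq, Fin.sum_univ_two]

lemma dot_self (u : Spinor) : dot u u = ((‖u‖ ^ 2 : ℝ) : ℂ) := by
  rw [dot_eq, Complex.mul_conj', Complex.mul_conj', norm_sq_spinor]; push_cast; rfl

lemma norm_dot_le (u v : Spinor) : ‖dot u v‖ ≤ ‖u‖ * ‖v‖ := by
  have : dot u v = inner ℂ v u := by
    simp [dot, PiLp.inner_apply]
  rw [this, mul_comm]
  exact norm_inner_le_norm v u

lemma norm_act_alpha (j : Fin 2) (u : Spinor) : ‖act (alpha j) u‖ = ‖u‖ := by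
  have : ‖act (alpha j) u‖ ^ 2 = ‖u‖ ^ 2 := by
    rw [norm_sq_spinor, norm_sq_spinor]
    fin_cases j
    · simp only [Fin.zero_eta]; rw [(act_alpha_zero u).1, (act_alpha_zero u).2]; ring
    · simp only [Fin.mk_one]; rw [(act_alpha_one u).1, (act_alpha_one u).2]; simp; ring
  exact (sq_eq_sq₀ (norm_nonneg _) (norm_nonneg _)).1 this

lemma norm_act_beta (u : Spinor) : ‖act beta u‖ = ‖u‖ := by
  have : ‖act beta u‖ ^ 2 = ‖u‖ ^ 2 := by
    rw [norm_sq_spinor, norm_sq_spinor, (act_beta u).1, (act_beta u).2]; simp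
  exact (sq_eq_sq₀ (norm_nonneg _) (norm_nonneg _)).1 this

/-- The current density `⟨αʲu, u⟩` is real, and its component in the direction of a vector `e`
of length at most one is bounded by the charge density. -/
lemma exists_real_flux (u : Spinor) : ∃ r : Fin 2 → ℝ, (∀ j, dot (act (alpha j) u) u = (r j : ℂ)) ∧
    ∀ e : Plane, ‖e‖ ≤ 1 → |∑ j, e j * r j| ≤ ‖u‖ ^ 2 := by
  set z : ℂ := u 1 * (starRingEnd ℂ) (u 0) with hz
  refine ⟨![2 * z.re, 2 * z.im], fun j => ?_, fun e he => ?_⟩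
  · have hzc : (starRingEnd ℂ) z = u 0 * (starRingEnd ℂ) (u 1) := by simp [hz, mul_comm]
    fin_cases j
    · simp only [Fin.zero_eta]
      rw [dot_eq, (act_alpha_zero u).1, (act_alpha_zero u).2, ← hzc, ← hz, Complex.add_conj]
      simp
    · simp only [Fin.mk_one]
      rw [dot_eq, (act_alpha_one u).1, (act_alpha_one u).2, mul_assoc, mul_assoc, ← hzc, ← hz]
      apply Complex.ext <;> simp; ring
  · have hzn : ‖z‖ = ‖u 1‖ * ‖u 0‖ := by simp [hz]
    have he2 : e 0 ^ 2 + e 1 ^ 2 ≤ 1 := by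
      have : ‖e‖ ^ 2 = e 0 ^ 2 + e 1 ^ 2 := by
        rw [EuclideanSpace.norm_sq_eq, Fin.sum_univ_two]; simp
      nlinarith [norm_nonneg e]
    have hz2 : z.re ^ 2 + z.im ^ 2 = ‖z‖ ^ 2 := by
      rw [← Complex.normSq_eq_norm_sq, Complex.normSq_apply]; ring
    have h1 : |e 0 * z.re + e 1 * z.im| ≤ ‖z‖ := by
      apply abs_le_of_sq_le_sq _ (norm_nonneg _)
      nlinarith [sq_nonneg (e 0 * z.im - e 1 * z.re), sq_nonneg ‖z‖]
    rw [Fin.sum_univ_two, norm_sq_spinor]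
    have : e 0 * (![2 * z.re, 2 * z.im] : Fin 2 → ℝ) 0 + e 1 * (![2 * z.re, 2 * z.im] : Fin 2 → ℝ) 1
      = 2 * (e 0 * z.re + e 1 * z.im) := by simp; ring
    rw [this, abs_mul, abs_two]
    nlinarith [sq_nonneg (‖u 0‖ - ‖u 1‖)]

end FluxBounds

section Mass

variable {ψ N : ℝ → Plane → Spinor}

/-- The charge of `ψ(t)`, localized by the cutoff. -/
def localMass (R σ : ℝ) (ψ : ℝ → Plane → Spinor) (t : ℝ) : ℝ :=
  ∫ x, cutoff R σ 1 (t, x) * ‖ψ t x‖ ^ 2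

/-- The charge in a shrinking cone decreases and the charge in a growing cone increases, because
the flux through a light cone is controlled by the density. -/
lemma localMass_monotone (hψ : JointlySmooth ψ) (hN : ∀ t x, diracEvol ψ t x = N t x)
    (hreal : ∀ t x, dot (N t x) (ψ t x) = dot (ψ t x) (N t x)) (R : ℝ) :
    Antitone (localMass R 1 ψ) ∧ Monotone (localMass R (-1) ψ) := by
  have key : ∀ σ : ℝ, |σ| = 1 → ∀ t, ∃ d : ℝ, σ * d ≤ 0 ∧ HasDerivAt (localMass R σ ψ) d t := by
    intro σ hσ t
    have hd := hasDerivAt_integral_balance (contDiff_ofReal_cutoff (R := R) (σ := σ) (ε := 1))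
      (hasBoundedSlices_cutoff one_pos) (contDiff_dot hψ hψ)
      (fun j => contDiff_dot (jointlySmooth_act (alpha j) hψ) hψ)
      (S := fun _ => 0) (fun p => by
        rw [dot_balance hψ hψ hN hN, hreal, sub_self, mul_zero]) t
    choose r hr hrb using fun x => exists_real_flux (ψ t x)
    set D : Plane → ℝ := fun x => deriv Real.smoothTransition (cutoffPhase R σ 1 (t, x)) *
      (-σ * ‖ψ t x‖ ^ 2 - ∑ j, (bracket x)⁻¹ * x j * r x j) with hD
    have e1 : ∀ x, (dirDeriv timeVec (fun p => (cutoff R σ 1 p : ℂ)) (t, x) *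
        dot (ψ t x) (ψ t x) + ∑ j, dirDeriv (spaceVec j) (fun p => (cutoff R σ 1 p : ℂ)) (t, x) *
        dot (act (alpha j) (ψ t x)) (ψ t x) + (cutoff R σ 1 (t, x) : ℂ) * 0) = (D x : ℂ) := by
      intro x
      rw [Fin.sum_univ_two, dirDeriv_cutoff, dirDeriv_cutoff, dirDeriv_cutoff, hr, hr, dot_self]
      simp only [hD, inner_basisVec, Fin.sum_univ_two, inner_zero_right]
      push_cast
      ring
    have e2 : (fun t => ∫ x, (cutoff R σ 1 (t, x) : ℂ) * dot (ψ t x) (ψ t x)) =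
        fun t => ((localMass R σ ψ t : ℝ) : ℂ) := by
      funext s
      unfold localMass
      rw [← integral_complex_ofReal]
      congr 1; funext x; rw [dot_self]; push_cast; rfl
    simp only [e1] at hd
    rw [e2, integral_complex_ofReal] at hd
    refine ⟨∫ x, D x, ?_, by
      simpa [Function.comp_def] using Complex.reCLM.hasFDerivAt.comp_hasDerivAt t hd⟩
    rw [← integral_const_mul]
    refine integral_nonpos fun x => ?_
    have hσ2 : σ * σ = 1 := by rw [← abs_mul_abs_self, hσ, one_mul]
    have hb := hrb x ((bracket x)⁻¹ • x) (by
      rw [norm_smul, norm_inv, Real.norm_of_nonneg (bracket_pos x).le, inv_mul_le_iff₀ (bracket_pos x),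
        mul_one]
      exact norm_le_bracket x)
    simp only [PiLp.smul_apply, smul_eq_mul] at hb
    have h1 : σ * D x = deriv Real.smoothTransition (cutoffPhase R σ 1 (t, x)) *
        (-‖ψ t x‖ ^ 2 - σ * ∑ j, (bracket x)⁻¹ * x j * r x j) := by
      simp only [hD]
      linear_combination (-deriv Real.smoothTransition (cutoffPhase R σ 1 (t, x)) *
        ‖ψ t x‖ ^ 2) * hσ2
    simp only [h1, Pi.zero_apply]
    refine mul_nonpos_of_nonneg_of_nonpos (deriv_smoothTransition_nonneg _) ?_
    have h2 : |σ * ∑ j, (bracket x)⁻¹ * x j * r x j| ≤ ‖ψ t x‖ ^ 2 := by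
      rw [abs_mul, hσ, one_mul]; exact hb
    linarith [neg_abs_le (σ * ∑ j, (bracket x)⁻¹ * x j * r x j)]
  constructor
  · refine antitone_of_deriv_nonpos (fun t => ?_) fun t => ?_
    · obtain ⟨d, -, hd⟩ := key 1 (by simp) t; exact hd.differentiableAt
    · obtain ⟨d, h, hd⟩ := key 1 (by simp) t; rw [hd.deriv]; linarith
  · refine monotone_of_deriv_nonneg (fun t => ?_) fun t => ?_
    · obtain ⟨d, -, hd⟩ := key (-1) (by simp) t; exact hd.differentiableAt
    · obtain ⟨d, h, hd⟩ := key (-1) (by simp) t; rw [hd.deriv]; linarith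

/-- The total charge, possibly infinite. -/
def mass (ψ : ℝ → Plane → Spinor) (t : ℝ) : ℝ≥0∞ := ∫⁻ x, ‖ψ t x‖ₑ ^ 2

lemma continuous_slice (hψ : JointlySmooth ψ) (t : ℝ) : Continuous (ψ t) :=
  hψ.continuous.comp (by fun_prop : Continuous fun x : Plane => (t, x))

lemma ofReal_localMass (hψ : JointlySmooth ψ) (R σ t : ℝ) :
    ENNReal.ofReal (localMass R σ ψ t) =
      ∫⁻ x, ENNReal.ofReal (cutoff R σ 1 (t, x)) * ‖ψ t x‖ₑ ^ 2 := by
  have hc : Continuous (fun x => cutoff R σ 1 (t, x)) :=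
    contDiff_cutoff.continuous.comp (by fun_prop : Continuous fun x : Plane => (t, x))
  have hs : HasCompactSupport (fun x => cutoff R σ 1 (t, x)) := by
    have := (hasBoundedSlices_cutoff (R := R) (σ := σ) one_pos).hasCompactSupport t
    have h2 := this.comp_left (g := Complex.re) (by simp)
    simpa [Function.comp_def] using h2
  have hψc : Continuous (fun x => ‖ψ t x‖ ^ 2) := (continuous_slice hψ t).norm.pow 2
  have hi : Integrable (fun x => cutoff R σ 1 (t, x) * ‖ψ t x‖ ^ 2) :=
    (hc.mul hψc).integrable_of_hasCompactSupport hs.mul_right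
  unfold localMass
  rw [ofReal_integral_eq_lintegral_ofReal hi
    (ae_of_all _ fun x => mul_nonneg (cutoff_nonneg _) (by positivity))]
  refine lintegral_congr fun x => ?_
  rw [ENNReal.ofReal_mul (cutoff_nonneg _), ENNReal.ofReal_pow (norm_nonneg _), ofReal_norm]

lemma ofReal_localMass_le (hψ : JointlySmooth ψ) (R σ t : ℝ) :
    ENNReal.ofReal (localMass R σ ψ t) ≤ mass ψ t := by
  rw [ofReal_localMass hψ]
  refine lintegral_mono fun x => ?_
  calc _ ≤ 1 * ‖ψ t x‖ₑ ^ 2 := by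
        gcongr; exact ENNReal.ofReal_le_one.2 (cutoff_le_one _)
    _ = _ := one_mul _

/-- Fatou's lemma, for the exhaustion of the plane by growing cutoffs. -/
lemma mass_le_of_localMass_le (hψ : JointlySmooth ψ) (σ t : ℝ) {B : ℝ≥0∞}
    (h : ∀ R, ENNReal.ofReal (localMass R σ ψ t) ≤ B) : mass ψ t ≤ B := by
  have hlim : ∀ x, Tendsto (fun n : ℕ => ENNReal.ofReal (cutoff n σ 1 (t, x)) * ‖ψ t x‖ₑ ^ 2) atTop
      (𝓝 (‖ψ t x‖ₑ ^ 2)) := by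
    intro x
    apply tendsto_const_nhds.congr'
    filter_upwards [tendsto_natCast_atTop_atTop.eventually_ge_atTop
      (1 + σ * t + bracket x)] with n hn
    have : cutoff n σ 1 (t, x) = 1 := Real.smoothTransition.one_of_one_le (by
      simp only [cutoffPhase]; linarith)
    simp [this]
  calc mass ψ t = ∫⁻ x, liminf (fun n : ℕ =>
        ENNReal.ofReal (cutoff n σ 1 (t, x)) * ‖ψ t x‖ₑ ^ 2) atTop :=
        lintegral_congr fun x => (hlim x).liminf_eq.symm
    _ ≤ liminf (fun n : ℕ => ∫⁻ x,
        ENNReal.ofReal (cutoff n σ 1 (t, x)) * ‖ψ t x‖ₑ ^ 2) atTop := by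
        refine lintegral_liminf_le fun n => Measurable.fun_mul ?_ ?_
        · exact (contDiff_cutoff.continuous.comp
            (by fun_prop : Continuous fun x : Plane => (t, x))).measurable.ennreal_ofReal
        · exact ((continuous_slice hψ t).measurable.enorm).pow_const 2
    _ ≤ liminf (fun _ : ℕ => B) atTop := by
        refine liminf_le_liminf (Eventually.of_forall fun n => ?_)
        have := h n
        rwa [ofReal_localMass hψ] at this
    _ = B := by simp

/-- Conservation of charge, with no assumption on the growth of `ψ`. -/
theorem mass_eq (hψ : JointlySmooth ψ) (hN : ∀ t x, diracEvol ψ t x = N t x)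
    (hreal : ∀ t x, dot (N t x) (ψ t x) = dot (ψ t x) (N t x)) (s t : ℝ) :
    mass ψ s = mass ψ t := by
  have key : ∀ {s t : ℝ}, s ≤ t → mass ψ s = mass ψ t := by
    intro s t hst
    apply le_antisymm
    · exact mass_le_of_localMass_le hψ (-1) s fun R => (ENNReal.ofReal_le_ofReal
        ((localMass_monotone hψ hN hreal R).2 hst)).trans (ofReal_localMass_le hψ R _ t)
    · exact mass_le_of_localMass_le hψ 1 t fun R => (ENNReal.ofReal_le_ofReal
        ((localMass_monotone hψ hN hreal R).1 hst)).trans (ofReal_localMass_le hψ R _ s)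
  rcases le_total s t with h | h
  · exact key h
  · exact (key h).symm

/-- Finite speed of propagation: a fixed amount of charge stays in a ball growing at unit speed. -/
theorem exists_mass_ball (hψ : JointlySmooth ψ) (hN : ∀ t x, diracEvol ψ t x = N t x)
    (hreal : ∀ t x, dot (N t x) (ψ t x) = dot (ψ t x) (N t x)) (h0 : mass ψ 0 ≠ 0) :
    ∃ μ R : ℝ, 0 < μ ∧ 0 < R ∧ ∀ t, 0 ≤ t →
      ENNReal.ofReal μ ≤ ∫⁻ x in Metric.ball 0 (R + t), ‖ψ t x‖ₑ ^ 2 := by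
  obtain ⟨R, hR⟩ : ∃ R, ENNReal.ofReal (localMass R (-1) ψ 0) ≠ 0 := by
    by_contra! h
    exact h0 (nonpos_iff_eq_zero.1 (mass_le_of_localMass_le hψ (-1) 0 fun R => (h R).le))
  refine ⟨localMass R (-1) ψ 0, max R 1, ?_, by positivity, fun t ht => ?_⟩
  · by_contra! h; exact hR (ENNReal.ofReal_of_nonpos h)
  · refine (ENNReal.ofReal_le_ofReal ((localMass_monotone hψ hN hreal R).2 ht)).trans ?_
    rw [ofReal_localMass hψ, ← lintegral_indicator measurableSet_ball]
    refine lintegral_mono fun x => ?_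
    by_cases hx : x ∈ Metric.ball (0 : Plane) (max R 1 + t)
    · rw [Set.indicator_of_mem hx]
      calc _ ≤ 1 * ‖ψ t x‖ₑ ^ 2 := by
            gcongr; exact ENNReal.ofReal_le_one.2 (cutoff_le_one _)
        _ = _ := one_mul _
    · have h1 : max R 1 + t ≤ ‖x‖ := by simpa using hx
      have : cutoff R (-1) 1 (t, x) = 0 := Real.smoothTransition.zero_of_nonpos (by
        simp only [cutoffPhase]
        linarith [norm_le_bracket x, le_max_left R 1])
      simp [this]

end Mass

/-! ### Positive definiteness of the Riesz kernel -/

section PositiveDefinite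

/-- A kernel that is a superposition of products `a(x,z) a(y,z)` is positive definite. -/
lemma integral_kernel_nonneg {X Z : Type*} [MeasurableSpace X] [MeasurableSpace Z]
    {μ : Measure X} {ν : Measure Z} [SFinite μ] [SFinite ν] {a : X → Z → ℝ}
    (ha : Measurable (fun p : X × Z => a p.1 p.2)) (ha0 : ∀ x z, 0 ≤ a x z) {k : X × X → ℝ}
    (hk : ∀ᵐ p ∂(μ.prod μ), Integrable (fun z => a p.1 z * a p.2 z) ν ∧
      ∫ z, a p.1 z * a p.2 z ∂ν = k p)
    {r : X → ℝ} (hr : Measurable r)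
    (hi : Integrable (fun p : X × X => k p * (r p.1 * r p.2)) (μ.prod μ)) :
    0 ≤ ∫ p, k p * (r p.1 * r p.2) ∂(μ.prod μ) := by
  set F : X × X → Z → ℝ := fun p z => (a p.1 z * a p.2 z) * (r p.1 * r p.2) with hF
  have hFm : Measurable (Function.uncurry F) := by
    have m1 : Measurable (fun q : (X × X) × Z => a q.1.1 q.2) :=
      ha.comp (by fun_prop : Measurable fun q : (X × X) × Z => (q.1.1, q.2))
    have m2 : Measurable (fun q : (X × X) × Z => a q.1.2 q.2) :=
      ha.comp (by fun_prop : Measurable fun q : (X × X) × Z => (q.1.2, q.2))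
    exact (m1.mul m2).mul (by fun_prop)
  have hint : ∀ᵐ p ∂(μ.prod μ), ∫ z, F p z ∂ν = k p * (r p.1 * r p.2) := by
    filter_upwards [hk] with p hp
    simp only [hF]
    rw [integral_mul_const, hp.2]
  have hFi : Integrable (Function.uncurry F) ((μ.prod μ).prod ν) := by
    rw [integrable_prod_iff hFm.aestronglyMeasurable]
    constructor
    · filter_upwards [hk] with p hp
      exact hp.1.mul_const (r p.1 * r p.2)
    · refine hi.norm.congr ?_
      filter_upwards [hk] with p hp
      have : ∀ z, ‖Function.uncurry F (p, z)‖ = (a p.1 z * a p.2 z) * ‖r p.1 * r p.2‖ := by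
        intro z
        simp only [Function.uncurry, hF]
        rw [norm_mul, Real.norm_of_nonneg (mul_nonneg (ha0 _ _) (ha0 _ _))]
      simp_rw [this]
      rw [integral_mul_const, hp.2, norm_mul, Real.norm_of_nonneg]
      rw [← hp.2]
      exact integral_nonneg fun z => mul_nonneg (ha0 _ _) (ha0 _ _)
  rw [← integral_congr_ae hint, integral_integral_swap hFi]
  refine integral_nonneg fun z => ?_
  have : ∀ p : X × X, F p z = (a p.1 z * r p.1) * (a p.2 z * r p.2) := fun p => by
    simp only [hF]; ring
  simp_rw [this]
  rw [integral_prod_mul (fun x => a x z * r x) (fun y => a y z * r y)]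
  exact mul_self_nonneg _

/-- The factor in the representation of `|x - y|^{-γ}` as a superposition of products of
Gaussians, over the inverse width `z.1 > 0` and the centre `z.2`. -/
def gaussFactor (γ : ℝ) (x : Plane) (z : ℝ × Plane) : ℝ :=
  |z.1| ^ (γ / 4) * Real.exp (-(2 * z.1) * ‖x - z.2‖ ^ 2)

lemma integral_gaussian_plane {b : ℝ} (hb : 0 < b) (m : Plane) :
    Integrable (fun z : Plane => Real.exp (-b * ‖z - m‖ ^ 2)) ∧
    ∫ z : Plane, Real.exp (-b * ‖z - m‖ ^ 2) = Real.pi / b := by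
  have h : ∫ z : Plane, Real.exp (-b * ‖z‖ ^ 2) = Real.pi / b := by
    rw [GaussianFourier.integral_rexp_neg_mul_sq_norm hb]; simp
  have hi : Integrable (fun z : Plane => Real.exp (-b * ‖z‖ ^ 2)) :=
    Integrable.of_integral_ne_zero (by rw [h]; positivity)
  exact ⟨hi.comp_sub_right m, (integral_sub_right_eq_self
    (fun z : Plane => Real.exp (-b * ‖z‖ ^ 2)) m).trans h⟩

/-- The parallelogram law separates the centre of the Gaussians from the distance of `x` and `y`. -/
lemma gaussFactor_mul {γ l : ℝ} (hl : 0 < l) (x y z : Plane) :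
    gaussFactor γ x (l, z) * gaussFactor γ y (l, z) =
      l ^ (γ / 2) * Real.exp (-l * ‖x - y‖ ^ 2) *
        Real.exp (-(4 * l) * ‖z - ((1 / 2 : ℝ) • (x + y))‖ ^ 2) := by
  have hpar : ‖x - z‖ ^ 2 + ‖y - z‖ ^ 2 =
      2 * ‖z - ((1 / 2 : ℝ) • (x + y))‖ ^ 2 + ‖x - y‖ ^ 2 / 2 := by
    have h := parallelogram_law_with_norm ℝ (x - z) (y - z)
    have h1 : (x - z) + (y - z) = (-2 : ℝ) • (z - ((1 / 2 : ℝ) • (x + y))) := by module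
    have h2 : (x - z) - (y - z) = x - y := by abel
    rw [h1, h2, norm_smul, Real.norm_eq_abs, abs_neg, abs_two] at h
    linear_combination -h / 2
  simp only [gaussFactor, abs_of_pos hl]
  have e1 : l ^ (γ / 4) * l ^ (γ / 4) = l ^ (γ / 2) := by
    rw [← Real.rpow_add hl]; congr 1; ring
  rw [mul_mul_mul_comm, e1, mul_assoc, ← Real.exp_add, ← Real.exp_add]
  congr 2
  linear_combination (-2 * l) * hpar

/-- Integrating over the centre gives a Gaussian in `x - y`, and integrating over the width gives
the Riesz kernel by the definition of the Gamma function. -/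
lemma integral_gaussFactor {γ : ℝ} (hγ : 0 < γ) {x y : Plane} (hxy : x ≠ y) :
    Integrable (fun z => gaussFactor γ x z * gaussFactor γ y z)
      ((volume.restrict (Set.Ioi (0 : ℝ))).prod volume) ∧
    ∫ z, gaussFactor γ x z * gaussFactor γ y z ∂((volume.restrict (Set.Ioi (0 : ℝ))).prod volume) =
      Real.pi / 4 * Real.Gamma (γ / 2) * ‖x - y‖ ^ (-γ) := by
  have hd : 0 < ‖x - y‖ := norm_pos_iff.2 (sub_ne_zero.2 hxy)
  have hmeas : Measurable (fun z => gaussFactor γ x z * gaussFactor γ y z) := by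
    unfold gaussFactor; fun_prop
  have hin : ∀ l ∈ Set.Ioi (0 : ℝ), Integrable (fun z =>
      gaussFactor γ x (l, z) * gaussFactor γ y (l, z)) ∧
      ∫ z, gaussFactor γ x (l, z) * gaussFactor γ y (l, z) =
      Real.pi / 4 * (l ^ (γ / 2 - 1) * Real.exp (-(‖x - y‖ ^ 2 * l))) := by
    intro l hl
    have hl : 0 < l := hl
    obtain ⟨g1, g2⟩ := integral_gaussian_plane (b := 4 * l) (by positivity)
      ((1 / 2 : ℝ) • (x + y))
    simp_rw [gaussFactor_mul hl]
    refine ⟨g1.const_mul _, ?_⟩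
    rw [integral_const_mul, g2, Real.rpow_sub hl, Real.rpow_one,
      show -(‖x - y‖ ^ 2 * l) = -l * ‖x - y‖ ^ 2 by ring]
    field_simp
  have hG : ∫ l in Set.Ioi (0 : ℝ), l ^ (γ / 2 - 1) * Real.exp (-(‖x - y‖ ^ 2 * l)) =
      Real.Gamma (γ / 2) * ‖x - y‖ ^ (-γ) := by
    rw [Real.integral_rpow_mul_exp_neg_mul_Ioi (by positivity) (by positivity), mul_comm]
    congr 1
    rw [one_div, Real.inv_rpow (by positivity), ← Real.rpow_natCast, ← Real.rpow_mul hd.le,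
      Real.rpow_neg hd.le]
    congr 2; push_cast; ring
  have hGi : Integrable (fun l => l ^ (γ / 2 - 1) * Real.exp (-(‖x - y‖ ^ 2 * l)))
      (volume.restrict (Set.Ioi (0 : ℝ))) := by
    refine Integrable.of_integral_ne_zero ?_
    rw [hG]
    have := Real.Gamma_pos_of_pos (half_pos hγ)
    positivity
  have hI : Integrable (fun z => gaussFactor γ x z * gaussFactor γ y z)
      ((volume.restrict (Set.Ioi (0 : ℝ))).prod volume) := by
    rw [integrable_prod_iff hmeas.aestronglyMeasurable]
    constructor
    · exact (ae_restrict_iff' measurableSet_Ioi).2 (ae_of_all _ fun l hl => (hin l hl).1)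
    · refine (hGi.const_mul (Real.pi / 4)).congr ?_
      refine (ae_restrict_iff' measurableSet_Ioi).2 (ae_of_all _ fun l hl => ?_)
      refine Eq.trans (hin l hl).2.symm ?_
      refine integral_congr_ae (ae_of_all _ fun z => ?_)
      have hl : 0 < l := hl
      have : 0 ≤ gaussFactor γ x (l, z) * gaussFactor γ y (l, z) := by
        unfold gaussFactor; positivity
      exact (Real.norm_of_nonneg this).symm
  refine ⟨hI, ?_⟩
  rw [integral_prod _ hI, setIntegral_congr_fun measurableSet_Ioi fun l hl => (hin l hl).2,
    integral_const_mul, hG, mul_assoc]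

/-- The Riesz kernel `|x - y|^{-γ}` is positive definite: it is a superposition of the products
`gaussFactor γ x z * gaussFactor γ y z` off the diagonal. -/
theorem riesz_energy_nonneg {γ : ℝ} (hγ : 0 < γ) {r : Plane → ℝ} (hr : Measurable r)
    (hi : Integrable (fun p : Plane × Plane => ‖p.1 - p.2‖ ^ (-γ) * (r p.1 * r p.2))) :
    0 ≤ ∫ p : Plane × Plane, ‖p.1 - p.2‖ ^ (-γ) * (r p.1 * r p.2) := by
  have hc : 0 < Real.pi / 4 * Real.Gamma (γ / 2) :=
    mul_pos (by positivity) (Real.Gamma_pos_of_pos (half_pos hγ))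
  have hdiag : ∀ᵐ p : Plane × Plane, p.1 ≠ p.2 := by
    rw [Measure.volume_eq_prod]
    refine (Measure.ae_prod_iff_ae_ae (measurableSet_eq_fun measurable_fst measurable_snd).compl).2 ?_
    refine ae_of_all _ fun x => ?_
    filter_upwards [Measure.ae_ne volume x] with y hy using hy.symm
  have hm : Measurable (fun p : Plane × (ℝ × Plane) => gaussFactor γ p.1 p.2) := by
    unfold gaussFactor; fun_prop
  have h0 : ∀ x z, 0 ≤ gaussFactor γ x z := fun x z => by unfold gaussFactor; positivity
  have h := integral_kernel_nonneg (μ := (volume : Measure Plane))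
    (ν := (volume.restrict (Set.Ioi (0 : ℝ))).prod (volume : Measure Plane)) hm h0
    (k := fun p => Real.pi / 4 * Real.Gamma (γ / 2) * ‖p.1 - p.2‖ ^ (-γ))
    (by filter_upwards [hdiag] with p hp using integral_gaussFactor hγ hp) hr
    ((hi.const_mul (Real.pi / 4 * Real.Gamma (γ / 2))).congr
      (ae_of_all _ fun p => by simp only; ring))
  simp_rw [mul_assoc (Real.pi / 4 * Real.Gamma (γ / 2))] at h
  rw [integral_const_mul] at h
  exact nonneg_of_mul_nonneg_right h hc

end PositiveDefinite

/-! ### Bounds for Riesz potentials -/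

section RieszPotential

/-- The Riesz kernel `|x - y|^{-γ}` with values in `[0, ∞]`. For `γ ≠ 0` it takes the value `0`
rather than `∞` on the diagonal, which is a null set. -/
def riesz (γ : ℝ) (x y : Plane) : ℝ≥0∞ := ENNReal.ofReal (‖x - y‖ ^ (-γ))

@[fun_prop]
lemma measurable_riesz (γ : ℝ) : Measurable (fun p : Plane × Plane => riesz γ p.1 p.2) := by
  unfold riesz; fun_prop

@[fun_prop]
lemma measurable_riesz_right (γ : ℝ) (x : Plane) : Measurable (riesz γ x) := by
  unfold riesz; fun_prop

lemma riesz_comm (γ : ℝ) (x y : Plane) : riesz γ x y = riesz γ y x := by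
  unfold riesz; rw [norm_sub_rev]

lemma lintegral_radial {f : ℝ → ℝ≥0∞} (hf : Measurable f) (x : Plane) :
    ∫⁻ y, f ‖x - y‖ = ∫⁻ ρ in Set.Ioi (0 : ℝ), ENNReal.ofReal (2 * Real.pi * ρ) * f ρ := by
  rw [← lintegral_polar (fun y => f ‖x - y‖) (by fun_prop) x]
  refine setLIntegral_congr_fun measurableSet_Ioi fun ρ hρ => ?_
  have hρ : 0 < ρ := hρ
  have hn : ∀ ζ, ‖x - polarPoint x ρ ζ‖ = ρ := by
    intro ζ
    have : x - polarPoint x ρ ζ =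
        (-(ρ * Real.cos ζ)) • basisVec 0 + (-(ρ * Real.sin ζ)) • basisVec 1 := by
      unfold polarPoint; module
    rw [this, EuclideanSpace.norm_eq, Fin.sum_univ_two]
    have : ρ ^ 2 * Real.cos ζ ^ 2 + ρ ^ 2 * Real.sin ζ ^ 2 = ρ ^ 2 := by
      rw [← mul_add, Real.cos_sq_add_sin_sq, mul_one]
    simp [mul_pow, this, hρ.le]
  simp only [hn]
  rw [lintegral_const, Measure.restrict_apply_univ, Real.volume_Ioo, mul_left_comm, mul_comm,
    ← ENNReal.ofReal_mul hρ.le]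
  congr 2; ring

/-- The Riesz kernel is locally integrable for exponents below the dimension. -/
lemma lintegral_riesz_ball_le {γ : ℝ} (hγ : γ < 2) {r : ℝ} (hr : 0 < r) (x : Plane) :
    ∫⁻ y in Metric.ball x r, riesz γ x y ≤
      ENNReal.ofReal (2 * Real.pi / (2 - γ) * r ^ (2 - γ)) := by
  set f : ℝ → ℝ≥0∞ := (Set.Iio r).indicator fun ρ => ENNReal.ofReal (ρ ^ (-γ)) with hf
  have hfm : Measurable f := Measurable.indicator (by fun_prop) measurableSet_Iio
  have e1 : ∫⁻ y in Metric.ball x r, riesz γ x y = ∫⁻ y, f ‖x - y‖ := by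
    rw [← lintegral_indicator measurableSet_ball]
    refine lintegral_congr fun y => ?_
    by_cases hy : y ∈ Metric.ball x r
    · have h' : ‖x - y‖ ∈ Set.Iio r := by
        rw [norm_sub_rev]; simpa [dist_eq_norm] using hy
      rw [Set.indicator_of_mem hy, hf, Set.indicator_of_mem h']; rfl
    · have h' : ‖x - y‖ ∉ Set.Iio r := by
        rw [norm_sub_rev]; simpa [dist_eq_norm] using hy
      rw [Set.indicator_of_notMem hy, hf, Set.indicator_of_notMem h']
  have hi : IntervalIntegrable (fun ρ : ℝ => 2 * Real.pi * ρ ^ (1 - γ)) volume 0 r :=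
    (intervalIntegral.intervalIntegrable_rpow' (by linarith)).const_mul _
  have hval : ∫ ρ in (0 : ℝ)..r, 2 * Real.pi * ρ ^ (1 - γ) =
      2 * Real.pi / (2 - γ) * r ^ (2 - γ) := by
    rw [intervalIntegral.integral_const_mul, integral_rpow (Or.inl (by linarith)),
      show (1 - γ + 1) = 2 - γ by ring, Real.zero_rpow (by linarith)]
    ring
  rw [e1, lintegral_radial hfm, ← hval, intervalIntegral.integral_of_le hr.le,
    ofReal_integral_eq_lintegral_ofReal
      ((intervalIntegrable_iff_integrableOn_Ioc_of_le hr.le).1 hi)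
      ((ae_restrict_iff' measurableSet_Ioc).2 (ae_of_all _ fun ρ hρ => by
        have : 0 ≤ ρ := hρ.1.le
        simp only [Pi.zero_apply]; positivity)),
    ← lintegral_indicator measurableSet_Ioi, ← lintegral_indicator measurableSet_Ioc]
  refine lintegral_mono fun ρ => ?_
  by_cases h0 : ρ ∈ Set.Ioi (0 : ℝ)
  · by_cases h1 : ρ ∈ Set.Iio r
    · have h0' : 0 < ρ := h0
      have h2 : ρ ∈ Set.Ioc 0 r := ⟨h0, le_of_lt h1⟩
      simp only [hf]
      rw [Set.indicator_of_mem h0, Set.indicator_of_mem h1, Set.indicator_of_mem h2,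
        ← ENNReal.ofReal_mul (by positivity), Real.rpow_sub h0', Real.rpow_neg h0'.le,
        Real.rpow_one]
      apply le_of_eq; congr 1; ring
    · simp only [hf]
      rw [Set.indicator_of_mem h0, Set.indicator_of_notMem h1]; simp
  · rw [Set.indicator_of_notMem h0]; exact zero_le

/-- The Riesz potential of a density that is bounded near `x` and integrable. -/
lemma riesz_potential_le {γ : ℝ} (hγ0 : 0 ≤ γ) (hγ : γ < 2) {r : ℝ} (hr : 0 < r) (x : Plane)
    {f : Plane → ℝ≥0∞} {B : ℝ≥0∞} (hB : ∀ y ∈ Metric.ball x r, f y ≤ B) :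
    ∫⁻ y, riesz γ x y * f y ≤
      ENNReal.ofReal (2 * Real.pi / (2 - γ) * r ^ (2 - γ)) * B +
        ENNReal.ofReal (r ^ (-γ)) * ∫⁻ y, f y := by
  rw [← lintegral_add_compl _ (measurableSet_ball (x := x) (ε := r))]
  gcongr
  · calc ∫⁻ y in Metric.ball x r, riesz γ x y * f y ≤ ∫⁻ y in Metric.ball x r, riesz γ x y * B :=
          setLIntegral_mono' measurableSet_ball fun y hy => by gcongr; exact hB y hy
      _ = (∫⁻ y in Metric.ball x r, riesz γ x y) * B := lintegral_mul_const _ (by fun_prop)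
      _ ≤ _ := by gcongr; exact lintegral_riesz_ball_le hγ hr x
  · calc ∫⁻ y in (Metric.ball x r)ᶜ, riesz γ x y * f y ≤
          ∫⁻ y in (Metric.ball x r)ᶜ, ENNReal.ofReal (r ^ (-γ)) * f y := by
          refine setLIntegral_mono' measurableSet_ball.compl fun y hy => ?_
          have h' : r ≤ ‖x - y‖ := by
            rw [norm_sub_rev]; simpa [dist_eq_norm] using hy
          unfold riesz
          gcongr ?_ * _
          exact ENNReal.ofReal_le_ofReal (Real.rpow_le_rpow_of_nonpos hr h' (by linarith))
      _ ≤ ∫⁻ y, ENNReal.ofReal (r ^ (-γ)) * f y := setLIntegral_le_lintegral _ _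
      _ = _ := lintegral_const_mul' _ _ ENNReal.ofReal_ne_top

lemma lintegral_mul_le_sqrt {α : Type*} [MeasurableSpace α] {μ : Measure α} {f g : α → ℝ≥0∞}
    (hf : AEMeasurable f μ) (hg : AEMeasurable g μ) :
    ∫⁻ a, f a * g a ∂μ ≤ (∫⁻ a, f a ^ 2 ∂μ) ^ (1 / 2 : ℝ) * (∫⁻ a, g a ^ 2 ∂μ) ^ (1 / 2 : ℝ) := by
  have := ENNReal.lintegral_mul_le_Lp_mul_Lq μ (p := 2) (q := 2)
    ⟨by norm_num, by norm_num, by norm_num⟩ hf hg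
  simpa using this

/-- Cauchy-Schwarz for the Riesz potential of a product. -/
lemma riesz_potential_mul_le {γ : ℝ} (x : Plane) {f g : Plane → ℝ≥0∞} (hf : Measurable f)
    (hg : Measurable g) :
    ∫⁻ y, riesz γ x y * (f y * g y) ≤
      (∫⁻ y, f y ^ 2) ^ (1 / 2 : ℝ) * (∫⁻ y, riesz (2 * γ) x y * g y ^ 2) ^ (1 / 2 : ℝ) := by
  have h := lintegral_mul_le_sqrt (μ := (volume : Measure Plane)) hf.aemeasurable
    ((measurable_riesz_right γ x).mul hg).aemeasurable
  have e1 : ∀ y, riesz γ x y * (f y * g y) = f y * (riesz γ x * g) y := fun y => by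
    simp only [Pi.mul_apply]; ring
  have e2 : ∀ y, riesz (2 * γ) x y * g y ^ 2 = (riesz γ x * g) y ^ 2 := fun y => by
    simp only [Pi.mul_apply, mul_pow]
    congr 1
    unfold riesz
    rw [← ENNReal.ofReal_pow (by positivity), ← Real.rpow_natCast, ← Real.rpow_mul (norm_nonneg _)]
    congr 2; push_cast; ring
  simp_rw [e1, e2]
  exact h

lemma lintegral_riesz_compl_ball_le {p : ℝ} (hp : 2 < p) (x : Plane) :
    ∫⁻ y in (Metric.ball x 1)ᶜ, riesz p x y ≤ ENNReal.ofReal (2 * Real.pi / (p - 2)) := by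
  set f : ℝ → ℝ≥0∞ := (Set.Ici 1).indicator fun ρ => ENNReal.ofReal (ρ ^ (-p)) with hf
  have hfm : Measurable f := Measurable.indicator (by fun_prop) measurableSet_Ici
  have e1 : ∫⁻ y in (Metric.ball x 1)ᶜ, riesz p x y = ∫⁻ y, f ‖x - y‖ := by
    rw [← lintegral_indicator measurableSet_ball.compl]
    refine lintegral_congr fun y => ?_
    by_cases hy : y ∈ (Metric.ball x 1)ᶜ
    · have h' : ‖x - y‖ ∈ Set.Ici (1 : ℝ) := by
        rw [norm_sub_rev]; simpa [dist_eq_norm] using hy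
      rw [Set.indicator_of_mem hy, hf, Set.indicator_of_mem h']; rfl
    · have h' : ‖x - y‖ ∉ Set.Ici (1 : ℝ) := by
        rw [norm_sub_rev]; simpa [dist_eq_norm] using hy
      rw [Set.indicator_of_notMem hy, hf, Set.indicator_of_notMem h']
  have hi : IntegrableOn (fun ρ : ℝ => 2 * Real.pi * ρ ^ (1 - p)) (Set.Ioi 1) :=
    (integrableOn_Ioi_rpow_of_lt (by linarith) one_pos).const_mul _
  have hval : ∫ ρ in Set.Ioi (1 : ℝ), 2 * Real.pi * ρ ^ (1 - p) = 2 * Real.pi / (p - 2) := by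
    rw [integral_const_mul, integral_Ioi_rpow_of_lt (by linarith) one_pos, Real.one_rpow,
      show (1 - p + 1) = -(p - 2) by ring]
    have : p - 2 ≠ 0 := by linarith
    field_simp
  rw [e1, lintegral_radial hfm, ← hval, ofReal_integral_eq_lintegral_ofReal hi
      ((ae_restrict_iff' measurableSet_Ioi).2 (ae_of_all _ fun ρ hρ => by
        have : (0 : ℝ) ≤ ρ := zero_le_one.trans (le_of_lt hρ)
        simp only [Pi.zero_apply]; positivity)),
    ← setLIntegral_congr (Ioi_ae_eq_Ici (a := (1 : ℝ))).symm,
    ← lintegral_indicator measurableSet_Ioi, ← lintegral_indicator measurableSet_Ici]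
  refine lintegral_mono fun ρ => ?_
  by_cases h0 : ρ ∈ Set.Ioi (0 : ℝ)
  · by_cases h1 : ρ ∈ Set.Ici (1 : ℝ)
    · have h0' : 0 < ρ := h0
      simp only [hf]
      rw [Set.indicator_of_mem h0, Set.indicator_of_mem h1, Set.indicator_of_mem h1,
        ← ENNReal.ofReal_mul (by positivity), Real.rpow_sub h0', Real.rpow_neg h0'.le,
        Real.rpow_one]
      apply le_of_eq; congr 1; ring
    · simp only [hf]
      rw [Set.indicator_of_mem h0, Set.indicator_of_notMem h1]; simp
  · rw [Set.indicator_of_notMem h0]; exact zero_le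

/-- Away from the singularity, the Coulomb potential is controlled by a weighted `L²` norm: the
function `|x - y|⁻¹ (1 + |y|)^{-δ}` is square integrable there, uniformly in `x`. -/
lemma exists_riesz_one_far_le {δ : ℝ} (hδ : 0 < δ) : ∃ C : ℝ≥0∞, C ≠ ⊤ ∧
    ∀ (x : Plane) (f : Plane → ℝ≥0∞), Measurable f →
    ∫⁻ y in (Metric.ball x 1)ᶜ, riesz 1 x y * f y ≤
      C * (∫⁻ y, (ENNReal.ofReal ((1 + ‖y‖) ^ δ) * f y) ^ 2) ^ (1 / 2 : ℝ) := by
  set p : ℝ := 2 + 2 * δ with hp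
  set K : ℝ≥0∞ := ENNReal.ofReal (2 * Real.pi / (p - 2)) +
    ∫⁻ y : Plane, ENNReal.ofReal ((1 + ‖y‖) ^ (-p)) with hK
  have hfin : ∫⁻ y : Plane, ENNReal.ofReal ((1 + ‖y‖) ^ (-p)) < ⊤ :=
    finite_integral_one_add_norm (by simp [hp, hδ])
  refine ⟨K ^ (1 / 2 : ℝ), ENNReal.rpow_ne_top_of_nonneg (by norm_num)
    (ENNReal.add_ne_top.2 ⟨ENNReal.ofReal_ne_top, hfin.ne⟩), fun x f hf => ?_⟩
  set a : Plane → ℝ≥0∞ := fun y => riesz 1 x y * ENNReal.ofReal ((1 + ‖y‖) ^ (-δ)) with ha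
  set b : Plane → ℝ≥0∞ := fun y => ENNReal.ofReal ((1 + ‖y‖) ^ δ) * f y with hb
  have ham : Measurable a := by
    have : Measurable fun y : Plane => ENNReal.ofReal ((1 + ‖y‖) ^ (-δ)) := by fun_prop
    exact (measurable_riesz_right 1 x).mul this
  have hbm : Measurable b := by
    have : Measurable fun y : Plane => ENNReal.ofReal ((1 + ‖y‖) ^ δ) := by fun_prop
    exact this.mul hf
  have hab : ∀ y, riesz 1 x y * f y = a y * b y := by
    intro y
    have hy : 0 < 1 + ‖y‖ := by positivity
    have : ENNReal.ofReal ((1 + ‖y‖) ^ (-δ)) * ENNReal.ofReal ((1 + ‖y‖) ^ δ) = 1 := by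
      rw [← ENNReal.ofReal_mul (by positivity), ← Real.rpow_add hy]; simp
    simp only [ha, hb]
    rw [mul_assoc, ← mul_assoc (ENNReal.ofReal _) (ENNReal.ofReal _), this, one_mul]
  have hsq : ∫⁻ y in (Metric.ball x 1)ᶜ, a y ^ 2 ≤ K := by
    calc ∫⁻ y in (Metric.ball x 1)ᶜ, a y ^ 2 ≤
          ∫⁻ y in (Metric.ball x 1)ᶜ, (riesz p x y + ENNReal.ofReal ((1 + ‖y‖) ^ (-p))) := by
          refine setLIntegral_mono' measurableSet_ball.compl fun y hy => ?_
          have h1 : 1 ≤ ‖x - y‖ := by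
            rw [norm_sub_rev]; simpa [dist_eq_norm] using hy
          have h2 : 1 ≤ 1 + ‖y‖ := by linarith [norm_nonneg y]
          simp only [ha, riesz]
          generalize ‖x - y‖ = u at *
          generalize 1 + ‖y‖ = v at *
          have hu : 0 < u := by linarith
          have hv : 0 < v := by linarith
          rw [← ENNReal.ofReal_mul (by positivity), ← ENNReal.ofReal_pow (by positivity),
            ← ENNReal.ofReal_add (by positivity) (by positivity)]
          apply ENNReal.ofReal_le_ofReal
          have e : (u ^ (-1 : ℝ) * v ^ (-δ)) ^ 2 = u ^ (-2 : ℝ) * v ^ (-(2 * δ)) := by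
            rw [mul_pow, ← Real.rpow_natCast, ← Real.rpow_natCast, ← Real.rpow_mul hu.le,
              ← Real.rpow_mul hv.le]
            congr 2 <;> push_cast <;> ring
          rw [e, hp]
          -- the larger of `u` and `v` may be replaced by the smaller one
          rcases le_total u v with h | h
          · have : v ^ (-(2 * δ)) ≤ u ^ (-(2 * δ)) :=
              Real.rpow_le_rpow_of_nonpos hu h (by linarith)
            calc u ^ (-2 : ℝ) * v ^ (-(2 * δ)) ≤ u ^ (-2 : ℝ) * u ^ (-(2 * δ)) := by gcongr
              _ = u ^ (-(2 + 2 * δ)) := by rw [← Real.rpow_add hu]; congr 1; ring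
              _ ≤ _ := le_add_of_nonneg_right (by positivity)
          · have : u ^ (-2 : ℝ) ≤ v ^ (-2 : ℝ) :=
              Real.rpow_le_rpow_of_nonpos hv h (by linarith)
            calc u ^ (-2 : ℝ) * v ^ (-(2 * δ)) ≤ v ^ (-2 : ℝ) * v ^ (-(2 * δ)) := by gcongr
              _ = v ^ (-(2 + 2 * δ)) := by rw [← Real.rpow_add hv]; congr 1; ring
              _ ≤ _ := le_add_of_nonneg_left (by positivity)
      _ = (∫⁻ y in (Metric.ball x 1)ᶜ, riesz p x y) +
          ∫⁻ y in (Metric.ball x 1)ᶜ, ENNReal.ofReal ((1 + ‖y‖) ^ (-p)) :=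
          lintegral_add_left (by fun_prop) _
      _ ≤ K := add_le_add (lintegral_riesz_compl_ball_le (by linarith) x)
          (setLIntegral_le_lintegral _ _)
  simp_rw [hab]
  refine (lintegral_mul_le_sqrt ham.aemeasurable hbm.aemeasurable).trans ?_
  gcongr
  exact Measure.restrict_le_self

end RieszPotential

/-! ### The Coulomb potential near its singularity, by splitting frequencies -/

section FourierInversion

lemma integral_fourierInv_smul_eq_flip {η : Plane → ℂ} {G : Plane → Spinor}
    (hη : Integrable η) (hG : Integrable G) :
    ∫ ξ, (𝓕⁻ η) ξ • G ξ = ∫ x, η x • (𝓕⁻ G) x := by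
  have hc : Continuous fun p : Plane × Plane => (-innerₗ Plane) p.1 p.2 := continuous_inner.neg
  have h := VectorFourier.integral_fourierIntegral_smul_eq_flip (L := -innerₗ Plane)
    (μ := volume) (ν := volume) Real.continuous_fourierChar hc hη hG
  have hflip : (-innerₗ Plane).flip = -innerₗ Plane := by
    ext x y
    simp [real_inner_comm]
  rw [hflip] at h
  exact h

lemma norm_fourierInv_le_integral (G : Plane → Spinor) (x : Plane) :
    ‖(𝓕⁻ G) x‖ ≤ ∫ ξ, ‖G ξ‖ :=
  VectorFourier.norm_fourierIntegral_le_integral_norm _ _ _ _ _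

/-- The Plancherel extension of the inverse Fourier transform agrees with the Fourier integral
on `L¹ ∩ L²`. -/
lemma ae_eq_fourierInv_of_integrable {G : Lp Spinor 2 (volume : Measure Plane)}
    (hG : Integrable G) :
    ((𝓕⁻ G : Lp Spinor 2 (volume : Measure Plane)) : Plane → Spinor) =ᵐ[volume]
      𝓕⁻ (G : Plane → Spinor) := by
  have hcont : Continuous (𝓕⁻ (G : Plane → Spinor)) := by
    have := VectorFourier.fourierIntegral_continuous (L := -innerₗ Plane) (μ := volume)
      Real.continuous_fourierChar (continuous_inner.neg :
        Continuous fun p : Plane × Plane => -inner ℝ p.1 p.2) hG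
    exact this
  refine ae_eq_of_integral_contDiff_smul_eq
    ((Lp.memLp _).locallyIntegrable (by norm_num)) hcont.locallyIntegrable fun g hgs hgc => ?_
  have hg₁ : HasCompactSupport (Complex.ofRealCLM ∘ g) := hgc.comp_left rfl
  have hg₂ : ContDiff ℝ ∞ (Complex.ofRealCLM ∘ g) := by fun_prop
  -- both sides are tested against a real bump function, regarded as a complex Schwartz function
  set η := hg₁.toSchwartzMap hg₂ with hη
  have key : ∫ x, η x • ((𝓕⁻ G : Lp Spinor 2 (volume : Measure Plane)) : Plane → Spinor) x =
      ∫ x, (𝓕⁻ η) x • G x := by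
    rw [← Lp.toTemperedDistribution_apply, ← Lp.toTemperedDistribution_apply,
      ← Lp.fourierInv_toTemperedDistribution_eq, TemperedDistribution.fourierInv_apply]
  rw [SchwartzMap.fourierInv_coe, integral_fourierInv_smul_eq_flip η.integrable hG] at key
  simpa [hη] using key

lemma norm_fourierInv_le {G : Lp Spinor 2 (volume : Measure Plane)} (hG : Integrable G) :
    ∀ᵐ x, ‖((𝓕⁻ G : Lp Spinor 2 (volume : Measure Plane)) : Plane → Spinor) x‖ₑ ≤
      ∫⁻ ξ, ‖G ξ‖ₑ := by
  filter_upwards [ae_eq_fourierInv_of_integrable hG] with x hx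
  rw [hx, ← ofReal_norm]
  refine (ENNReal.ofReal_le_ofReal (norm_fourierInv_le_integral _ x)).trans_eq ?_
  exact ofReal_integral_norm_eq_lintegral_enorm hG

end FourierInversion

section NearField

lemma sqrt_volume_ball_le (x : Plane) {r : ℝ} (hr : 0 ≤ r) :
    volume (Metric.ball x r) ^ (1 / 2 : ℝ) ≤ ENNReal.ofReal (2 * r) := by
  have h : volume (Metric.ball x r) ≤ ENNReal.ofReal (2 * r) ^ (2 : ℝ) := by
    rw [EuclideanSpace.volume_ball_fin_two, ENNReal.rpow_two,
      ← ENNReal.ofReal_pow hr, ← ENNReal.ofReal_pow (by positivity),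
      ← ENNReal.ofReal_mul (by positivity)]
    refine ENNReal.ofReal_le_ofReal ?_
    have := Real.pi_lt_four
    nlinarith [sq_nonneg r]
  calc _ ≤ (ENNReal.ofReal (2 * r) ^ (2 : ℝ)) ^ (1 / 2 : ℝ) := by gcongr
    _ = _ := by rw [← ENNReal.rpow_mul]; norm_num

lemma one_le_weight {s : ℝ} (hs : 0 < s) (ξ : Plane) :
    (1 : ℝ) ≤ (1 + (2 * Real.pi * ‖ξ‖) ^ 2) ^ (s / 2) :=
  Real.one_le_rpow (by nlinarith [sq_nonneg (2 * Real.pi * ‖ξ‖)]) (by positivity)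

lemma rpow_le_weight {s R : ℝ} (hs : 0 < s) (hR : 0 < R) {ξ : Plane} (hξ : R ≤ ‖ξ‖) :
    R ^ s ≤ (1 + (2 * Real.pi * ‖ξ‖) ^ 2) ^ (s / 2) := by
  have h : R ^ s = (R ^ 2) ^ (s / 2) := by
    rw [← Real.rpow_natCast, ← Real.rpow_mul hR.le]
    congr 1
    push_cast
    ring
  rw [h]
  refine Real.rpow_le_rpow (by positivity) ?_ (by positivity)
  have h1 : R ≤ 2 * Real.pi * ‖ξ‖ := by
    have := Real.pi_gt_three
    nlinarith [norm_nonneg ξ]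
  have := pow_le_pow_left₀ hR.le h1 2
  linarith

lemma eLpNorm_fourierInv (K : Lp Spinor 2 (volume : Measure Plane)) :
    eLpNorm ((𝓕⁻ K : Lp Spinor 2 (volume : Measure Plane)) : Plane → Spinor) 2 volume =
      eLpNorm (K : Plane → Spinor) 2 volume := by
  have h : ‖(𝓕⁻ K : Lp Spinor 2 (volume : Measure Plane))‖ = ‖K‖ := by
    rw [← Lp.norm_fourier_eq, FourierTransform.fourier_fourierInv_eq]
  rw [Lp.norm_def, Lp.norm_def] at h
  exact (ENNReal.toReal_eq_toReal_iff' (Lp.eLpNorm_ne_top _) (Lp.eLpNorm_ne_top _)).1 h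

lemma sobolevNorm_eq {s : ℝ} {f : Plane → Spinor} (hf : MemLp f 2 volume) :
    sobolevNorm s f = eLpNorm (fun ξ : Plane =>
      ((1 + (2 * Real.pi * ‖ξ‖) ^ 2) ^ (s / 2) : ℝ) •
        (𝓕 (hf.toLp f) : Lp Spinor 2 volume) ξ) 2 volume := by
  unfold sobolevNorm
  rw [dif_pos hf]

/-- Splitting `f ∈ H^s` at frequency `R`: a bounded low frequency part, and a high frequency part
of small `L²` norm. -/
lemma exists_low_add_high {s R : ℝ} (hs : 0 < s) (hR : 0 < R) {f : Plane → Spinor}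
    (hf : MemLp f 2 volume) :
    ∃ g h : Plane → Spinor, AEStronglyMeasurable g ∧ AEStronglyMeasurable h ∧
      f =ᵐ[volume] g + h ∧
      (∀ᵐ x, ‖g x‖ₑ ≤ ENNReal.ofReal (2 * R) * sobolevNorm s f) ∧
      eLpNorm h 2 volume ≤ ENNReal.ofReal (R ^ (-s)) * sobolevNorm s f := by
  rw [sobolevNorm_eq hf]
  set H : Lp Spinor 2 (volume : Measure Plane) := 𝓕 (hf.toLp f) with hH
  set W : Plane → Spinor := fun ξ => ((1 + (2 * Real.pi * ‖ξ‖) ^ 2) ^ (s / 2) : ℝ) • H ξ with hW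
  have hmem := (Lp.memLp H).indicator (measurableSet_ball (x := (0 : Plane)) (ε := R))
  set G : Lp Spinor 2 (volume : Measure Plane) := hmem.toLp _ with hG
  have hGae : G =ᵐ[volume] (Metric.ball (0 : Plane) R).indicator H := hmem.coeFn_toLp
  have hHW : eLpNorm (H : Plane → Spinor) 2 volume ≤ eLpNorm W 2 volume := by
    refine eLpNorm_mono fun ξ => ?_
    rw [hW, norm_smul, Real.norm_of_nonneg (by positivity)]
    exact le_mul_of_one_le_left (norm_nonneg _) (one_le_weight hs ξ)
  have hGint : ∫⁻ ξ, ‖G ξ‖ₑ ≤ ENNReal.ofReal (2 * R) * eLpNorm W 2 volume := by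
    have h1 : ∫⁻ ξ, ‖G ξ‖ₑ =
        ∫⁻ ξ, (Metric.ball (0 : Plane) R).indicator (fun _ => (1 : ℝ≥0∞)) ξ * ‖H ξ‖ₑ := by
      refine lintegral_congr_ae ?_
      filter_upwards [hGae] with ξ hξ
      rw [hξ]
      by_cases h : ξ ∈ Metric.ball (0 : Plane) R <;> simp [h]
    have hHm : AEMeasurable (fun ξ => ‖H ξ‖ₑ) := (Lp.aestronglyMeasurable H).enorm
    have h2 := ENNReal.lintegral_mul_le_Lp_mul_Lq (volume : Measure Plane)
      Real.HolderConjugate.two_two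
      (f := (Metric.ball (0 : Plane) R).indicator (fun _ => (1 : ℝ≥0∞)))
      (g := fun ξ => ‖H ξ‖ₑ) (by
        exact (measurable_const.indicator measurableSet_ball).aemeasurable) hHm
    rw [h1]
    refine h2.trans ?_
    rw [eLpNorm_eq_lintegral_rpow_enorm_toReal (by norm_num) (by norm_num)] at hHW
    refine mul_le_mul' ?_ (by simpa using hHW)
    have h3 : ∀ ξ : Plane, (Metric.ball (0 : Plane) R).indicator (fun _ => (1 : ℝ≥0∞)) ξ ^ (2 : ℝ) =
        (Metric.ball (0 : Plane) R).indicator (fun _ => (1 : ℝ≥0∞)) ξ := by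
      intro ξ
      by_cases h : ξ ∈ Metric.ball (0 : Plane) R <;> simp [h]
    simp only [h3]
    rw [lintegral_indicator measurableSet_ball, setLIntegral_const, one_mul]
    exact sqrt_volume_ball_le 0 hR.le
  have hGi : Integrable G := by
    refine ⟨Lp.aestronglyMeasurable G, ?_⟩
    have h1 : eLpNorm ((Metric.ball (0 : Plane) R).indicator H) 1 volume < ⊤ := by
      rw [eLpNorm_indicator_eq_eLpNorm_restrict measurableSet_ball]
      have : IsFiniteMeasure (volume.restrict (Metric.ball (0 : Plane) R)) :=
        ⟨by rw [Measure.restrict_apply_univ]; exact measure_ball_lt_top⟩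
      exact ((Lp.memLp H).restrict _ |>.mono_exponent (p := 1) (by norm_num)).2
    rw [eLpNorm_one_eq_lintegral_enorm] at h1
    refine lt_of_eq_of_lt (lintegral_congr_ae ?_) h1
    filter_upwards [hGae] with ξ hξ
    rw [hξ]
  refine ⟨(𝓕⁻ G : Lp Spinor 2 (volume : Measure Plane)),
    (𝓕⁻ (H - G) : Lp Spinor 2 (volume : Measure Plane)), Lp.aestronglyMeasurable _,
    Lp.aestronglyMeasurable _, ?_, ?_, ?_⟩
  · have h1 : hf.toLp f = (𝓕⁻ G : Lp Spinor 2 (volume : Measure Plane)) + 𝓕⁻ (H - G) := by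
      rw [← FourierTransform.fourierInv_add, add_sub_cancel, hH,
        FourierTransform.fourierInv_fourier_eq]
    refine hf.coeFn_toLp.symm.trans ?_
    rw [h1]
    exact Lp.coeFn_add _ _
  · filter_upwards [norm_fourierInv_le hGi] with x hx using hx.trans hGint
  · rw [eLpNorm_fourierInv]
    have h1 : ∀ᵐ ξ, ‖(H - G : Lp Spinor 2 (volume : Measure Plane)) ξ‖ ≤ R ^ (-s) * ‖W ξ‖ := by
      filter_upwards [hGae, Lp.coeFn_sub H G] with ξ h1 h2
      rw [h2, Pi.sub_apply, h1]
      by_cases h : ξ ∈ Metric.ball (0 : Plane) R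
      · simp only [h, Set.indicator_of_mem, sub_self, norm_zero]
        positivity
      · simp only [h, not_false_eq_true, Set.indicator_of_notMem, sub_zero]
        rw [hW, norm_smul, Real.norm_of_nonneg (by positivity), ← mul_assoc]
        refine le_mul_of_one_le_left (norm_nonneg _) ?_
        have h4 : R ≤ ‖ξ‖ := by simpa using h
        calc (1 : ℝ) = R ^ (-s) * R ^ s := by rw [← Real.rpow_add hR]; simp
          _ ≤ _ := by gcongr; exact rpow_le_weight hs hR h4
    exact eLpNorm_le_mul_eLpNorm_of_ae_le_mul h1 2

lemma lintegral_enorm_ball_le {s r R : ℝ} (hs : 0 < s) (hr : 0 ≤ r) (hR : 0 < R)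
    {f : Plane → Spinor} (hf : MemLp f 2 volume) (x : Plane) :
    ∫⁻ y in Metric.ball x r, ‖f y‖ₑ ≤
      ENNReal.ofReal (8 * r ^ 2 * R + 2 * r * R ^ (-s)) * sobolevNorm s f := by
  obtain ⟨g, h, hgm, hhm, hfgh, hg, hh⟩ := exists_low_add_high hs hR hf
  set X := sobolevNorm s f
  have hv := sqrt_volume_ball_le x hr
  have hv2 : volume (Metric.ball x r) ≤ ENNReal.ofReal (4 * r ^ 2) := by
    calc volume (Metric.ball x r) = (volume (Metric.ball x r) ^ (1 / 2 : ℝ)) ^ (2 : ℝ) := by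
          rw [← ENNReal.rpow_mul]; norm_num
      _ ≤ ENNReal.ofReal (2 * r) ^ (2 : ℝ) := by gcongr
      _ = _ := by
        rw [ENNReal.rpow_two, ← ENNReal.ofReal_pow (by positivity)]
        congr 1
        ring
  have h1 : ∫⁻ y in Metric.ball x r, ‖g y‖ₑ ≤ ENNReal.ofReal (8 * r ^ 2 * R) * X := by
    calc ∫⁻ y in Metric.ball x r, ‖g y‖ₑ
        ≤ ∫⁻ _ in Metric.ball x r, ENNReal.ofReal (2 * R) * X :=
          lintegral_mono_ae (ae_restrict_of_ae hg)
      _ = ENNReal.ofReal (2 * R) * X * volume (Metric.ball x r) := setLIntegral_const _ _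
      _ ≤ ENNReal.ofReal (2 * R) * X * ENNReal.ofReal (4 * r ^ 2) := by gcongr
      _ = ENNReal.ofReal (2 * R) * ENNReal.ofReal (4 * r ^ 2) * X := by ring
      _ = _ := by
        rw [← ENNReal.ofReal_mul (by positivity)]
        congr 2
        ring
  have h2 : ∫⁻ y in Metric.ball x r, ‖h y‖ₑ ≤ ENNReal.ofReal (2 * r * R ^ (-s)) * X := by
    have h3 := lintegral_mul_le_sqrt (μ := volume.restrict (Metric.ball x r))
      (f := fun _ => 1) (g := fun y => ‖h y‖ₑ) aemeasurable_const hhm.enorm.restrict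
    simp only [one_mul, one_pow, lintegral_const, Measure.restrict_apply_univ] at h3
    rw [eLpNorm_eq_lintegral_rpow_enorm_toReal (by norm_num) (by norm_num)] at hh
    calc ∫⁻ y in Metric.ball x r, ‖h y‖ₑ
        ≤ _ := h3
      _ ≤ ENNReal.ofReal (2 * r) * (∫⁻ y, ‖h y‖ₑ ^ 2) ^ (1 / 2 : ℝ) := by
          gcongr
          exact Measure.restrict_le_self
      _ ≤ ENNReal.ofReal (2 * r) * (ENNReal.ofReal (R ^ (-s)) * X) := by
          gcongr
          simpa using hh
      _ = _ := by rw [← mul_assoc, ← ENNReal.ofReal_mul (by positivity)]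
  calc ∫⁻ y in Metric.ball x r, ‖f y‖ₑ
      ≤ ∫⁻ y in Metric.ball x r, (‖g y‖ₑ + ‖h y‖ₑ) := by
        refine lintegral_mono_ae (ae_restrict_of_ae ?_)
        filter_upwards [hfgh] with y hy
        rw [hy]
        exact enorm_add_le _ _
    _ = (∫⁻ y in Metric.ball x r, ‖g y‖ₑ) + ∫⁻ y in Metric.ball x r, ‖h y‖ₑ :=
        lintegral_add_left' hgm.enorm.restrict _
    _ ≤ _ := by
        rw [ENNReal.ofReal_add (by positivity) (by positivity), add_mul]
        gcongr

/-- The near field of the Coulomb potential of `|f|` is bounded by the `H^s` norm, for every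
`s > 0`: at distance `r` the frequencies are split at `r^{-1/2}`, and the contributions of the
dyadic annuli form a geometric series. -/
lemma exists_riesz_one_near_le {s : ℝ} (hs : 0 < s) : ∃ C : ℝ≥0∞, C ≠ ⊤ ∧
    ∀ (x : Plane) (f : Plane → Spinor), MemLp f 2 volume →
    ∫⁻ y in Metric.ball x 1, riesz 1 x y * ‖f y‖ₑ ≤ C * sobolevNorm s f := by
  set q : ℝ := (1 / 2) ^ (1 / 2 : ℝ) with hq
  set q' : ℝ := (1 / 2) ^ (s / 2 : ℝ) with hq'
  have hq0 : 0 < q := by positivity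
  have hq'0 : 0 < q' := by positivity
  have hq1 : q < 1 := Real.rpow_lt_one (by norm_num) (by norm_num) (by norm_num)
  have hq'1 : q' < 1 := Real.rpow_lt_one (by norm_num) (by norm_num) (by positivity)
  have hsum : Summable fun k : ℕ => 64 * q ^ k + 8 * q' ^ k :=
    ((summable_geometric_of_lt_one hq0.le hq1).mul_left _).add
      ((summable_geometric_of_lt_one hq'0.le hq'1).mul_left _)
  refine ⟨∑' k : ℕ, ENNReal.ofReal (64 * q ^ k + 8 * q' ^ k), ?_, fun x f hf => ?_⟩
  · rw [← ENNReal.ofReal_tsum_of_nonneg (fun k => by positivity) hsum]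
    exact ENNReal.ofReal_ne_top
  set A : ℕ → Set Plane := fun k =>
    {y | (1 / 2 : ℝ) ^ (k + 1) < ‖x - y‖ ∧ ‖x - y‖ ≤ (1 / 2) ^ k} with hA
  have hsub : Metric.ball x 1 ⊆ {x} ∪ ⋃ k, A k := by
    intro y hy
    by_cases hxy : y = x
    · exact Or.inl hxy
    right
    have h0 : 0 < ‖x - y‖ := norm_pos_iff.2 (sub_ne_zero.2 (Ne.symm hxy))
    have h1 : ‖x - y‖ < 1 := by rwa [← dist_eq_norm, dist_comm]
    obtain ⟨k, hk1, hk2⟩ := exists_nat_pow_near_of_lt_one h0 h1.le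
      (by norm_num : (0 : ℝ) < 1 / 2) (by norm_num)
    exact Set.mem_iUnion.2 ⟨k, hk1, hk2⟩
  have hterm : ∀ k, ∫⁻ y in A k, riesz 1 x y * ‖f y‖ₑ ≤
      ENNReal.ofReal (64 * q ^ k + 8 * q' ^ k) * sobolevNorm s f := by
    intro k
    set r : ℝ := (1 / 2) ^ k with hr
    have hr0 : 0 < r := by positivity
    have hqk : q ^ k = r ^ (1 / 2 : ℝ) := by
      rw [hq, hr, ← Real.rpow_natCast, ← Real.rpow_mul (by norm_num), mul_comm,
        Real.rpow_mul (by norm_num), Real.rpow_natCast]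
    have hq'k : q' ^ k = r ^ (s / 2 : ℝ) := by
      rw [hq', hr, ← Real.rpow_natCast, ← Real.rpow_mul (by norm_num), mul_comm,
        Real.rpow_mul (by norm_num), Real.rpow_natCast]
    have hAball : A k ⊆ Metric.ball x (2 * r) := by
      intro y hy
      rw [Metric.mem_ball, dist_comm, dist_eq_norm]
      linarith [hy.2]
    have hAm : MeasurableSet (A k) := by
      have h : Measurable fun y => ‖x - y‖ := by fun_prop
      exact h measurableSet_Ioc
    calc ∫⁻ y in A k, riesz 1 x y * ‖f y‖ₑ
        ≤ ∫⁻ y in A k, ENNReal.ofReal (2 / r) * ‖f y‖ₑ := by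
          refine setLIntegral_mono_ae' hAm (ae_of_all _ fun y hy => ?_)
          gcongr
          refine ENNReal.ofReal_le_ofReal ?_
          rw [Real.rpow_neg_one, inv_le_comm₀ (lt_trans (by positivity) hy.1) (by positivity)]
          refine le_trans (le_of_eq ?_) hy.1.le
          rw [hr, pow_succ]
          field_simp
      _ ≤ ∫⁻ y in Metric.ball x (2 * r), ENNReal.ofReal (2 / r) * ‖f y‖ₑ := lintegral_mono_set hAball
      _ = ENNReal.ofReal (2 / r) * ∫⁻ y in Metric.ball x (2 * r), ‖f y‖ₑ :=
          lintegral_const_mul' _ _ ENNReal.ofReal_ne_top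
      _ ≤ ENNReal.ofReal (2 / r) * (ENNReal.ofReal (8 * (2 * r) ^ 2 * r ^ (-(1 / 2) : ℝ) +
            2 * (2 * r) * (r ^ (-(1 / 2) : ℝ)) ^ (-s)) * sobolevNorm s f) := by
          gcongr
          exact lintegral_enorm_ball_le hs (by positivity) (by positivity) hf x
      _ = _ := by
          rw [← mul_assoc, ← ENNReal.ofReal_mul (by positivity), hqk, hq'k,
            ← Real.rpow_mul hr0.le]
          have h1 : r * r ^ (-(1 / 2) : ℝ) = r ^ (1 / 2 : ℝ) := by
            rw [← Real.rpow_one_add' hr0.le (by norm_num)]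
            norm_num
          have h2 : -(1 / 2) * -s = s / 2 := by ring
          rw [h2, ← h1]
          congr 2
          field_simp
          ring
  calc ∫⁻ y in Metric.ball x 1, riesz 1 x y * ‖f y‖ₑ
      ≤ ∫⁻ y in {x} ∪ ⋃ k, A k, riesz 1 x y * ‖f y‖ₑ := lintegral_mono_set hsub
    _ ≤ (∫⁻ y in {x}, riesz 1 x y * ‖f y‖ₑ) + ∫⁻ y in ⋃ k, A k, riesz 1 x y * ‖f y‖ₑ :=
        lintegral_union_le _ _ _
    _ ≤ 0 + ∑' k, ∫⁻ y in A k, riesz 1 x y * ‖f y‖ₑ := by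
        gcongr
        · simp
        · exact lintegral_iUnion_le _ _
    _ ≤ ∑' k, ENNReal.ofReal (64 * q ^ k + 8 * q' ^ k) * sobolevNorm s f := by
        rw [zero_add]
        exact ENNReal.tsum_le_tsum hterm
    _ = _ := ENNReal.tsum_mul_right

lemma memLp_of_weightedSobolevNorm_ne_top {s δ : ℝ} {f : Plane → Spinor}
    (h : weightedSobolevNorm s δ f ≠ ⊤) : MemLp f 2 volume := by
  by_contra hf
  apply h
  unfold weightedSobolevNorm sobolevNorm
  rw [dif_neg hf, top_add]

lemma eLpNorm_le_weightedSobolevNorm (s : ℝ) {δ : ℝ} (hδ : 0 < δ) (f : Plane → Spinor) :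
    eLpNorm f 2 volume ≤ weightedSobolevNorm s δ f := by
  refine le_trans (eLpNorm_mono fun x => ?_) le_add_self
  rw [norm_smul, Real.norm_of_nonneg (by positivity)]
  exact le_mul_of_one_le_left (norm_nonneg _) (Real.one_le_rpow (by simp) hδ.le)

/-- The Coulomb potential of `|f|` is bounded, uniformly in space, by the `H^{s,δ}` norm. -/
lemma exists_riesz_one_le {s δ : ℝ} (hs : 0 < s) (hδ : 0 < δ) : ∃ C : ℝ≥0∞, C ≠ ⊤ ∧
    ∀ (x : Plane) (f : Plane → Spinor), Continuous f →
    ∫⁻ y, riesz 1 x y * ‖f y‖ₑ ≤ C * weightedSobolevNorm s δ f := by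
  obtain ⟨C₁, hC₁, h₁⟩ := exists_riesz_one_near_le hs
  obtain ⟨C₂, hC₂, h₂⟩ := exists_riesz_one_far_le hδ
  refine ⟨C₁ + C₂ + 1, by simp [hC₁, hC₂], fun x f hf => ?_⟩
  by_cases htop : weightedSobolevNorm s δ f = ⊤
  · rw [htop, ENNReal.mul_top (by simp)]
    exact le_top
  have hm := memLp_of_weightedSobolevNorm_ne_top htop
  have h2 := h₂ x (fun y => ‖f y‖ₑ) hf.enorm.measurable
  have h3 : (∫⁻ y, (ENNReal.ofReal ((1 + ‖y‖) ^ δ) * ‖f y‖ₑ) ^ 2) ^ (1 / 2 : ℝ) =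
      eLpNorm (fun x : Plane => ((1 + ‖x‖) ^ δ : ℝ) • f x) 2 volume := by
    rw [eLpNorm_eq_lintegral_rpow_enorm_toReal (by norm_num) (by norm_num)]
    simp only [enorm_smul, ENNReal.toReal_ofNat, ENNReal.rpow_two]
    congr 1
    refine lintegral_congr fun y => ?_
    rw [Real.enorm_of_nonneg (by positivity)]
  rw [h3] at h2
  rw [← lintegral_add_compl _ (measurableSet_ball (x := x) (ε := 1))]
  calc _ ≤ C₁ * weightedSobolevNorm s δ f + C₂ * weightedSobolevNorm s δ f := by
        gcongr
        · exact (h₁ x f hm).trans (by gcongr; exact le_self_add)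
        · exact h2.trans (by gcongr; exact le_add_self)
    _ ≤ _ := by
        rw [← add_mul]
        exact mul_le_mul_left le_self_add _

end NearField

/-! ### The overlap of the nonlinearity with a free field -/

section Potential

/-- The Riesz potential `|·|^{-γ} * f` of a nonnegative density. -/
def rieszPotential (γ : ℝ) (f : Plane → ℝ≥0∞) (x : Plane) : ℝ≥0∞ := ∫⁻ y, riesz γ x y * f y

lemma measurable_rieszPotential (γ : ℝ) {f : Plane → ℝ≥0∞} (hf : Measurable f) :
    Measurable (rieszPotential γ f) :=
  Measurable.lintegral_prod_right' (f := fun p : Plane × Plane => riesz γ p.1 p.2 * f p.2)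
    (by fun_prop)

lemma rieszPotential_add (γ : ℝ) {f g : Plane → ℝ≥0∞} (hf : Measurable f) (x : Plane) :
    rieszPotential γ (fun y => f y + g y) x = rieszPotential γ f x + rieszPotential γ g x := by
  unfold rieszPotential
  simp only [mul_add]
  exact lintegral_add_left (by fun_prop) _

lemma rieszPotential_mono (γ : ℝ) {f g : Plane → ℝ≥0∞} (h : ∀ y, f y ≤ g y) (x : Plane) :
    rieszPotential γ f x ≤ rieszPotential γ g x :=
  lintegral_mono fun y => mul_le_mul_right (h y) _

lemma lintegral_rieszPotential_mul_comm (γ : ℝ) {f g : Plane → ℝ≥0∞} (hf : Measurable f)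
    (hg : Measurable g) :
    ∫⁻ x, rieszPotential γ f x * g x = ∫⁻ x, rieszPotential γ g x * f x := by
  have h1 : ∀ {f g : Plane → ℝ≥0∞}, Measurable f → Measurable g →
      ∫⁻ x, rieszPotential γ f x * g x = ∫⁻ x, ∫⁻ y, riesz γ x y * f y * g x := fun hf hg =>
    lintegral_congr fun x => (lintegral_mul_const _ (by fun_prop)).symm
  rw [h1 hf hg, h1 hg hf, lintegral_lintegral_swap (by fun_prop)]
  refine lintegral_congr fun x => lintegral_congr fun y => ?_
  rw [riesz_comm]
  ring

lemma lintegral_rieszPotential_mul_le {γ : ℝ} {f g : Plane → ℝ≥0∞} {A : ℝ≥0∞}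
    (hg : Measurable g) (h : ∀ x, rieszPotential γ f x ≤ A) :
    ∫⁻ x, rieszPotential γ f x * g x ≤ A * ∫⁻ x, g x := by
  rw [← lintegral_const_mul _ hg]
  exact lintegral_mono fun x => mul_le_mul_left (h x) _

lemma conv_potential (c γ : ℝ) (f : Plane → ℂ) (x : Plane) :
    conv (potential c γ) f x = ∫ y, ((c * ‖x - y‖ ^ (-γ) : ℝ) : ℂ) * f y := by
  unfold conv
  rw [convolution_eq_swap]
  rfl

lemma enorm_kernel (c γ : ℝ) (x y : Plane) :
    ‖((c * ‖x - y‖ ^ (-γ) : ℝ) : ℂ)‖ₑ = ‖c‖ₑ * riesz γ x y := by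
  rw [← ofReal_norm, Complex.norm_real, norm_mul, ENNReal.ofReal_mul (norm_nonneg _), ofReal_norm,
    Real.norm_of_nonneg (by positivity), riesz]

lemma enorm_conv_le (c γ : ℝ) {f : Plane → ℂ} (hf : Measurable f) (x : Plane) :
    ‖conv (potential c γ) f x‖ₑ ≤ ‖c‖ₑ * rieszPotential γ (fun y => ‖f y‖ₑ) x := by
  rw [conv_potential, rieszPotential, ← lintegral_const_mul _ (by fun_prop)]
  refine (enorm_integral_le_lintegral_enorm _).trans_eq (lintegral_congr fun y => ?_)
  rw [enorm_mul, enorm_kernel, mul_assoc]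

lemma integrable_kernel_mul (c : ℝ) {γ : ℝ} {f : Plane → ℂ} (hf : Measurable f) {x : Plane}
    (h : rieszPotential γ (fun y => ‖f y‖ₑ) x ≠ ⊤) :
    Integrable fun y => ((c * ‖x - y‖ ^ (-γ) : ℝ) : ℂ) * f y := by
  refine ⟨by fun_prop, ?_⟩
  simp only [HasFiniteIntegral, enorm_mul, enorm_kernel, mul_assoc]
  rw [lintegral_const_mul _ (by fun_prop)]
  exact ENNReal.mul_lt_top (by simp) (lt_top_iff_ne_top.2 h)

lemma conv_sub (c : ℝ) {γ : ℝ} {f g : Plane → ℂ} (hf : Measurable f) (hg : Measurable g) {x : Plane}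
    (hf' : rieszPotential γ (fun y => ‖f y‖ₑ) x ≠ ⊤)
    (hg' : rieszPotential γ (fun y => ‖g y‖ₑ) x ≠ ⊤) :
    conv (potential c γ) f x - conv (potential c γ) g x =
      conv (potential c γ) (fun y => f y - g y) x := by
  simp only [conv_potential]
  rw [← integral_sub (integrable_kernel_mul c hf hf') (integrable_kernel_mul c hg hg')]
  simp only [mul_sub]

lemma conv_ofReal (c γ : ℝ) (r : Plane → ℝ) (x : Plane) :
    conv (potential c γ) (fun y => (r y : ℂ)) x =
      ((c * ∫ y, ‖x - y‖ ^ (-γ) * r y : ℝ) : ℂ) := by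
  rw [conv_potential, ← integral_const_mul, ← integral_complex_ofReal]
  push_cast
  simp only [mul_assoc]

/-- The potential of a continuous square integrable field is finite everywhere. -/
lemma rieszPotential_ne_top {γ : ℝ} (hγ0 : 0 ≤ γ) (hγ : γ < 2) {f : Plane → Spinor}
    (hf : Continuous f) (hm : MemLp f 2 volume) (x : Plane) :
    rieszPotential γ (fun y => ‖f y‖ₑ ^ 2) x ≠ ⊤ := by
  obtain ⟨B, hB⟩ := (isCompact_closedBall x (1 : ℝ)).exists_bound_of_continuousOn hf.continuousOn
  have h := riesz_potential_le (f := fun y => ‖f y‖ₑ ^ 2) (B := ENNReal.ofReal B ^ 2) hγ0 hγ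
    one_pos x fun y hy => by
      gcongr
      rw [← ofReal_norm]
      exact ENNReal.ofReal_le_ofReal (hB y (Metric.ball_subset_closedBall hy))
  have hfin : ∫⁻ y, ‖f y‖ₑ ^ 2 < ⊤ := by
    have := hm.2
    rw [eLpNorm_lt_top_iff_lintegral_rpow_enorm_lt_top (by norm_num) (by norm_num)] at this
    simpa using this
  refine ne_top_of_le_ne_top ?_ h
  exact ENNReal.add_ne_top.2 ⟨by finiteness, ENNReal.mul_ne_top (by simp) hfin.ne⟩

end Potential

section Density

/-- The scalar density `⟨u, βu⟩ = |u₁|² - |u₂|²`. -/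
def scalarDensity (u : Spinor) : ℝ := ‖u 0‖ ^ 2 - ‖u 1‖ ^ 2

lemma continuous_scalarDensity : Continuous scalarDensity := by
  unfold scalarDensity; fun_prop

lemma dot_act_beta_self (u : Spinor) : dot u (act beta u) = (scalarDensity u : ℂ) := by
  rw [dot_eq, (act_beta u).1, (act_beta u).2, scalarDensity]
  push_cast
  rw [← Complex.mul_conj', ← Complex.mul_conj', map_neg]
  ring

lemma dot_act_beta_comm (u v : Spinor) : dot (act beta u) v = dot u (act beta v) := by
  rw [dot_eq, dot_eq, (act_beta u).1, (act_beta u).2, (act_beta v).1, (act_beta v).2, map_neg]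
  ring

lemma dot_smul_left (z : ℂ) (u v : Spinor) : dot (z • u) v = z * dot u v := by
  simp [dot, mul_add, mul_assoc]

lemma dot_smul_right (z : ℂ) (u v : Spinor) :
    dot u (z • v) = (starRingEnd ℂ) z * dot u v := by
  simp [dot, mul_add]
  ring

lemma norm_scalarDensity_le (u : Spinor) : ‖(scalarDensity u : ℂ)‖ ≤ ‖u‖ ^ 2 := by
  rw [← dot_act_beta_self, sq]
  simpa [norm_act_beta] using norm_dot_le u (act beta u)

/-- The difference of the densities is linear in `u - v`, up to a quadratic remainder. -/
lemma norm_scalarDensity_sub_le (u v : Spinor) :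
    ‖(scalarDensity u : ℂ) - scalarDensity v‖ ≤ 2 * (‖u - v‖ * ‖v‖) + ‖u - v‖ ^ 2 := by
  have h : (scalarDensity u : ℂ) - scalarDensity v =
      dot (u - v) (act beta v) + dot v (act beta (u - v)) + dot (u - v) (act beta (u - v)) := by
    rw [← dot_act_beta_self, ← dot_act_beta_self]
    simp only [dot_eq, (act_beta _).1, (act_beta _).2, PiLp.sub_apply, map_neg, map_sub]
    ring
  rw [h]
  have h1 := norm_dot_le (u - v) (act beta v)
  have h2 := norm_dot_le v (act beta (u - v))
  have h3 := norm_dot_le (u - v) (act beta (u - v))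
  rw [norm_act_beta] at h1 h2 h3
  refine (norm_add₃_le).trans ?_
  nlinarith

lemma norm_dot_act_beta_sub_le (u v : Spinor) :
    ‖dot (act beta u) v - scalarDensity v‖ ≤ ‖u - v‖ * ‖v‖ := by
  have h : dot (act beta u) v - scalarDensity v = dot (act beta (u - v)) v := by
    rw [← dot_act_beta_self]
    simp only [dot_eq, (act_beta _).1, (act_beta _).2, PiLp.sub_apply, map_neg]
    ring
  rw [h]
  simpa [norm_act_beta] using norm_dot_le (act beta (u - v)) v

lemma hartree_eq (c γ : ℝ) (f : Plane → Spinor) (x : Plane) : hartree c γ f x =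
    conv (potential c γ) (fun y => (scalarDensity (f y) : ℂ)) x • act beta (f x) := by
  unfold hartree
  simp only [dot_act_beta_self]

/-- The Hartree potential is real, so that the nonlinearity conserves the mass. -/
lemma dot_hartree_comm (c γ : ℝ) (f : Plane → Spinor) (x : Plane) :
    dot (hartree c γ f x) (f x) = dot (f x) (hartree c γ f x) := by
  rw [hartree_eq, conv_ofReal, dot_smul_left, dot_smul_right, Complex.conj_ofReal,
    dot_act_beta_comm]

end Density

section Overlap

variable {γ : ℝ} {f g : Plane → Spinor}

/-- Replacing the solution by the linear solution in the overlap of the nonlinearity with the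
linear solution costs a quadratic expression in which one factor is the `L²` norm of their
difference. -/
lemma lintegral_overlap_sub_le (c : ℝ) (hγ0 : 0 ≤ γ) (hγ : γ < 2) (hf : Continuous f)
    (hg : Continuous g) (hfm : MemLp f 2 volume) (hgm : MemLp g 2 volume) {A : ℝ≥0∞}
    (hA : ∀ x, rieszPotential γ (fun y => ‖g y‖ₑ ^ 2) x ≤ A)
    (hB : ∀ x, rieszPotential γ (fun y => ‖f y - g y‖ₑ * ‖g y‖ₑ) x ≤ A) :
    ∫⁻ x, ‖dot (hartree c γ f x) (g x) -
        conv (potential c γ) (fun y => (scalarDensity (g y) : ℂ)) x * scalarDensity (g x)‖ₑ ≤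
      ‖c‖ₑ * A * (5 * (∫⁻ x, ‖f x - g x‖ₑ * ‖g x‖ₑ) + 2 * ∫⁻ x, ‖f x - g x‖ₑ ^ 2) := by
  set a : Plane → ℝ≥0∞ := fun y => ‖g y‖ₑ ^ 2 with ha
  set b : Plane → ℝ≥0∞ := fun y => ‖f y - g y‖ₑ * ‖g y‖ₑ with hb
  set d : Plane → ℝ≥0∞ := fun y => 2 * b y + ‖f y - g y‖ₑ ^ 2 with hd
  have ham : Measurable a := by fun_prop
  have hbm : Measurable b := by fun_prop
  have hdm : Measurable d := by fun_prop
  have hsf : Measurable fun y => (scalarDensity (f y) : ℂ) := by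
    have := continuous_scalarDensity
    fun_prop
  have hsg : Measurable fun y => (scalarDensity (g y) : ℂ) := by
    have := continuous_scalarDensity
    fun_prop
  have hle : ∀ u : Spinor, ‖(scalarDensity u : ℂ)‖ₑ ≤ ‖u‖ₑ ^ 2 := fun u => by
    rw [← ofReal_norm, ← ofReal_norm, ← ENNReal.ofReal_pow (norm_nonneg _)]
    exact ENNReal.ofReal_le_ofReal (norm_scalarDensity_le u)
  have hsub : ∀ y, ‖(scalarDensity (f y) : ℂ) - scalarDensity (g y)‖ₑ ≤ d y := fun y => by
    refine le_trans ?_ (le_of_eq (?_ : ENNReal.ofReal (2 * (‖f y - g y‖ * ‖g y‖) +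
      ‖f y - g y‖ ^ 2) = d y))
    · rw [← ofReal_norm]
      exact ENNReal.ofReal_le_ofReal (norm_scalarDensity_sub_le _ _)
    · rw [ENNReal.ofReal_add (by positivity) (by positivity), ENNReal.ofReal_mul (by norm_num),
        ENNReal.ofReal_mul (norm_nonneg _), ENNReal.ofReal_pow (norm_nonneg _)]
      simp [hd, hb]
  have hover : ∀ x, ‖dot (act beta (f x)) (g x) - scalarDensity (g x)‖ₑ ≤ b x := fun x => by
    simp only [hb]
    rw [← ofReal_norm, ← ofReal_norm, ← ofReal_norm, ← ENNReal.ofReal_mul (norm_nonneg _)]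
    exact ENNReal.ofReal_le_ofReal (norm_dot_act_beta_sub_le _ _)
  have hover' : ∀ x, ‖dot (act beta (f x)) (g x)‖ₑ ≤ a x + b x := fun x => by
    have h1 := enorm_add_le (scalarDensity (g x) : ℂ)
      (dot (act beta (f x)) (g x) - scalarDensity (g x))
    rw [add_sub_cancel] at h1
    exact h1.trans (add_le_add (hle _) (hover x))
  have hpt : ∀ x, ‖dot (hartree c γ f x) (g x) -
        conv (potential c γ) (fun y => (scalarDensity (g y) : ℂ)) x * scalarDensity (g x)‖ₑ ≤
      ‖c‖ₑ * (rieszPotential γ d x * (a x + b x) + rieszPotential γ a x * b x) := fun x => by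
    have h1 := conv_sub c (x := x) (γ := γ) hsf hsg
      (ne_top_of_le_ne_top (rieszPotential_ne_top hγ0 hγ hf hfm x)
        (rieszPotential_mono γ (fun y => hle (f y)) x))
      (ne_top_of_le_ne_top (rieszPotential_ne_top hγ0 hγ hg hgm x)
        (rieszPotential_mono γ (fun y => hle (g y)) x))
    have h2 : dot (hartree c γ f x) (g x) -
        conv (potential c γ) (fun y => (scalarDensity (g y) : ℂ)) x * scalarDensity (g x) =
        conv (potential c γ) (fun y => (scalarDensity (f y) : ℂ) - scalarDensity (g y)) x *
          dot (act beta (f x)) (g x) +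
        conv (potential c γ) (fun y => (scalarDensity (g y) : ℂ)) x *
          (dot (act beta (f x)) (g x) - scalarDensity (g x)) := by
      rw [← h1, hartree_eq, dot_smul_left]
      ring
    rw [h2]
    refine (enorm_add_le _ _).trans ?_
    rw [enorm_mul, enorm_mul, mul_add, ← mul_assoc, ← mul_assoc]
    have h3 := (enorm_conv_le c γ (hsf.sub hsg) x).trans
      (mul_le_mul_right (rieszPotential_mono γ hsub x) _)
    have h4 := (enorm_conv_le c γ hsg x).trans
      (mul_le_mul_right (rieszPotential_mono γ (fun y => hle (g y)) x) _)
    exact add_le_add (mul_le_mul' h3 (hover' x)) (mul_le_mul' h4 (hover x))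
  have hUm := fun {h : Plane → ℝ≥0∞} => measurable_rieszPotential γ (f := h)
  have hUd := hUm hdm
  have hUa := hUm ham
  refine (lintegral_mono hpt).trans ?_
  rw [lintegral_const_mul _ (by fun_prop), lintegral_add_left (by fun_prop), mul_assoc]
  refine mul_le_mul_right ?_ _
  have hab : ∀ x, rieszPotential γ (fun y => a y + b y) x ≤ A + A := fun x => by
    rw [rieszPotential_add γ ham]
    exact add_le_add (hA x) (hB x)
  have hdi : ∫⁻ x, d x = 2 * (∫⁻ x, b x) + ∫⁻ x, ‖f x - g x‖ₑ ^ 2 := by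
    rw [hd, lintegral_add_left (by fun_prop), lintegral_const_mul _ hbm]
  calc (∫⁻ x, rieszPotential γ d x * (a x + b x)) + ∫⁻ x, rieszPotential γ a x * b x
      ≤ (A + A) * (∫⁻ x, d x) + A * ∫⁻ x, b x := by
        refine add_le_add ?_ (lintegral_rieszPotential_mul_le hbm hA)
        rw [lintegral_rieszPotential_mul_comm γ hdm (by fun_prop)]
        exact lintegral_rieszPotential_mul_le hdm hab
    _ = _ := by rw [hdi]; ring

end Overlap

/-! ### Riesz energy and lower bounds for the overlap -/

section Energy

/-- The Riesz energy of a real density. -/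
def energy (γ : ℝ) (r : Plane → ℝ) : ℝ :=
  ∫ p : Plane × Plane, ‖p.1 - p.2‖ ^ (-γ) * (r p.1 * r p.2)

variable {γ : ℝ} {r : Plane → ℝ}

lemma enorm_energy_density (x y : Plane) :
    ‖‖x - y‖ ^ (-γ) * (r x * r y)‖ₑ = riesz γ x y * ‖r y‖ₑ * ‖r x‖ₑ := by
  rw [enorm_mul, enorm_mul, Real.enorm_of_nonneg (by positivity), riesz]
  ring

lemma lintegral_energy_density (hr : Measurable r) :
    ∫⁻ p : Plane × Plane, ‖‖p.1 - p.2‖ ^ (-γ) * (r p.1 * r p.2)‖ₑ =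
      ∫⁻ x, rieszPotential γ (fun y => ‖r y‖ₑ) x * ‖r x‖ₑ := by
  rw [Measure.volume_eq_prod, lintegral_prod _ (by fun_prop)]
  refine lintegral_congr fun x => ?_
  rw [rieszPotential, ← lintegral_mul_const _ (by fun_prop)]
  exact lintegral_congr fun y => enorm_energy_density x y

lemma integrable_energy (hr : Measurable r) {A : ℝ≥0∞} (hA : A ≠ ⊤)
    (h : ∀ x, rieszPotential γ (fun y => ‖r y‖ₑ) x ≤ A) (hi : ∫⁻ x, ‖r x‖ₑ ≠ ⊤) :
    Integrable (fun p : Plane × Plane => ‖p.1 - p.2‖ ^ (-γ) * (r p.1 * r p.2)) := by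
  refine ⟨by fun_prop, ?_⟩
  rw [HasFiniteIntegral, lintegral_energy_density hr]
  exact (lintegral_rieszPotential_mul_le hr.enorm h).trans_lt
    (ENNReal.mul_lt_top (lt_top_iff_ne_top.2 hA) (lt_top_iff_ne_top.2 hi))

lemma integral_conv_mul (c : ℝ)
    (hi : Integrable (fun p : Plane × Plane => ‖p.1 - p.2‖ ^ (-γ) * (r p.1 * r p.2))) :
    ∫ x, conv (potential c γ) (fun y => (r y : ℂ)) x * r x = ((c * energy γ r : ℝ) : ℂ) := by
  unfold energy
  rw [Measure.volume_eq_prod] at hi ⊢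
  rw [integral_prod _ hi, ← integral_const_mul, ← integral_complex_ofReal]
  refine integral_congr_ae (ae_of_all _ fun x => ?_)
  dsimp only
  rw [conv_ofReal, ← Complex.ofReal_mul, mul_assoc, ← integral_mul_const]
  congr 3
  funext y
  ring

/-- A density carrying mass `μ` in a ball of radius `ρ` has energy at least `(2ρ)^{-γ} μ²`. -/
lemma le_energy (hγ : 0 ≤ γ) (hr : Measurable r) (hr0 : ∀ x, 0 ≤ r x)
    (hi : Integrable (fun p : Plane × Plane => ‖p.1 - p.2‖ ^ (-γ) * (r p.1 * r p.2)))
    {ρ μ : ℝ} (hρ : 0 < ρ) (hμ : 0 ≤ μ)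
    (h : ENNReal.ofReal μ ≤ ∫⁻ x in Metric.ball 0 ρ, ‖r x‖ₑ) :
    (2 * ρ) ^ (-γ) * μ ^ 2 ≤ energy γ r := by
  have hnn : ∀ p : Plane × Plane, 0 ≤ ‖p.1 - p.2‖ ^ (-γ) * (r p.1 * r p.2) := fun p =>
    mul_nonneg (by positivity) (mul_nonneg (hr0 _) (hr0 _))
  have h1 : ENNReal.ofReal (energy γ r) =
      ∫⁻ x, rieszPotential γ (fun y => ‖r y‖ₑ) x * ‖r x‖ₑ := by
    rw [← lintegral_energy_density hr, energy,
      ofReal_integral_eq_lintegral_ofReal hi (ae_of_all _ hnn)]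
    exact lintegral_congr fun p => (Real.enorm_of_nonneg (hnn p)).symm
  have h2 : ∀ x ∈ Metric.ball (0 : Plane) ρ, ENNReal.ofReal ((2 * ρ) ^ (-γ) * μ) ≤
      rieszPotential γ (fun y => ‖r y‖ₑ) x := fun x hx => by
    rw [ENNReal.ofReal_mul (by positivity)]
    calc _ ≤ ENNReal.ofReal ((2 * ρ) ^ (-γ)) * ∫⁻ y in Metric.ball 0 ρ, ‖r y‖ₑ := by gcongr
      _ = ∫⁻ y in Metric.ball 0 ρ, ENNReal.ofReal ((2 * ρ) ^ (-γ)) * ‖r y‖ₑ :=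
          (lintegral_const_mul _ (by fun_prop)).symm
      _ ≤ ∫⁻ y in Metric.ball 0 ρ, riesz γ x y * ‖r y‖ₑ := by
          refine setLIntegral_mono_ae' measurableSet_ball ?_
          -- the diagonal, where the kernel has the junk value `0`, is a null set
          have hne : ∀ᵐ y : Plane, y ≠ x := by simp [ae_iff]
          filter_upwards [hne] with y hyx hy
          refine mul_le_mul_left (ENNReal.ofReal_le_ofReal ?_) _
          have h3 : ‖x - y‖ ≤ 2 * ρ := by
            have hx' : ‖x‖ < ρ := by simpa using hx
            have hy' : ‖y‖ < ρ := by simpa using hy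
            linarith [norm_sub_le x y]
          exact Real.rpow_le_rpow_of_nonpos (norm_pos_iff.2 (sub_ne_zero.2 hyx.symm)) h3
            (by linarith)
      _ ≤ _ := setLIntegral_le_lintegral _ _
  have h3 : ENNReal.ofReal ((2 * ρ) ^ (-γ) * μ ^ 2) ≤ ENNReal.ofReal (energy γ r) := by
    rw [h1]
    calc ENNReal.ofReal ((2 * ρ) ^ (-γ) * μ ^ 2)
        = ENNReal.ofReal ((2 * ρ) ^ (-γ) * μ) * ENNReal.ofReal μ := by
          rw [← ENNReal.ofReal_mul (by positivity)]
          congr 1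
          ring
      _ ≤ ENNReal.ofReal ((2 * ρ) ^ (-γ) * μ) * ∫⁻ x in Metric.ball 0 ρ, ‖r x‖ₑ := by gcongr
      _ = ∫⁻ x in Metric.ball 0 ρ, ENNReal.ofReal ((2 * ρ) ^ (-γ) * μ) * ‖r x‖ₑ :=
          (lintegral_const_mul _ (by fun_prop)).symm
      _ ≤ ∫⁻ x in Metric.ball 0 ρ, rieszPotential γ (fun y => ‖r y‖ₑ) x * ‖r x‖ₑ :=
          setLIntegral_mono' measurableSet_ball fun x hx => mul_le_mul_left (h2 x hx) _
      _ ≤ _ := setLIntegral_le_lintegral _ _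
  exact (ENNReal.ofReal_le_ofReal_iff (integral_nonneg hnn)).1 h3

end Energy

section OverlapBounds

variable {γ : ℝ} {f g : Plane → Spinor}

lemma lintegral_sq_ne_top (hg : MemLp g 2 volume) : ∫⁻ x, ‖g x‖ₑ ^ 2 ≠ ⊤ := by
  have := hg.2
  rw [eLpNorm_lt_top_iff_lintegral_rpow_enorm_lt_top (by norm_num) (by norm_num)] at this
  simpa using this.ne

lemma enorm_scalarDensity_le (u : Spinor) : ‖scalarDensity u‖ₑ ≤ ‖u‖ₑ ^ 2 := by
  rw [← ofReal_norm, ← ofReal_norm, ← ENNReal.ofReal_pow (norm_nonneg _)]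
  refine ENNReal.ofReal_le_ofReal ?_
  rw [← Complex.norm_real]
  exact norm_scalarDensity_le u

lemma enorm_ofReal_complex (a : ℝ) : ‖(a : ℂ)‖ₑ = ‖a‖ₑ := by
  rw [← ofReal_norm, Complex.norm_real, ofReal_norm]

lemma enorm_norm_sq (u : Spinor) : ‖‖u‖ ^ 2‖ₑ = ‖u‖ₑ ^ 2 := by
  rw [enorm_pow, enorm_norm]

lemma measurable_conv (c γ : ℝ) {h : Plane → ℂ} (hh : Measurable h) :
    Measurable (conv (potential c γ) h) := by
  have h1 : conv (potential c γ) h = fun x => ∫ y, ((c * ‖x - y‖ ^ (-γ) : ℝ) : ℂ) * h y :=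
    funext fun x => conv_potential c γ h x
  rw [h1]
  have h2 : Measurable fun p : Plane × Plane => ((c * ‖p.1 - p.2‖ ^ (-γ) : ℝ) : ℂ) * h p.2 := by
    fun_prop
  exact (h2.stronglyMeasurable.integral_prod_right' (ν := volume)).measurable

lemma measurable_scalarDensity_comp (hg : Continuous g) :
    Measurable fun y => (scalarDensity (g y) : ℂ) :=
  (Complex.continuous_ofReal.comp (continuous_scalarDensity.comp hg)).measurable

lemma continuous_dot_act_beta (hf : Continuous f) (hg : Continuous g) :
    Continuous fun x => dot (act beta (f x)) (g x) := by
  simp only [dot_eq, (act_beta _).1, (act_beta _).2]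
  fun_prop

lemma measurable_dot_hartree (c : ℝ) (hf : Continuous f) (hg : Continuous g) :
    Measurable fun x => dot (hartree c γ f x) (g x) := by
  simp only [hartree_eq, dot_smul_left]
  exact (measurable_conv c γ (measurable_scalarDensity_comp hf)).mul
    (continuous_dot_act_beta hf hg).measurable

/-- The overlap of the nonlinearity at `f` with the free field `g`, at a fixed time: it is
integrable, and it is bounded below if the interaction of `g` is. The bounds `p` and `q` measure the
difference of `f` and `g`, and `A` is the size of the potentials. -/
lemma overlap_bounds (c : ℝ) (hγ0 : 0 < γ) (hγ : γ < 2) (hf : Continuous f)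
    (hg : Continuous g) (hfm : MemLp f 2 volume) (hgm : MemLp g 2 volume) {A m p q : ℝ}
    (hA0 : 0 ≤ A) (hm0 : 0 ≤ m) (hp0 : 0 ≤ p) (hq0 : 0 ≤ q)
    (hA : ∀ x, rieszPotential γ (fun y => ‖g y‖ₑ ^ 2) x ≤ ENNReal.ofReal A)
    (hB : ∀ x, rieszPotential γ (fun y => ‖f y - g y‖ₑ * ‖g y‖ₑ) x ≤ ENNReal.ofReal A)
    (hm : ∫⁻ x, ‖g x‖ₑ ^ 2 ≤ ENNReal.ofReal m)
    (hp : ∫⁻ x, ‖f x - g x‖ₑ * ‖g x‖ₑ ≤ ENNReal.ofReal p)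
    (hq : ∫⁻ x, ‖f x - g x‖ₑ ^ 2 ≤ ENNReal.ofReal q) :
    ∫⁻ x, ‖dot (hartree c γ f x) (g x)‖ₑ ≤ ENNReal.ofReal (|c| * A * (m + 5 * p + 2 * q)) ∧
    ∀ θ ρ μ : ℝ, 0 ≤ θ → 0 < ρ → 0 ≤ μ →
      θ * (interaction γ g g).re ≤ ‖interaction γ g (fun x => act beta (g x))‖ →
      ENNReal.ofReal μ ≤ ∫⁻ x in Metric.ball 0 ρ, ‖g x‖ₑ ^ 2 →
      c ^ 2 * (θ * ((2 * ρ) ^ (-γ) * μ ^ 2) - A * (5 * p + 2 * q)) ≤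
        (c * ∫ x, dot (hartree c γ f x) (g x)).re := by
  set D : Plane → ℂ := fun x => dot (hartree c γ f x) (g x) with hD
  set P : Plane → ℂ := fun x =>
    conv (potential c γ) (fun y => (scalarDensity (g y) : ℂ)) x * scalarDensity (g x) with hP
  have hDm : Measurable D := measurable_dot_hartree c hf hg
  have hPm : Measurable P := (measurable_conv c γ (measurable_scalarDensity_comp hg)).mul
    (measurable_scalarDensity_comp hg)
  have herr : ∫⁻ x, ‖D x - P x‖ₑ ≤ ENNReal.ofReal (|c| * A * (5 * p + 2 * q)) := by
    refine (lintegral_overlap_sub_le c hγ0.le hγ hf hg hfm hgm hA hB).trans ?_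
    rw [ENNReal.ofReal_mul (by positivity), ENNReal.ofReal_mul (by positivity),
      ENNReal.ofReal_add (by positivity) (by positivity), ENNReal.ofReal_mul (by norm_num),
      ENNReal.ofReal_mul (by norm_num), ← Real.norm_eq_abs, ofReal_norm]
    simp only [ENNReal.ofReal_ofNat]
    gcongr
  have hPb : ∫⁻ x, ‖P x‖ₑ ≤ ENNReal.ofReal (|c| * A * m) := by
    calc ∫⁻ x, ‖P x‖ₑ
        ≤ ∫⁻ x, ‖c‖ₑ * ENNReal.ofReal A * ‖g x‖ₑ ^ 2 := lintegral_mono fun x => by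
          rw [hP, enorm_mul]
          refine mul_le_mul' ((enorm_conv_le c γ (measurable_scalarDensity_comp hg) x).trans
            (mul_le_mul_right ((rieszPotential_mono γ (fun y => ?_) x).trans (hA x)) _)) ?_
          · exact (enorm_ofReal_complex _).trans_le (enorm_scalarDensity_le _)
          · exact (enorm_ofReal_complex _).trans_le (enorm_scalarDensity_le _)
      _ = ‖c‖ₑ * ENNReal.ofReal A * ∫⁻ x, ‖g x‖ₑ ^ 2 := lintegral_const_mul _ (by fun_prop)
      _ ≤ ‖c‖ₑ * ENNReal.ofReal A * ENNReal.ofReal m := by gcongr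
      _ = _ := by
          rw [ENNReal.ofReal_mul (by positivity), ENNReal.ofReal_mul (by positivity),
            ← Real.norm_eq_abs, ofReal_norm]
  have hDb : ∫⁻ x, ‖D x‖ₑ ≤ ENNReal.ofReal (|c| * A * (m + 5 * p + 2 * q)) := by
    calc ∫⁻ x, ‖D x‖ₑ ≤ ∫⁻ x, (‖P x‖ₑ + ‖D x - P x‖ₑ) := lintegral_mono fun x => by
          simpa using enorm_add_le (P x) (D x - P x)
      _ = (∫⁻ x, ‖P x‖ₑ) + ∫⁻ x, ‖D x - P x‖ₑ := lintegral_add_left (by fun_prop) _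
      _ ≤ _ := add_le_add hPb herr
      _ = _ := by
          rw [← ENNReal.ofReal_add (by positivity) (by positivity)]
          congr 1
          ring
  refine ⟨hDb, fun θ ρ μ hθ hρ hμ hint hmass => ?_⟩
  have hPi : Integrable P := ⟨hPm.aestronglyMeasurable, hPb.trans_lt ENNReal.ofReal_lt_top⟩
  have hDi : Integrable D := ⟨hDm.aestronglyMeasurable, hDb.trans_lt ENNReal.ofReal_lt_top⟩
  have hsm : Measurable fun x => scalarDensity (g x) :=
    (continuous_scalarDensity.comp hg).measurable
  have hnm : Measurable fun x => ‖g x‖ ^ 2 := by fun_prop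
  have hmtop : ∫⁻ x, ‖g x‖ₑ ^ 2 ≠ ⊤ := ne_top_of_le_ne_top ENNReal.ofReal_ne_top hm
  have hE1 : Integrable (fun z : Plane × Plane => ‖z.1 - z.2‖ ^ (-γ) *
      (scalarDensity (g z.1) * scalarDensity (g z.2))) :=
    integrable_energy hsm ENNReal.ofReal_ne_top
      (fun x => (rieszPotential_mono γ (fun y => enorm_scalarDensity_le (g y)) x).trans (hA x))
      (ne_top_of_le_ne_top hmtop (lintegral_mono fun x => enorm_scalarDensity_le (g x)))
  have hE2 : Integrable (fun z : Plane × Plane => ‖z.1 - z.2‖ ^ (-γ) *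
      (‖g z.1‖ ^ 2 * ‖g z.2‖ ^ 2)) :=
    integrable_energy hnm ENNReal.ofReal_ne_top (by simpa only [enorm_norm_sq] using hA)
      (by simpa only [enorm_norm_sq] using hmtop)
  have hI1 : interaction γ g (fun x => act beta (g x)) =
      (energy γ (fun x => scalarDensity (g x)) : ℂ) := by
    have := integral_conv_mul (r := fun x => scalarDensity (g x)) 1 hE1
    rw [one_mul] at this
    rw [← this, interaction]
    simp only [dot_act_beta_self]
  have hI2 : interaction γ g g = (energy γ (fun x => ‖g x‖ ^ 2) : ℂ) := by
    have := integral_conv_mul (r := fun x => ‖g x‖ ^ 2) 1 hE2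
    rw [one_mul] at this
    rw [← this, interaction]
    simp only [dot_self]
  have hE0 : 0 ≤ energy γ (fun x => scalarDensity (g x)) := riesz_energy_nonneg hγ0 hsm hE1
  rw [hI1, hI2, Complex.ofReal_re, Complex.norm_real, Real.norm_of_nonneg hE0] at hint
  have hlow := le_energy hγ0.le hnm (fun x => by positivity) hE2 hρ hμ
    (by simpa only [enorm_norm_sq] using hmass)
  have hPint : ∫ x, P x = ((c * energy γ (fun x => scalarDensity (g x)) : ℝ) : ℂ) :=
    integral_conv_mul (r := fun x => scalarDensity (g x)) c hE1
  have hdiff : ‖(∫ x, D x) - ∫ x, P x‖ ≤ |c| * A * (5 * p + 2 * q) := by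
    rw [← integral_sub hDi hPi]
    refine (ENNReal.ofReal_le_ofReal_iff (by positivity)).1 ?_
    rw [ofReal_norm]
    exact (enorm_integral_le_lintegral_enorm _).trans herr
  have hre : (c * ∫ x, D x).re = c * (c * energy γ (fun x => scalarDensity (g x))) +
      (c * ((∫ x, D x) - ∫ x, P x)).re := by
    rw [hPint, mul_sub, Complex.sub_re, ← Complex.ofReal_mul, Complex.ofReal_re]
    ring
  have hre2 : -(c ^ 2 * (A * (5 * p + 2 * q))) ≤ (c * ((∫ x, D x) - ∫ x, P x)).re := by
    refine (abs_le.1 ((Complex.abs_re_le_norm _).trans ?_)).1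
    rw [norm_mul, Complex.norm_real, Real.norm_eq_abs, ← sq_abs c]
    calc _ ≤ |c| * (|c| * A * (5 * p + 2 * q)) := by gcongr
      _ = _ := by ring
  rw [hre]
  have hmain : θ * ((2 * ρ) ^ (-γ) * μ ^ 2) ≤ energy γ (fun x => scalarDensity (g x)) :=
    (mul_le_mul_of_nonneg_left hlow hθ).trans hint
  have := mul_le_mul_of_nonneg_left hmain (sq_nonneg c)
  linarith

end OverlapBounds

/-! ### The overlap integrated in time -/

section TimeIntegral

variable {ψ φ N : ℝ → Plane → Spinor}

lemma norm_cutoff_le_one (R σ ε : ℝ) (p : ℝ × Plane) : ‖(cutoff R σ ε p : ℂ)‖ ≤ 1 := by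
  rw [Complex.norm_real, Real.norm_of_nonneg (cutoff_nonneg p)]
  exact cutoff_le_one p

lemma norm_dirDeriv_space_cutoff_le {R σ ε C : ℝ} (hε : 0 ≤ ε) (hC0 : 0 ≤ C)
    (hC : ∀ x, deriv Real.smoothTransition x ≤ C) (j : Fin 2) (p : ℝ × Plane) :
    ‖dirDeriv (spaceVec j) (fun p => (cutoff R σ ε p : ℂ)) p‖ ≤ C * ε := by
  rw [dirDeriv_cutoff, Complex.norm_real, norm_mul,
    Real.norm_of_nonneg (deriv_smoothTransition_nonneg _)]
  refine mul_le_mul (hC _) ?_ (norm_nonneg _) hC0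
  have h1 : |p.2 j| ≤ bracket p.2 := by
    have := (PiLp.norm_apply_le p.2 j).trans (norm_le_bracket p.2)
    rwa [Real.norm_eq_abs] at this
  have h2 : -σ * (spaceVec j).1 - ε * (inner ℝ p.2 (spaceVec j).2 / bracket p.2) =
      -(ε * (p.2 j / bracket p.2)) := by
    rw [show (spaceVec j).2 = basisVec j from rfl, show (spaceVec j).1 = 0 from rfl, inner_basisVec]
    ring
  rw [h2, norm_neg, norm_mul, norm_div, Real.norm_of_nonneg hε, Real.norm_eq_abs,
    Real.norm_of_nonneg (bracket_pos p.2).le]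
  exact mul_le_of_le_one_right hε ((div_le_one (bracket_pos _)).2 h1)

lemma norm_integral_le_of_lintegral_le {h : Plane → ℂ} {K : ℝ} (hK : 0 ≤ K)
    (hh : ∫⁻ x, ‖h x‖ₑ ≤ ENNReal.ofReal K) : ‖∫ x, h x‖ ≤ K := by
  refine (ENNReal.ofReal_le_ofReal_iff hK).1 ?_
  rw [ofReal_norm]
  exact (enorm_integral_le_lintegral_enorm _).trans hh

lemma intervalIntegrable_of_norm_le {h : ℝ → ℂ} {a b K : ℝ} (hab : a ≤ b)
    (hm : StronglyMeasurable h) (hK : ∀ t ∈ Set.Icc a b, ‖h t‖ ≤ K) :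
    IntervalIntegrable h volume a b := by
  rw [intervalIntegrable_iff_integrableOn_Icc_of_le hab]
  exact Measure.integrableOn_of_bounded (M := K) (by simp) hm.aestronglyMeasurable
    ((ae_restrict_iff' measurableSet_Icc).2 (ae_of_all _ hK))

lemma stronglyMeasurable_integral_slice {h : ℝ × Plane → ℂ} (hc : Continuous h) :
    StronglyMeasurable fun t => ∫ x, h (t, x) :=
  hc.stronglyMeasurable.integral_prod_right'

lemma dot_zero_right (u : Spinor) : dot u 0 = 0 := by simp [dot]

lemma continuous_dot_source (hψ : JointlySmooth ψ) (hφ : JointlySmooth φ)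
    (hN : ∀ t x, diracEvol ψ t x = N t x) (h0 : ∀ t x, diracEvol φ t x = 0) :
    Continuous fun p : ℝ × Plane => dot (N p.1 p.2) (φ p.1 p.2) := by
  have h := fun p => dot_balance hψ hφ hN (M := fun _ _ => 0) h0 p
  have hS : (fun p : ℝ × Plane => dot (N p.1 p.2) (φ p.1 p.2)) = fun p : ℝ × Plane => -Complex.I *
      (dirDeriv timeVec (fun p => dot (ψ p.1 p.2) (φ p.1 p.2)) p + ∑ j, dirDeriv (spaceVec j)
        (fun p => dot (act (alpha j) (ψ p.1 p.2)) (φ p.1 p.2)) p) := by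
    funext p
    rw [h p, dot_zero_right, sub_zero, ← mul_assoc]
    simp
  rw [hS]
  refine continuous_const.mul (((contDiff_dirDeriv (contDiff_dot hψ hφ) _).continuous).add
    (continuous_finsetSum _ fun j _ =>
      (contDiff_dirDeriv (contDiff_dot (jointlySmooth_act (alpha j) hψ) hφ) _).continuous))

/-- The localized balance law for the overlap `∫ ⟨ψ, φ⟩` with a linear solution. -/
lemma norm_integral_cutoff_overlap_le (hψ : JointlySmooth ψ) (hφ : JointlySmooth φ)
    (hN : ∀ t x, diracEvol ψ t x = N t x) (h0 : ∀ t x, diracEvol φ t x = 0) {a b M B : ℝ}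
    (hab : a ≤ b) (hM0 : 0 ≤ M) (hM : ∀ t, ∫⁻ x, ‖ψ t x‖ₑ * ‖φ t x‖ₑ ≤ ENNReal.ofReal M)
    (hB0 : 0 ≤ B)
    (hB : ∀ t ∈ Set.Icc a b, ∫⁻ x, ‖dot (N t x) (φ t x)‖ₑ ≤ ENNReal.ofReal B)
    {C : ℝ} (hC0 : 0 ≤ C) (hC : ∀ x, deriv Real.smoothTransition x ≤ C) {ε : ℝ} (hε : 0 < ε) :
    ‖∫ t in a..b, ∫ x, (cutoff 2 0 ε (t, x) : ℂ) * dot (N t x) (φ t x)‖ ≤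
      2 * M + 2 * (C * ε) * M * (b - a) := by
  set S : ℝ × Plane → ℂ := fun p => dot (N p.1 p.2) (φ p.1 p.2) with hSdef
  set m : ℝ × Plane → ℂ := fun p => dot (ψ p.1 p.2) (φ p.1 p.2) with hmdef
  set f : Fin 2 → ℝ × Plane → ℂ :=
    fun j p => dot (act (alpha j) (ψ p.1 p.2)) (φ p.1 p.2) with hfdef
  have hSc : Continuous S := continuous_dot_source hψ hφ hN h0
  have hms : ContDiff ℝ ∞ m := contDiff_dot hψ hφ
  have hfs : ∀ j, ContDiff ℝ ∞ (f j) := fun j => contDiff_dot (jointlySmooth_act (alpha j) hψ) hφ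
  have hbal : ∀ p, dirDeriv timeVec m p + ∑ j, dirDeriv (spaceVec j) (f j) p =
      Complex.I * S p := fun p => by
    have := dot_balance hψ hφ hN (M := fun _ _ => 0) h0 p
    rwa [dot_zero_right, sub_zero] at this
  set η : ℝ × Plane → ℂ := fun p => (cutoff 2 0 ε p : ℂ) with hη
  have hηs : ContDiff ℝ ∞ η := contDiff_ofReal_cutoff
  have hηb : HasBoundedSlices η := hasBoundedSlices_cutoff hε
  have hη1 : ∀ p, ‖η p‖ ≤ 1 := norm_cutoff_le_one 2 0 ε
  have htime : ∀ p, dirDeriv timeVec η p = 0 := fun p => by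
    rw [hη, dirDeriv_cutoff]
    simp
  have hspace : ∀ j p, ‖dirDeriv (spaceVec j) η p‖ ≤ C * ε := fun j p =>
    norm_dirDeriv_space_cutoff_le hε.le hC0 hC j p
  set F : ℝ × Plane → ℂ := fun p => ∑ j, dirDeriv (spaceVec j) η p * f j p with hF
  have hFc : Continuous F := continuous_finsetSum _ fun j _ =>
    (contDiff_dirDeriv hηs _).continuous.mul (hfs j).continuous
  have hFb : ∀ t, ∫⁻ x, ‖F (t, x)‖ₑ ≤ ENNReal.ofReal (2 * (C * ε) * M) := fun t => by
    have hpt : ∀ x, ‖F (t, x)‖ₑ ≤ ENNReal.ofReal (2 * (C * ε)) * (‖ψ t x‖ₑ * ‖φ t x‖ₑ) :=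
      fun x => by
      rw [← ofReal_norm, ← ofReal_norm, ← ofReal_norm, ← ENNReal.ofReal_mul (norm_nonneg _),
        ← ENNReal.ofReal_mul (by positivity)]
      refine ENNReal.ofReal_le_ofReal ((norm_sum_le _ _).trans ?_)
      rw [Fin.sum_univ_two, norm_mul, norm_mul]
      have h1 : ∀ j, ‖f j (t, x)‖ ≤ ‖ψ t x‖ * ‖φ t x‖ := fun j => by
        simpa [norm_act_alpha, hfdef] using norm_dot_le (act (alpha j) (ψ t x)) (φ t x)
      have h2 := fun j => mul_le_mul (hspace j (t, x)) (h1 j) (norm_nonneg _) (by positivity)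
      linarith [h2 0, h2 1]
    have hmeas : Measurable fun x => ‖ψ t x‖ₑ * ‖φ t x‖ₑ :=
      (continuous_slice hψ t).enorm.measurable.mul (continuous_slice hφ t).enorm.measurable
    refine (lintegral_mono hpt).trans ?_
    rw [lintegral_const_mul _ hmeas, ENNReal.ofReal_mul (q := M) (by positivity)]
    exact mul_le_mul_right (hM t) _
  have hFi : ∀ t, Integrable fun x => F (t, x) := fun t =>
    ⟨(hFc.comp (by fun_prop)).aestronglyMeasurable, (hFb t).trans_lt ENNReal.ofReal_lt_top⟩
  have hηSi : ∀ t, Integrable fun x => η (t, x) * S (t, x) := fun t => by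
    have h1 : Continuous fun x => η (t, x) * S (t, x) :=
      (hηs.continuous.comp (by fun_prop)).mul (hSc.comp (by fun_prop))
    exact h1.integrable_of_hasCompactSupport ((hηb.hasCompactSupport t).mul_right)
  have hderiv : ∀ t, HasDerivAt (fun t => ∫ x, η (t, x) * m (t, x))
      ((∫ x, F (t, x)) + Complex.I * ∫ x, η (t, x) * S (t, x)) t := fun t => by
    have h1 := hasDerivAt_integral_balance hηs hηb hms hfs hbal t
    convert h1 using 1
    rw [← integral_const_mul, ← integral_add (hFi t) ((hηSi t).const_mul _)]
    refine integral_congr_ae (ae_of_all _ fun x => ?_)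
    simp only [htime, hF]
    ring
  have hGb : ∀ t, ‖∫ x, η (t, x) * m (t, x)‖ ≤ M := fun t => by
    refine norm_integral_le_of_lintegral_le hM0 (le_trans (lintegral_mono fun x => ?_) (hM t))
    rw [← ofReal_norm, ← ofReal_norm, ← ofReal_norm, ← ENNReal.ofReal_mul (norm_nonneg _)]
    refine ENNReal.ofReal_le_ofReal ?_
    rw [norm_mul]
    calc _ ≤ 1 * ‖m (t, x)‖ := by gcongr; exact hη1 _
      _ ≤ _ := by rw [one_mul]; exact norm_dot_le _ _
  have hhI : IntervalIntegrable (fun t => ∫ x, η (t, x) * S (t, x)) volume a b := by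
    refine intervalIntegrable_of_norm_le (K := B) hab (stronglyMeasurable_integral_slice (hηs.continuous.mul hSc)) fun t ht => norm_integral_le_of_lintegral_le hB0 ?_
    refine le_trans (lintegral_mono fun x => ?_) (hB t ht)
    rw [enorm_mul]
    refine mul_le_of_le_one_left' ?_
    rw [← ofReal_norm]
    exact (ENNReal.ofReal_le_ofReal (hη1 (t, x))).trans_eq ENNReal.ofReal_one
  have hFI : IntervalIntegrable (fun t => ∫ x, F (t, x)) volume a b :=
    intervalIntegrable_of_norm_le hab (stronglyMeasurable_integral_slice hFc) fun t _ => norm_integral_le_of_lintegral_le (by positivity) (hFb t)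
  have hftc := intervalIntegral.integral_eq_sub_of_hasDerivAt (fun t _ => hderiv t)
    (hFI.add (hhI.const_mul Complex.I))
  rw [intervalIntegral.integral_add hFI (hhI.const_mul _),
    intervalIntegral.integral_const_mul] at hftc
  have hFn : ‖∫ t in a..b, ∫ x, F (t, x)‖ ≤ 2 * (C * ε) * M * (b - a) := by
    have := intervalIntegral.norm_integral_le_of_norm_le_const (a := a) (b := b)
      (f := fun t => ∫ x, F (t, x)) (fun t _ => norm_integral_le_of_lintegral_le (by positivity) (hFb t))
    rwa [abs_of_nonneg (sub_nonneg.2 hab)] at this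
  calc ‖∫ t in a..b, ∫ x, η (t, x) * S (t, x)‖
      = ‖Complex.I * ∫ t in a..b, ∫ x, η (t, x) * S (t, x)‖ := by simp
    _ = ‖(∫ x, η (b, x) * m (b, x)) - (∫ x, η (a, x) * m (a, x)) -
          ∫ t in a..b, ∫ x, F (t, x)‖ := by
        rw [← hftc, add_sub_cancel_left]
    _ ≤ M + M + 2 * (C * ε) * M * (b - a) :=
        (norm_sub_le _ _).trans (add_le_add ((norm_sub_le _ _).trans
          (add_le_add (hGb b) (hGb a))) hFn)
    _ = _ := by ring

/-- The balance law for the overlap `∫ ⟨ψ, φ⟩` with a linear solution: over any time interval the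
source contributes at most the total variation of the overlap. The balance law is localized by
cutoffs that exhaust the plane, and the flux through their boundary layers tends to zero. -/
theorem norm_integral_overlap_le (hψ : JointlySmooth ψ) (hφ : JointlySmooth φ)
    (hN : ∀ t x, diracEvol ψ t x = N t x) (h0 : ∀ t x, diracEvol φ t x = 0) {a b M B : ℝ}
    (hab : a ≤ b) (hM0 : 0 ≤ M) (hM : ∀ t, ∫⁻ x, ‖ψ t x‖ₑ * ‖φ t x‖ₑ ≤ ENNReal.ofReal M)
    (hB0 : 0 ≤ B)
    (hB : ∀ t ∈ Set.Icc a b, ∫⁻ x, ‖dot (N t x) (φ t x)‖ₑ ≤ ENNReal.ofReal B) :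
    IntervalIntegrable (fun t => ∫ x, dot (N t x) (φ t x)) volume a b ∧
      ‖∫ t in a..b, ∫ x, dot (N t x) (φ t x)‖ ≤ 2 * M := by
  set S : ℝ × Plane → ℂ := fun p => dot (N p.1 p.2) (φ p.1 p.2) with hSdef
  have hSc : Continuous S := continuous_dot_source hψ hφ hN h0
  have hSi : ∀ t ∈ Set.Icc a b, Integrable fun x => S (t, x) := fun t ht =>
    ⟨(hSc.comp (by fun_prop)).aestronglyMeasurable, (hB t ht).trans_lt ENNReal.ofReal_lt_top⟩
  refine ⟨intervalIntegrable_of_norm_le hab (stronglyMeasurable_integral_slice hSc) fun t ht => norm_integral_le_of_lintegral_le hB0 (hB t ht), ?_⟩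
  obtain ⟨C, hC0, hC⟩ := exists_deriv_smoothTransition_le
  -- exhaust the plane by cutoffs
  have hε : Tendsto (fun n : ℕ => 1 / ((n : ℝ) + 1)) atTop (𝓝 0) :=
    tendsto_one_div_add_atTop_nhds_zero_nat
  have hcut : ∀ p : ℝ × Plane,
      Tendsto (fun n : ℕ => (cutoff 2 0 (1 / ((n : ℝ) + 1)) p : ℂ)) atTop (𝓝 1) := fun p => by
    have h1 : Tendsto (fun n : ℕ => cutoffPhase 2 0 (1 / ((n : ℝ) + 1)) p) atTop (𝓝 2) := by
      have := (hε.mul_const (bracket p.2)).const_sub (2 - 0 * p.1)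
      simpa [cutoffPhase] using this
    have h2 := (Real.smoothTransition.continuous.tendsto 2).comp h1
    rw [Real.smoothTransition.one_of_one_le (by norm_num)] at h2
    have h3 := (Complex.continuous_ofReal.tendsto 1).comp h2
    rw [Complex.ofReal_one] at h3
    exact h3
  have hle : ∀ ε p, ‖(cutoff 2 0 ε p : ℂ) * S p‖ ≤ ‖S p‖ := fun ε p => by
    rw [norm_mul]
    exact mul_le_of_le_one_left (norm_nonneg _) (norm_cutoff_le_one 2 0 ε p)
  have hcc : ∀ ε, Continuous fun p => (cutoff 2 0 ε p : ℂ) * S p := fun ε =>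
    contDiff_ofReal_cutoff.continuous.mul hSc
  have hinner : ∀ t ∈ Set.Icc a b, Tendsto
      (fun n : ℕ => ∫ x, (cutoff 2 0 (1 / ((n : ℝ) + 1)) (t, x) : ℂ) * S (t, x)) atTop
      (𝓝 (∫ x, S (t, x))) := fun t ht => by
    refine tendsto_integral_of_dominated_convergence (fun x => ‖S (t, x)‖)
      (fun n => ((hcc _).comp (by fun_prop)).aestronglyMeasurable) (hSi t ht).norm
      (fun n => ae_of_all _ fun x => hle _ _) (ae_of_all _ fun x => ?_)
    simpa using (hcut (t, x)).mul_const (S (t, x))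
  have houter : Tendsto (fun n : ℕ => ∫ t in a..b, ∫ x,
      (cutoff 2 0 (1 / ((n : ℝ) + 1)) (t, x) : ℂ) * S (t, x)) atTop
      (𝓝 (∫ t in a..b, ∫ x, S (t, x))) := by
    have hmem : ∀ t ∈ Set.uIoc a b, t ∈ Set.Icc a b := fun t ht => by
      rw [Set.uIoc_of_le hab] at ht
      exact Set.Ioc_subset_Icc_self ht
    refine intervalIntegral.tendsto_integral_filter_of_dominated_convergence (fun _ => B)
      (Eventually.of_forall fun n => (stronglyMeasurable_integral_slice (hcc _)).aestronglyMeasurable)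
      (Eventually.of_forall fun n => ae_of_all _ fun t ht => norm_integral_le_of_lintegral_le hB0 ?_)
      intervalIntegrable_const (ae_of_all _ fun t ht => hinner t (hmem t ht))
    refine le_trans (lintegral_mono fun x => ?_) (hB t (hmem t ht))
    rw [← ofReal_norm, ← ofReal_norm]
    exact ENNReal.ofReal_le_ofReal (hle _ (t, x))
  have hlim : Tendsto (fun n : ℕ => 2 * M + 2 * (C * (1 / ((n : ℝ) + 1))) * M * (b - a)) atTop
      (𝓝 (2 * M)) := by
    have := ((((hε.const_mul C).const_mul 2).mul_const M).mul_const (b - a)).const_add (2 * M)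
    simpa using this
  exact le_of_tendsto_of_tendsto' houter.norm hlim fun n =>
    norm_integral_cutoff_overlap_le hψ hφ hN h0 hab hM0 hM hB0 hB hC0 hC (by positivity)

end TimeIntegral

/-! ### Nonexistence of scattering -/

section Bounds

variable {ψ φ : ℝ → Plane → Spinor}

lemma eLpNorm_two_eq (f : Plane → Spinor) :
    eLpNorm f 2 volume = (∫⁻ x, ‖f x‖ₑ ^ 2) ^ (1 / 2 : ℝ) := by
  rw [eLpNorm_eq_lintegral_rpow_enorm_toReal (by norm_num) (by norm_num)]
  simp

lemma lintegral_sq_eq (f : Plane → Spinor) : ∫⁻ x, ‖f x‖ₑ ^ 2 = eLpNorm f 2 volume ^ 2 := by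
  rw [eLpNorm_two_eq, ← ENNReal.rpow_two, ← ENNReal.rpow_mul]
  norm_num

lemma mass_eq_zero_iff (hψ : JointlySmooth ψ) (t : ℝ) : mass ψ t = 0 ↔ ∀ x, ψ t x = 0 := by
  have hc := continuous_slice hψ t
  refine ⟨fun h => ?_, fun h => by simp [mass, h]⟩
  rw [mass, lintegral_eq_zero_iff (by fun_prop)] at h
  have h1 : ψ t =ᵐ[volume] fun _ => 0 := by
    filter_upwards [h] with x hx
    simpa using hx
  exact congrFun ((hc.ae_eq_iff_eq volume continuous_const).1 h1)

lemma IsSmoothLinearSolution.mass_eq (hφ : IsSmoothLinearSolution φ) (s t : ℝ) :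
    mass φ s = mass φ t :=
  HartreeDirac.mass_eq (N := fun _ _ => 0) hφ.smooth hφ.equation (fun t x => by simp [dot]) s t

lemma IsSmoothGlobalSolution.mass_eq {c γ : ℝ} (hψ : IsSmoothGlobalSolution c γ ψ) (s t : ℝ) :
    mass ψ s = mass ψ t :=
  HartreeDirac.mass_eq hψ.smooth hψ.equation (fun t x => dot_hartree_comm c γ (ψ t) x) s t

/-- The scattering state has finite mass. -/
lemma ScattersL2.memLp {c γ : ℝ} (h : ScattersL2 ψ φ) (hψ : IsSmoothGlobalSolution c γ ψ)
    (hφ : IsSmoothLinearSolution φ) (t : ℝ) : MemLp (φ t) 2 volume := by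
  obtain ⟨s, hs⟩ := (h.eventually (gt_mem_nhds ENNReal.zero_lt_top)).exists
  have hφs := fun t => continuous_slice hφ.smooth t
  have h1 : MemLp (fun x => ψ s x - φ s x) 2 volume :=
    ⟨((hψ.memL2 s).1.sub (hφs s).aestronglyMeasurable), hs⟩
  have h2 : MemLp (φ s) 2 volume := by
    have := (hψ.memL2 s).sub h1
    rwa [show (ψ s - fun x => ψ s x - φ s x) = φ s from funext fun x => by simp] at this
  refine ⟨(hφs t).aestronglyMeasurable, ?_⟩
  have h3 := hφ.mass_eq t s
  unfold mass at h3
  rw [eLpNorm_two_eq, h3, ← eLpNorm_two_eq]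
  exact h2.2

/-- Dispersion: the Riesz potential of the density of a free solution decays like `t^{-γ}`. -/
lemma IsSmoothLinearSolution.exists_rieszPotential_le (hφ : IsSmoothLinearSolution φ)
    (hm : MemLp (φ 0) 2 volume) {γ : ℝ} (hγ0 : 0 ≤ γ) (hγ : γ < 2) :
    ∃ K : ℝ, 0 < K ∧ ∀ t, 1 ≤ t → ∀ x,
      rieszPotential γ (fun y => ‖φ t y‖ₑ ^ 2) x ≤ ENNReal.ofReal (K * t ^ (-γ)) := by
  obtain ⟨C, hC0, hC⟩ := hφ.exists_decay
  have hγ' : 0 < 2 - γ := by linarith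
  set M : ℝ := (mass φ 0).toReal with hM
  have hMt : ∀ t, mass φ t = ENNReal.ofReal M := fun t => by
    rw [hφ.mass_eq t 0, hM, ENNReal.ofReal_toReal (show mass φ 0 ≠ ⊤ from lintegral_sq_ne_top hm)]
  have hM0 : 0 ≤ M := ENNReal.toReal_nonneg
  refine ⟨2 * Real.pi / (2 - γ) * C ^ 2 + M, by positivity, fun t ht x => ?_⟩
  have ht0 : 0 < t := by linarith
  have h := riesz_potential_le (f := fun y => ‖φ t y‖ₑ ^ 2) (B := ENNReal.ofReal ((C / t) ^ 2))
    hγ0 hγ ht0 x fun y _ => by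
      rw [← ofReal_norm, ← ENNReal.ofReal_pow (norm_nonneg _)]
      exact ENNReal.ofReal_le_ofReal (pow_le_pow_left₀ (norm_nonneg _) (hC t ht y) 2)
  refine h.trans_eq ?_
  have h1 := hMt t
  unfold mass at h1
  rw [h1, ← ENNReal.ofReal_mul (by positivity), ← ENNReal.ofReal_mul (by positivity),
    ← ENNReal.ofReal_add (by positivity) (by positivity)]
  congr 1
  have h2 : t ^ (2 - γ) = t ^ 2 * t ^ (-γ) := by
    rw [sub_eq_add_neg, Real.rpow_add ht0, Real.rpow_two]
  rw [h2]
  field_simp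

/-- For `γ < 1` the mixed potential is controlled by the `L²` norm of the difference and the
potential of the free density with the exponent `2γ < 2`. -/
lemma exists_mixed_potential_le_of_lt_one {c γ : ℝ} (hγ0 : 0 < γ) (hγ : γ < 1)
    (hψ : IsSmoothGlobalSolution c γ ψ) (hφ : IsSmoothLinearSolution φ) (h : ScattersL2 ψ φ) :
    ∃ K T : ℝ, ∀ t, T ≤ t → ∀ x, rieszPotential γ (fun y => ‖ψ t y - φ t y‖ₑ * ‖φ t y‖ₑ) x ≤
      ENNReal.ofReal (K * t ^ (-γ)) := by
  obtain ⟨K, hK0, hK⟩ := hφ.exists_rieszPotential_le (h.memLp hψ hφ 0)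
    (γ := 2 * γ) (by linarith) (by linarith)
  obtain ⟨T, hT⟩ := eventually_atTop.1 (h.eventually (gt_mem_nhds one_pos))
  refine ⟨K ^ (1 / 2 : ℝ), max T 1, fun t ht x => ?_⟩
  have ht1 : 1 ≤ t := (le_max_right _ _).trans ht
  have hc1 := continuous_slice hψ.smooth t
  have hc2 := continuous_slice hφ.smooth t
  have h1 := riesz_potential_mul_le (γ := γ) x (f := fun y => ‖ψ t y - φ t y‖ₑ)
    (g := fun y => ‖φ t y‖ₑ) (by fun_prop) (by fun_prop)
  rw [← eLpNorm_two_eq (fun y => ψ t y - φ t y)] at h1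
  refine h1.trans ((mul_le_mul' (hT t ((le_max_left _ _).trans ht)).le
    (ENNReal.rpow_le_rpow (hK t ht1 x) (by norm_num))).trans_eq ?_)
  rw [one_mul, ENNReal.ofReal_rpow_of_nonneg (by positivity) (by norm_num),
    Real.mul_rpow hK0.le (by positivity), ← Real.rpow_mul (by linarith)]
  congr 3
  ring

/-- In the Coulomb case `γ = 1` the mixed potential is controlled by the decay of the free
solution and the boundedness of the Coulomb potential on `H^{s,δ}`. -/
lemma exists_mixed_potential_le_of_weighted {s δ : ℝ} (hs : 0 < s) (hδ : 0 < δ)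
    (hψ : JointlySmooth ψ) (hφ : IsSmoothLinearSolution φ) (h : ScattersWeighted s δ ψ φ) :
    ∃ K T : ℝ, ∀ t, T ≤ t → ∀ x, rieszPotential 1 (fun y => ‖ψ t y - φ t y‖ₑ * ‖φ t y‖ₑ) x ≤
      ENNReal.ofReal (K * t ^ (-1 : ℝ)) := by
  obtain ⟨C, hC0, hC⟩ := hφ.exists_decay
  obtain ⟨K, hK0, hK⟩ := exists_riesz_one_le hs hδ
  obtain ⟨T, hT⟩ := eventually_atTop.1 (h.eventually (gt_mem_nhds one_pos))
  refine ⟨C * K.toReal, max T 1, fun t ht x => ?_⟩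
  have ht1 : 1 ≤ t := (le_max_right _ _).trans ht
  have hc1 := continuous_slice hψ t
  have hc2 := continuous_slice hφ.smooth t
  calc rieszPotential 1 (fun y => ‖ψ t y - φ t y‖ₑ * ‖φ t y‖ₑ) x
      ≤ ∫⁻ y, ENNReal.ofReal (C / t) * (riesz 1 x y * ‖ψ t y - φ t y‖ₑ) :=
        lintegral_mono fun y => by
          have h1 : ‖φ t y‖ₑ ≤ ENNReal.ofReal (C / t) := by
            rw [← ofReal_norm]
            exact ENNReal.ofReal_le_ofReal (hC t ht1 y)
          calc _ ≤ riesz 1 x y * (‖ψ t y - φ t y‖ₑ * ENNReal.ofReal (C / t)) :=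
                mul_le_mul_right (mul_le_mul_right h1 _) _
            _ = _ := by ring
    _ = ENNReal.ofReal (C / t) * ∫⁻ y, riesz 1 x y * ‖ψ t y - φ t y‖ₑ :=
        lintegral_const_mul _ (by fun_prop)
    _ ≤ ENNReal.ofReal (C / t) * (K * 1) := by
        gcongr
        refine (hK x (fun y => ψ t y - φ t y) (hc1.sub hc2)).trans ?_
        gcongr
        exact (hT t ((le_max_left _ _).trans ht)).le
    _ = _ := by
        rw [mul_one, ← ENNReal.ofReal_toReal hK0, ← ENNReal.ofReal_mul (by positivity),
          ENNReal.toReal_ofReal ENNReal.toReal_nonneg, Real.rpow_neg_one]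
        congr 1
        ring

end Bounds

section Nonexistence

variable {ψ φ : ℝ → Plane → Spinor} {c γ : ℝ}

/-- If the mixed potential decays like the potential of the free density, then the scattering
state vanishes: otherwise the overlap `∫ ⟨ψ, φ⟩`, which is bounded, would receive a source of size
at least `1/t`. -/
theorem mass_eq_zero_of_scatters (hc : c ≠ 0) (hγ0 : 0 < γ) (hγ1 : γ ≤ 1)
    (hψ : IsSmoothGlobalSolution c γ ψ) (hφ : IsSmoothLinearSolution φ) (hsc : ScattersL2 ψ φ)
    (hlow : InteractionLowerBound γ φ) {K T : ℝ}
    (hmix : ∀ t, T ≤ t → ∀ x, rieszPotential γ (fun y => ‖ψ t y - φ t y‖ₑ * ‖φ t y‖ₑ) x ≤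
      ENNReal.ofReal (K * t ^ (-γ))) : mass φ 0 = 0 := by
  by_contra hm0
  have hφm := hsc.memLp hψ hφ
  obtain ⟨μ, R, hμ, hR, hball⟩ := exists_mass_ball (N := fun _ _ => 0) hφ.smooth hφ.equation
    (fun t x => by simp [dot]) hm0
  obtain ⟨θ, hθ0, -, tstar, -, hθ⟩ := hlow
  obtain ⟨K₁, hK₁0, hK₁⟩ := hφ.exists_rieszPotential_le (hφm 0) hγ0.le (by linarith : γ < 2)
  set K₀ := max K₁ K with hK₀
  have hK₀0 : 0 < K₀ := hK₁0.trans_le (le_max_left _ _)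
  set k : ℝ := (eLpNorm (φ 0) 2 volume).toReal with hk
  set n : ℝ := (eLpNorm (ψ 0) 2 volume).toReal with hn
  have hk0 : 0 ≤ k := ENNReal.toReal_nonneg
  have hn0 : 0 ≤ n := ENNReal.toReal_nonneg
  have hφk : ∀ t, eLpNorm (φ t) 2 volume = ENNReal.ofReal k := fun t => by
    have := hφ.mass_eq t 0
    unfold mass at this
    rw [eLpNorm_two_eq, this, ← eLpNorm_two_eq, hk, ENNReal.ofReal_toReal (hφm 0).2.ne]
  have hψn : ∀ t, eLpNorm (ψ t) 2 volume = ENNReal.ofReal n := fun t => by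
    have := hψ.mass_eq t 0
    unfold mass at this
    rw [eLpNorm_two_eq, this, ← eLpNorm_two_eq, hn, ENNReal.ofReal_toReal (hψ.memL2 0).2.ne]
  have hcψ := fun t => continuous_slice hψ.smooth t
  have hcφ := fun t => continuous_slice hφ.smooth t
  -- the size of the difference for which the error is absorbed by the lower bound
  obtain ⟨e, he0, he1, heK⟩ : ∃ e : ℝ, 0 < e ∧ e ≤ 1 ∧
      K₀ * (5 * (e * k) + 2 * e) ≤ θ * μ ^ 2 / 8 := by
    refine ⟨min 1 (θ * μ ^ 2 / 8 / (K₀ * (5 * k + 2))), by positivity, min_le_left _ _, ?_⟩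
    have h1 := min_le_right 1 (θ * μ ^ 2 / 8 / (K₀ * (5 * k + 2)))
    rw [le_div_iff₀ (by positivity)] at h1
    linarith
  -- a time after which all bounds hold, and `R + t ≤ 2t`
  obtain ⟨T₁, hT₁⟩ := eventually_atTop.1
    (hsc.eventually (gt_mem_nhds (ENNReal.ofReal_pos.2 he0)))
  set a : ℝ := max (max (max T T₁) (max R 1)) (tstar + 1) with ha
  have hfacts : ∀ t, a ≤ t → T ≤ t ∧ T₁ ≤ t ∧ R ≤ t ∧ 1 ≤ t ∧ tstar < t := fun t hat => by
    simp only [ha, max_le_iff] at hat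
    exact ⟨hat.1.1.1, hat.1.1.2, hat.1.2.1, hat.1.2.2, by linarith [hat.2]⟩
  have ha1 : 1 ≤ a := (hfacts a le_rfl).2.2.2.1
  have hov : ∀ t, a ≤ t →
      ∫⁻ x, ‖dot (hartree c γ (ψ t) x) (φ t x)‖ₑ ≤
        ENNReal.ofReal (|c| * K₀ * (k ^ 2 + 5 * (e * k) + 2 * e)) ∧
      c ^ 2 * (θ * μ ^ 2 / 8) * t⁻¹ ≤ (c * ∫ x, dot (hartree c γ (ψ t) x) (φ t x)).re := by
    intro t hat
    obtain ⟨hT, hT1, hRt, ht1, hts⟩ := hfacts t hat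
    have ht0 : 0 < t := by linarith
    have hw := (hT₁ t hT1).le
    have hq : ∫⁻ x, ‖ψ t x - φ t x‖ₑ ^ 2 ≤ ENNReal.ofReal e := by
      rw [lintegral_sq_eq fun x => ψ t x - φ t x]
      refine (pow_le_pow_left' hw 2).trans ?_
      rw [← ENNReal.ofReal_pow he0.le]
      exact ENNReal.ofReal_le_ofReal (by nlinarith)
    have hp : ∫⁻ x, ‖ψ t x - φ t x‖ₑ * ‖φ t x‖ₑ ≤ ENNReal.ofReal (e * k) := by
      have h1 := lintegral_mul_le_sqrt (μ := volume) (f := fun x => ‖ψ t x - φ t x‖ₑ)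
        (g := fun x => ‖φ t x‖ₑ) ((hcψ t).sub (hcφ t)).enorm.measurable.aemeasurable
        (hcφ t).enorm.measurable.aemeasurable
      rw [← eLpNorm_two_eq (fun x => ψ t x - φ t x), ← eLpNorm_two_eq, hφk] at h1
      refine h1.trans ?_
      rw [ENNReal.ofReal_mul he0.le]
      gcongr
    have hm : ∫⁻ x, ‖φ t x‖ₑ ^ 2 ≤ ENNReal.ofReal (k ^ 2) := by
      rw [lintegral_sq_eq, hφk, ENNReal.ofReal_pow hk0]
    have htγ : 0 < t ^ (-γ) := Real.rpow_pos_of_pos ht0 _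
    have htγ1 : t ^ (-γ) ≤ 1 := Real.rpow_le_one_of_one_le_of_nonpos ht1 (by linarith)
    obtain ⟨h1, h2⟩ := overlap_bounds c hγ0 (by linarith) (hcψ t) (hcφ t) (hψ.memL2 t) (hφm t)
      (A := K₀ * t ^ (-γ)) (by positivity) (sq_nonneg k) (by positivity) he0.le
      (fun x => (hK₁ t ht1 x).trans (ENNReal.ofReal_le_ofReal (by
        gcongr; exact le_max_left _ _)))
      (fun x => (hmix t hT x).trans (ENNReal.ofReal_le_ofReal (by
        gcongr; exact le_max_right _ _))) hm hp hq
    refine ⟨h1.trans (ENNReal.ofReal_le_ofReal ?_), ?_⟩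
    · have : |c| * (K₀ * t ^ (-γ)) ≤ |c| * K₀ :=
        mul_le_mul_of_nonneg_left (mul_le_of_le_one_right hK₀0.le htγ1) (abs_nonneg c)
      exact mul_le_mul_of_nonneg_right this (by positivity)
    · refine le_trans ?_ (h2 θ (R + t) μ hθ0.le (by positivity) hμ.le (hθ t hts)
        (hball t ht0.le))
      rw [mul_assoc]
      refine mul_le_mul_of_nonneg_left ?_ (sq_nonneg c)
      have h3 : 1 / 4 * t ^ (-γ) ≤ (2 * (R + t)) ^ (-γ) := by
        calc 1 / 4 * t ^ (-γ) ≤ 4 ^ (-γ) * t ^ (-γ) := by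
              gcongr
              calc (1 / 4 : ℝ) = 4 ^ (-1 : ℝ) := by rw [Real.rpow_neg_one]; norm_num
                _ ≤ 4 ^ (-γ) := Real.rpow_le_rpow_of_exponent_le (by norm_num) (by linarith)
          _ = (4 * t) ^ (-γ) := (Real.mul_rpow (by norm_num) ht0.le).symm
          _ ≤ _ := Real.rpow_le_rpow_of_nonpos (by positivity) (by linarith) (by linarith)
      have h4 : t⁻¹ ≤ t ^ (-γ) := by
        rw [← Real.rpow_neg_one]
        exact Real.rpow_le_rpow_of_exponent_le ht1 (by linarith)
      have h5 : θ * (1 / 4 * t ^ (-γ) * μ ^ 2) ≤ θ * ((2 * (R + t)) ^ (-γ) * μ ^ 2) := by gcongr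
      have h6 := mul_le_mul_of_nonneg_right heK htγ.le
      have h7 : θ * μ ^ 2 / 8 * t⁻¹ ≤ θ * μ ^ 2 / 8 * t ^ (-γ) := by gcongr
      linarith
  set κ : ℝ := c ^ 2 * (θ * μ ^ 2 / 8) with hκ
  have hκ0 : 0 < κ := by positivity
  set M : ℝ := n * k with hM
  have hMt : ∀ t, ∫⁻ x, ‖ψ t x‖ₑ * ‖φ t x‖ₑ ≤ ENNReal.ofReal M := fun t => by
    have h1 := lintegral_mul_le_sqrt (μ := volume) (f := fun x => ‖ψ t x‖ₑ)
      (g := fun x => ‖φ t x‖ₑ) (hcψ t).enorm.measurable.aemeasurable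
      (hcφ t).enorm.measurable.aemeasurable
    rw [← eLpNorm_two_eq, ← eLpNorm_two_eq, hφk, hψn, ← ENNReal.ofReal_mul hn0] at h1
    exact h1
  -- the source integrates to a divergent logarithm, while the overlap stays bounded by `M`;
  -- `L` is chosen so that `κ L` exceeds `2 |c| M`
  set L : ℝ := (2 * |c| * M + 1) / κ with hL
  have hL0 : 0 ≤ L := by positivity
  set b : ℝ := a * Real.exp L with hb
  have ha0 : 0 < a := by linarith
  have hab : a ≤ b := le_mul_of_one_le_right ha0.le (Real.one_le_exp hL0)
  obtain ⟨hint, hbound⟩ := norm_integral_overlap_le hψ.smooth hφ.smooth hψ.equation hφ.equation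
    (B := |c| * K₀ * (k ^ 2 + 5 * (e * k) + 2 * e)) hab (by positivity) hMt (by positivity)
    fun t ht => (hov t ht.1).1
  have hlog : ∫ t in a..b, κ * t⁻¹ = κ * L := by
    rw [intervalIntegral.integral_const_mul, integral_inv_of_pos ha0 (by positivity), hb,
      mul_div_cancel_left₀ _ ha0.ne', Real.log_exp]
  have hinvI : IntervalIntegrable (fun t : ℝ => κ * t⁻¹) volume a b := by
    refine (intervalIntegral.intervalIntegrable_inv (fun t ht => ?_) continuousOn_id).const_mul κ
    rw [Set.uIcc_of_le hab] at ht
    exact (ha0.trans_le ht.1).ne'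
  have hreI : IntervalIntegrable
      (fun t => (c * ∫ x, dot (hartree c γ (ψ t) x) (φ t x)).re) volume a b := by
    have h1 := hint.const_mul (c : ℂ)
    exact ⟨h1.1.re, h1.2.re⟩
  have h1 : κ * L ≤ ∫ t in a..b, (c * ∫ x, dot (hartree c γ (ψ t) x) (φ t x)).re := by
    rw [← hlog]
    exact intervalIntegral.integral_mono_on hab hinvI hreI fun t ht => (hov t ht.1).2
  have h2 : ∫ t in a..b, (c * ∫ x, dot (hartree c γ (ψ t) x) (φ t x)).re =
      (c * ∫ t in a..b, ∫ x, dot (hartree c γ (ψ t) x) (φ t x)).re := by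
    rw [← intervalIntegral.integral_const_mul]
    have := Complex.reCLM.intervalIntegral_comp_comm (hint.const_mul (c : ℂ))
    simpa using this
  have h3 : (c * ∫ t in a..b, ∫ x, dot (hartree c γ (ψ t) x) (φ t x)).re ≤ |c| * (2 * M) := by
    refine (Complex.re_le_norm _).trans ?_
    rw [norm_mul, Complex.norm_real, Real.norm_eq_abs]
    gcongr
  have h4 : κ * L = 2 * |c| * M + 1 := by rw [hL]; field_simp
  linarith

/-- Once the scattering state has zero mass, conservation of mass forces the solution to vanish. -/
theorem eq_zero_of_scatters (hc : c ≠ 0) (hγ0 : 0 < γ) (hγ1 : γ ≤ 1)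
    (hψ : IsSmoothGlobalSolution c γ ψ) (hφ : IsSmoothLinearSolution φ) (hsc : ScattersL2 ψ φ)
    (hlow : InteractionLowerBound γ φ) {K T : ℝ}
    (hmix : ∀ t, T ≤ t → ∀ x, rieszPotential γ (fun y => ‖ψ t y - φ t y‖ₑ * ‖φ t y‖ₑ) x ≤
      ENNReal.ofReal (K * t ^ (-γ))) : (∀ t x, ψ t x = 0) ∧ (∀ t x, φ t x = 0) := by
  have h0 := mass_eq_zero_of_scatters hc hγ0 hγ1 hψ hφ hsc hlow hmix
  have hφ0 : ∀ t x, φ t x = 0 := fun t =>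
    (mass_eq_zero_iff hφ.smooth t).1 ((hφ.mass_eq t 0).trans h0)
  refine ⟨fun t => (mass_eq_zero_iff hψ.smooth t).1 ?_, hφ0⟩
  have h1 : Tendsto (fun s => mass ψ s) atTop (𝓝 0) := by
    have h2 := (ENNReal.continuous_pow 2).tendsto 0 |>.comp hsc
    rw [zero_pow two_ne_zero] at h2
    refine h2.congr fun s => ?_
    simp only [Function.comp, hφ0, sub_zero]
    exact (lintegral_sq_eq (ψ s)).symm
  simp only [fun s => hψ.mass_eq s t] at h1
  exact tendsto_nhds_unique tendsto_const_nhds h1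

end Nonexistence

end HartreeDirac

end

theorem theorem1p2 (c : ℝ) (hc : c ≠ 0) :
    (∀ γ : ℝ, 0 < γ → γ < 1 → ∀ ψ φ : ℝ → HartreeDirac.Plane → HartreeDirac.Spinor,
      HartreeDirac.IsSmoothGlobalSolution c γ ψ →
      HartreeDirac.IsSmoothLinearSolution φ →
      HartreeDirac.ScattersL2 ψ φ →
      HartreeDirac.InteractionLowerBound γ φ →
      (∀ t x, ψ t x = 0) ∧ (∀ t x, φ t x = 0)) ∧
    (∀ s δ : ℝ, 0 < s → 0 < δ → ∀ ψ φ : ℝ → HartreeDirac.Plane → HartreeDirac.Spinor,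
      HartreeDirac.IsSmoothGlobalSolution c 1 ψ →
      HartreeDirac.IsSmoothLinearSolution φ →
      HartreeDirac.ScattersWeighted s δ ψ φ →
      HartreeDirac.InteractionLowerBound 1 φ →
      (∀ t x, ψ t x = 0) ∧ (∀ t x, φ t x = 0)) := by
  refine ⟨fun γ hγ0 hγ1 ψ φ hψ hφ hsc hlow => ?_, fun s δ hs hδ ψ φ hψ hφ hsc hlow => ?_⟩
  · obtain ⟨K, T, h⟩ := HartreeDirac.exists_mixed_potential_le_of_lt_one hγ0 hγ1 hψ hφ hsc
    exact HartreeDirac.eq_zero_of_scatters hc hγ0 hγ1.le hψ hφ hsc hlow h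
  · obtain ⟨K, T, h⟩ := HartreeDirac.exists_mixed_potential_le_of_weighted hs hδ hψ.smooth hφ hsc
    have hsc' : HartreeDirac.ScattersL2 ψ φ :=
      tendsto_of_tendsto_of_tendsto_of_le_of_le tendsto_const_nhds hsc (fun _ => zero_le)
        fun t => HartreeDirac.eLpNorm_le_weightedSobolevNorm s hδ _
    exact HartreeDirac.eq_zero_of_scatters hc one_pos le_rfl hψ hφ hsc' hlow h
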